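/- Fix an o-minimal structure on $(\mathbb R,<)$, that is, Boolean algebras $\mathcal O_n$ of subsets of $\mathbb R^n$ ($n\ge 0$), whose members are called definable, which contain the diagonals $\{x_i=x_j\}$ and the order relation $\{x_1<x_2\}$, are closed under products and projections, and such that $\mathcal O_1$ consists exactly of the finite unions of points and intervals. For a definable set $A$ let $\chi(A)=\sum_j(-1)^{\dim\sigma_j}$, where $A$ is decomposed into finitely many disjoint definable pieces homeomorphic to open simplices $\sigma_j$ (the value does not depend on the decomposition). For an integer-valued, compactly supported function $g$ on a definable set $X$, all of whose level sets are definable, let $\int_X g\,d\chi=\sum_{s\in\mathbb Z}s\,\chi\{g=s\}$, and for a compactly supported definable function $h:X\to\mathbb R$ (one whose graph is definable) let $$\int_X h\,\lfloor d\chi\rfloor=\lim_{m\to\infty}\frac1m\int_X\lfloor mh\rfloor\,d\chi,\qquad \int_X h\,\lceil d\chi\rceil=\lim_{m\to\infty}\frac1m\int_X\lceil mh\rceil\,d\chi .$$ Let $M\subseteq\mathbb R^n$ be a definable set that, with the subspace topology, is a 1-dimensional topological manifold (without boundary, not necessarily compact or connected), and let $h:M\to\mathbb R$ be continuous, definable and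 compactly supported. Let $\operatorname{totvar}(h)$ be the supremum, over all finite families of arcs in $M$ with pairwise disjoint relative interiors, of the sum of the absolute differences of the values of $h$ at the two endpoints of each arc. Then $\operatorname{totvar}(h)$ is finite, both limits exist, and $$\int_M h\,\lfloor d\chi\rfloor=-\int_M h\,\lceil d\chi\rceil=\tfrac12\operatorname{totvar}(h).$$ -/

import Mathlib

open Filter Topology
open scoped ENNReal

noncomputable section

/-- An o-minimal structure on the ordered set `(ℝ, <)`: a sequence of Boolean algebras `Def n` of
subsets of `ℝⁿ` (the definable sets) that contains the diagonals and the order relation, is closed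
under products and projections, and whose members in dimension one are exactly the finite unions
of points and intervals. The order-connected subsets of `ℝ` are the empty set, the points and the
intervals of all kinds. -/
structure OMinimalStructure where
  /-- the definable subsets of `ℝⁿ` -/
  Def : (n : ℕ) → Set (Set (Fin n → ℝ))
  empty_mem : ∀ n : ℕ, (∅ : Set (Fin n → ℝ)) ∈ Def n
  compl_mem : ∀ (n : ℕ) (A : Set (Fin n → ℝ)), A ∈ Def n → Aᶜ ∈ Def n
  union_mem : ∀ (n : ℕ) (A B : Set (Fin n → ℝ)), A ∈ Def n → B ∈ Def n → A ∪ B ∈ Def n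
  prod_mem : ∀ (m n : ℕ) (A : Set (Fin m → ℝ)) (B : Set (Fin n → ℝ)), A ∈ Def m → B ∈ Def n →
    {x : Fin (m + n) → ℝ |
      (fun i : Fin m => x (Fin.castAdd n i)) ∈ A ∧
      (fun j : Fin n => x (Fin.natAdd m j)) ∈ B} ∈ Def (m + n)
  proj_mem : ∀ (n : ℕ) (A : Set (Fin (n + 1) → ℝ)), A ∈ Def (n + 1) →
    (fun (x : Fin (n + 1) → ℝ) (i : Fin n) => x i.castSucc) '' A ∈ Def n
  diag_mem : ∀ (n : ℕ) (i j : Fin n), {x : Fin n → ℝ | x i = x j} ∈ Def n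
  lt_mem : {x : Fin 2 → ℝ | x 0 < x 1} ∈ Def 2
  mem_one_iff : ∀ A : Set (Fin 1 → ℝ), A ∈ Def 1 ↔
    ∃ F : Set (Set ℝ), F.Finite ∧ (∀ I ∈ F, I.OrdConnected) ∧
      A = {x : Fin 1 → ℝ | x 0 ∈ ⋃₀ F}

/-- The (standard) open `k`-simplex, in barycentric coordinates. -/
def openSimplex (k : ℕ) : Set (Fin (k + 1) → ℝ) :=
  {w | (∀ i, 0 < w i) ∧ ∑ i, w i = 1}

namespace OMinimalStructure

/-- A function on a subset of `ℝⁿ` is definable if its graph, a subset of `ℝⁿ⁺¹`, is. -/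
def IsDefinableFun (O : OMinimalStructure) {n : ℕ} {X : Set (Fin n → ℝ)} (h : X → ℝ) : Prop :=
  {x : Fin (n + 1) → ℝ |
    ∃ p : X, (∀ i : Fin n, x i.castSucc = (p : Fin n → ℝ) i) ∧ x (Fin.last n) = h p} ∈ O.Def (n + 1)

/-- `A` is a finite disjoint union of definable pieces `C i`, each homeomorphic to an open simplex
of dimension `d i`, and `c = ∑ i, (-1) ^ d i`. The homeomorphisms are not asked to be definable:
in the structure of piecewise linear sets, for example, there is no definable homeomorphism of
the half line with a bounded interval. -/
def HasEulerChar (O : OMinimalStructure) {n : ℕ} (A : Set (Fin n → ℝ)) (c : ℤ) : Prop :=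
  ∃ (k : ℕ) (C : Fin k → Set (Fin n → ℝ)) (d : Fin k → ℕ),
    (∀ i, C i ∈ O.Def n) ∧
    (∀ i, Nonempty (C i ≃ₜ openSimplex (d i))) ∧
    Pairwise (fun i j => Disjoint (C i) (C j)) ∧
    (⋃ i, C i) = A ∧
    c = ∑ i, (-1 : ℤ) ^ d i

open Classical in
/-- The Euler characteristic of a definable set; it does not depend on the decomposition. -/
def eulerChar (O : OMinimalStructure) {n : ℕ} (A : Set (Fin n → ℝ)) : ℤ :=
  if hA : ∃ c : ℤ, O.HasEulerChar A c then hA.choose else 0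

/-- The Euler integral `∫_X g dχ = ∑ s, s * χ {g = s}` of an integer-valued function. -/
def eulerIntegral (O : OMinimalStructure) {n : ℕ} {X : Set (Fin n → ℝ)} (g : X → ℤ) : ℤ :=
  ∑ᶠ s : ℤ, s * O.eulerChar ((fun p : X => (p : Fin n → ℝ)) '' {p : X | g p = s})

/-- `∫_X h ⌊dχ⌋` exists and equals `I`: it is the limit of `(1 / m) ∫_X ⌊m h⌋ dχ`. -/
def HasFloorIntegral (O : OMinimalStructure) {n : ℕ} {X : Set (Fin n → ℝ)} (h : X → ℝ)
    (I : ℝ) : Prop :=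
  Tendsto (fun m : ℕ => (1 / (m : ℝ)) * (O.eulerIntegral (fun p : X => ⌊(m : ℝ) * h p⌋) : ℝ))
    atTop (𝓝 I)

/-- `∫_X h ⌈dχ⌉` exists and equals `I`: it is the limit of `(1 / m) ∫_X ⌈m h⌉ dχ`. -/
def HasCeilIntegral (O : OMinimalStructure) {n : ℕ} {X : Set (Fin n → ℝ)} (h : X → ℝ)
    (I : ℝ) : Prop :=
  Tendsto (fun m : ℕ => (1 / (m : ℝ)) * (O.eulerIntegral (fun p : X => ⌈(m : ℝ) * h p⌉) : ℝ))
    atTop (𝓝 I)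

end OMinimalStructure

/-- The total variation of a function on a one-dimensional manifold: the supremum, over all finite
families of non-overlapping arcs (injective paths whose relative interiors are disjoint), of the
sum of the absolute differences of the values at the two endpoints. -/
def manifoldTotalVariation {X : Type*} [TopologicalSpace X] (h : X → ℝ) : ℝ≥0∞ :=
  ⨆ (k : ℕ) (γ : Fin k → C(unitInterval, X))
    (_ : ∀ i, Function.Injective (γ i))
    (_ : Pairwise fun i j => Disjoint (γ i '' Set.Ioo 0 1) (γ j '' Set.Ioo 0 1)),
    ∑ i, ENNReal.ofReal |h (γ i 1) - h (γ i 0)|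

end

/-!
Let `W = {h ≠ 0}`, an open definable subset of a compact part of `M`. The proof decomposes `W` into
a finite set `P` of points and a finite set `𝒞` of definable open arcs on which `h` and all
coordinates are constant or injective, and computes every term of the theorem from the
decomposition.

*Existence of the decomposition.* No general cell decomposition is needed; the argument rests on the
fact that a countable definable set is finite (`OMinimalStructure.finite_of_countable`). A definable
set with finite fibres over a coordinate contains a definable section
(`OMinimalStructure.exists_section`), and a section has countably many, hence finitely many,
discontinuities. So an infinite definable set contains an arc, and by invariance of domain in
dimension one the frontier in `M` of a definable set is finite
(`OMinimalStructure.DefSub.finite_frontier`). It follows that a definable function has finitely many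
turning points: the values at local extrema are countably many, and an extremum near which the
function is not constant is on the frontier of its level set. Away from its turning points a
continuous function on an arc is constant or injective. Fibres of a coordinate over a compact set
are then uniformly finite, off the turning points and the places of local constancy, and sections
can be split off one at a time (`OMinimalStructure.hasDefDecomp_of_subset_isCompact`).

*The Euler characteristic.* A simplex of dimension at least two does not embed in a one-dimensional
manifold, so the pieces in the definition of `χ` are points and arcs. The number of points minus
the number of arcs does not depend on the decomposition: after passing to a common set of points the
arcs are the connected components of the rest (`IsArcDecomp.card_sub_card_eq`). Hence `χ` is
additive, and since a proper nonempty superlevel set of `h` in an arc is a half-open arc,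
`∫ ⌊m h⌋ dχ = ∑ p ∈ P, ⌊m h p⌋ - ∑ C ∈ 𝒞, ⌊m inf_C h⌋` (`OMinimalStructure.eulerIntegral_floor`).
Dividing by `m` gives the floor integral `∑ p ∈ P, h p - ∑ C ∈ 𝒞, inf_C h`; the same formula for
`-h` gives the ceiling integral `∑ p ∈ P, h p - ∑ C ∈ 𝒞, sup_C h`.

*Comparison.* Each arc has two ends, with limits in `M`, at which `h` takes the values `inf_C h` and
`sup_C h`. Each point of `P` lies in the open set `W`, so exactly two ends of arcs arrive at it,
one from each side, while `h` vanishes at the ends outside `W`. Counting ends in two ways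
(`IsArcDecomp.sum_ends`) yields `∑ C ∈ 𝒞, (inf_C h + sup_C h) = 2 * ∑ p ∈ P, h p`, which makes the
two integrals opposite to each other and the first equal to half of `∑ C ∈ 𝒞, (sup_C h - inf_C h)`.
The last sum is the total variation. It is approached by closed subarcs of the arcs in `𝒞`; and it
bounds the variation along every family of arcs, because for almost every `y` the arcs of the family
that pass through the value `y` between their endpoints do so on distinct members of `𝒞`.
-/

/-! ### Definable predicates -/

namespace OMinimalStructure

variable (O : OMinimalStructure)

theorem univ_mem (n : ℕ) : Set.univ ∈ O.Def n := by
  simpa using O.compl_mem n ∅ (O.empty_mem n)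

theorem inter_mem {n : ℕ} {A B : Set (Fin n → ℝ)} (hA : A ∈ O.Def n) (hB : B ∈ O.Def n) :
    A ∩ B ∈ O.Def n := by
  have := O.compl_mem n _ (O.union_mem n _ _ (O.compl_mem n _ hA) (O.compl_mem n _ hB))
  simpa [Set.compl_union] using this

theorem iInter_mem {n : ℕ} {κ : Type} [Finite κ] (A : κ → Set (Fin n → ℝ))
    (hA : ∀ k, A k ∈ O.Def n) : (⋂ k, A k) ∈ O.Def n := by
  classical
  have := Fintype.ofFinite κ
  have key : ∀ s : Finset κ, (⋂ k ∈ s, A k) ∈ O.Def n := by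
    intro s
    induction s using Finset.induction_on with
    | empty => simpa using O.univ_mem n
    | insert a s _ ih =>
      rw [Finset.set_biInter_insert]
      exact O.inter_mem (hA a) ih
  simpa using key Finset.univ

theorem image_castAdd_mem {n : ℕ} (m : ℕ) (A : Set (Fin (n + m) → ℝ)) (hA : A ∈ O.Def (n + m)) :
    (fun (x : Fin (n + m) → ℝ) (i : Fin n) => x (Fin.castAdd m i)) '' A ∈ O.Def n := by
  induction m with
  | zero => simpa using hA
  | succ m ih =>
    have := ih _ (O.proj_mem (n + m) A hA)
    rw [Set.image_image] at this
    exact this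

/-- Definability is stable under pulling back along any map of the coordinates: permuting,
repeating, and adding coordinates. -/
theorem reindex_mem {m n : ℕ} {A : Set (Fin m → ℝ)} (hA : A ∈ O.Def m) (f : Fin m → Fin n) :
    {x : Fin n → ℝ | (fun i => x (f i)) ∈ A} ∈ O.Def n := by
  have h1 := O.prod_mem n m _ _ (O.univ_mem n) hA
  have h2 := O.iInter_mem (fun i : Fin m => {x : Fin (n + m) → ℝ |
    x (Fin.natAdd n i) = x (Fin.castAdd m (f i))}) (fun i => O.diag_mem _ _ _)
  have h3 := O.image_castAdd_mem m _ (O.inter_mem h1 h2)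
  convert h3 using 1
  ext x
  simp only [Set.mem_ofPred_eq, Set.mem_image, Set.mem_inter_iff, Set.mem_iInter, Set.mem_univ,
    true_and]
  constructor
  · intro hx
    refine ⟨Fin.append x (fun i => x (f i)), ⟨by simpa using hx, by simp⟩, by ext; simp⟩
  · rintro ⟨y, ⟨h1, h2⟩, rfl⟩
    simp only [h2] at h1
    exact h1

/-- A predicate on real tuples indexed by a finite type is definable if the set it cuts out is,
after some enumeration of the index type. -/
def DefPred {ι : Type} (P : (ι → ℝ) → Prop) : Prop :=
  ∃ (m : ℕ) (e : ι ≃ Fin m), {x : Fin m → ℝ | P (fun i => x (e i))} ∈ O.Def m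

variable {O}

theorem defPred_iff_mem {n : ℕ} {A : Set (Fin n → ℝ)} :
    O.DefPred (fun x => x ∈ A) ↔ A ∈ O.Def n := by
  constructor
  · rintro ⟨m, e, h⟩
    have := O.reindex_mem h e.symm
    simp only [Set.mem_ofPred_eq, Equiv.symm_apply_apply] at this
    exact this
  · intro h
    exact ⟨n, Equiv.refl _, h⟩

namespace DefPred

variable {ι κ : Type}

theorem comp [Finite ι] {P : (κ → ℝ) → Prop} (h : O.DefPred P) (f : κ → ι) :
    O.DefPred (fun x : ι → ℝ => P (fun k => x (f k))) := by
  obtain ⟨m, e, h⟩ := h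
  obtain ⟨n, ⟨e'⟩⟩ := Finite.exists_equiv_fin ι
  refine ⟨n, e', ?_⟩
  have := O.reindex_mem h (fun i => e' (f (e.symm i)))
  simpa using this

theorem mem [Finite ι] {n : ℕ} {A : Set (Fin n → ℝ)} (hA : A ∈ O.Def n) (f : Fin n → ι) :
    O.DefPred (fun x : ι → ℝ => (fun k => x (f k)) ∈ A) :=
  (defPred_iff_mem.2 hA).comp f

/-- A definable predicate can be read in any enumeration of its index type. -/
theorem mem_def {P : (ι → ℝ) → Prop} (h : O.DefPred P) {n : ℕ} (f : ι → Fin n) :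
    {x : Fin n → ℝ | P (fun i => x (f i))} ∈ O.Def n :=
  defPred_iff_mem.1 (h.comp f)

theorem not {P : (ι → ℝ) → Prop} (h : O.DefPred P) : O.DefPred (fun x => ¬ P x) := by
  obtain ⟨m, e, h⟩ := h
  exact ⟨m, e, O.compl_mem _ _ h⟩

theorem and {P Q : (ι → ℝ) → Prop} (hP : O.DefPred P) (hQ : O.DefPred Q) :
    O.DefPred (fun x => P x ∧ Q x) := by
  obtain ⟨m, e, h⟩ := hP
  exact ⟨m, e, O.inter_mem h (hQ.mem_def e)⟩

theorem or {P Q : (ι → ℝ) → Prop} (hP : O.DefPred P) (hQ : O.DefPred Q) :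
    O.DefPred (fun x => P x ∨ Q x) := by
  have := (hP.not.and hQ.not).not
  simpa only [not_and_or, not_not] using this

theorem imp {P Q : (ι → ℝ) → Prop} (hP : O.DefPred P) (hQ : O.DefPred Q) :
    O.DefPred (fun x => P x → Q x) := by
  have := hP.not.or hQ
  simpa only [imp_iff_not_or] using this

theorem forall_fin {n : ℕ} [Finite ι] {P : Fin n → (ι → ℝ) → Prop} (hP : ∀ i, O.DefPred (P i)) :
    O.DefPred (fun x => ∀ i, P i x) := by
  obtain ⟨m, ⟨e⟩⟩ := Finite.exists_equiv_fin ι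
  refine ⟨m, e, ?_⟩
  have := O.iInter_mem _ (fun i => (hP i).mem_def e)
  convert this using 1
  ext x; simp

theorem ex [Finite ι] [Finite κ] {P : (ι → ℝ) → (κ → ℝ) → Prop}
    (h : O.DefPred (fun z : ι ⊕ κ → ℝ => P (fun i => z (Sum.inl i)) (fun k => z (Sum.inr k)))) :
    O.DefPred (fun x => ∃ y, P x y) := by
  obtain ⟨m, ⟨e⟩⟩ := Finite.exists_equiv_fin ι
  obtain ⟨k, ⟨e'⟩⟩ := Finite.exists_equiv_fin κ
  refine ⟨m, e, ?_⟩
  have := O.image_castAdd_mem k _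
    (h.mem_def (Sum.elim (fun i => Fin.castAdd k (e i)) (fun j => Fin.natAdd m (e' j))))
  convert this using 1
  ext x
  simp only [Set.mem_ofPred_eq, Set.mem_image, Sum.elim_inl, Sum.elim_inr]
  constructor
  · rintro ⟨y, hy⟩
    exact ⟨Fin.append x (fun j => y (e'.symm j)), by simpa using hy, by ext; simp⟩
  · rintro ⟨z, hz, rfl⟩
    exact ⟨_, hz⟩

theorem all [Finite ι] [Finite κ] {P : (ι → ℝ) → (κ → ℝ) → Prop}
    (h : O.DefPred (fun z : ι ⊕ κ → ℝ => P (fun i => z (Sum.inl i)) (fun k => z (Sum.inr k)))) :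
    O.DefPred (fun x => ∀ y, P x y) := by
  have := (DefPred.ex (P := fun x y => ¬ P x y) h.not).not
  simpa only [not_exists, not_not] using this

theorem exReal [Finite ι] {P : (ι → ℝ) → ℝ → Prop}
    (h : O.DefPred (fun z : ι ⊕ Unit → ℝ => P (fun i => z (Sum.inl i)) (z (Sum.inr ())))) :
    O.DefPred (fun x => ∃ y, P x y) := by
  have := DefPred.ex (P := fun x (y : Unit → ℝ) => P x (y ())) h
  convert this using 3 with x
  exact ⟨fun ⟨y, hy⟩ => ⟨fun _ => y, hy⟩, fun ⟨y, hy⟩ => ⟨y (), hy⟩⟩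

theorem lt [Finite ι] (i j : ι) : O.DefPred (fun x : ι → ℝ => x i < x j) := by
  have := DefPred.mem O.lt_mem (ι := ι) ![i, j]
  simpa using this

theorem le [Finite ι] (i j : ι) : O.DefPred (fun x : ι → ℝ => x i ≤ x j) := by
  have := (DefPred.lt (O := O) j i).not
  simpa only [not_lt] using this

theorem eq [Finite ι] (i j : ι) : O.DefPred (fun x : ι → ℝ => x i = x j) := by
  have := (DefPred.le (O := O) i j).and (DefPred.le j i)
  simpa only [← le_antisymm_iff] using this

theorem mem_of_ordConnected [Finite ι] (i : ι) {I : Set ℝ} (hI : I.OrdConnected) :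
    O.DefPred (fun x : ι → ℝ => x i ∈ I) := by
  have h1 : {x : Fin 1 → ℝ | x 0 ∈ I} ∈ O.Def 1 :=
    (O.mem_one_iff _).2 ⟨{I}, by simp, by simpa using hI, by simp⟩
  exact DefPred.mem h1 (fun _ => i)

theorem eqConst [Finite ι] (i : ι) (c : ℝ) : O.DefPred (fun x : ι → ℝ => x i = c) :=
  mem_of_ordConnected i (Set.ordConnected_singleton (a := c))

end DefPred

/-! ### Definable sets on the line, and countable definable sets -/

theorem _root_.Set.OrdConnected.finite_frontier {I : Set ℝ} (hI : I.OrdConnected) :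
    (frontier I).Finite := by
  have key := (isPreconnected_iff_ordConnected.2 hI).mem_intervals
  generalize sInf I = a, sSup I = b at key
  rcases key with rfl | rfl | rfl | rfl | rfl | rfl | rfl | rfl | rfl | rfl | rfl
  · rcases le_or_gt a b with h | h
    · simp [frontier_Icc h]
    · simp [Set.Icc_eq_empty_of_lt h]
  · rcases lt_or_ge a b with h | h
    · simp [frontier_Ico h]
    · simp [Set.Ico_eq_empty_of_le h]
  · rcases lt_or_ge a b with h | h
    · simp [frontier_Ioc h]
    · simp [Set.Ioc_eq_empty_of_le h]
  · rcases lt_or_ge a b with h | h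
    · simp [frontier_Ioo h]
    · simp [Set.Ioo_eq_empty_of_le h]
  all_goals simp

theorem finite_frontier_sUnion {F : Set (Set ℝ)} (hF : F.Finite) (h : ∀ I ∈ F, I.OrdConnected) :
    (frontier (⋃₀ F)).Finite := by
  induction F, hF using Set.Finite.induction_on with
  | empty => simp
  | @insert I F _ _ ih =>
    rw [Set.sUnion_insert]
    refine (((h I (by simp)).finite_frontier).union
      (ih fun J hJ => h J (by simp [hJ]))).subset ?_
    refine (frontier_union_subset _ _).trans ?_
    exact Set.union_subset_union Set.inter_subset_left Set.inter_subset_right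

/-- Definable subsets of the line, without the detour through one-element tuples. -/
def DefReal (O : OMinimalStructure) (J : Set ℝ) : Prop := O.DefPred (fun x : Unit → ℝ => x () ∈ J)

variable {O : OMinimalStructure}

theorem DefReal.finite_frontier {J : Set ℝ} (h : O.DefReal J) : (frontier J).Finite := by
  obtain ⟨F, hF, hI, hJ⟩ := (O.mem_one_iff _).1 (h.mem_def (fun _ => (0 : Fin 1)))
  have : J = ⋃₀ F := by
    ext t
    exact Set.ext_iff.1 hJ (fun _ => t)
  rw [this]
  exact finite_frontier_sUnion hF hI

theorem DefReal.exists_Ioo_subset {J : Set ℝ} (h : O.DefReal J) (hJ : J.Infinite) {T : Set ℝ}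
    (hT : T.Finite) : ∃ a b, a < b ∧ Set.Ioo a b ⊆ J \ T := by
  obtain ⟨t, htJ, ht⟩ := (hJ.sdiff (h.finite_frontier.union hT)).nonempty
  simp only [Set.mem_union, not_or] at ht
  have h1 : J ∈ 𝓝 t := by
    rw [mem_interior_iff_mem_nhds.symm]
    by_contra h2
    exact ht.1 ⟨subset_closure htJ, h2⟩
  have h2 : J \ T ∈ 𝓝 t := Filter.inter_mem h1 (hT.isClosed.isOpen_compl.mem_nhds ht.2)
  obtain ⟨a, b, h3, h4⟩ := mem_nhds_iff_exists_Ioo_subset.1 h2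
  exact ⟨a, b, h3.1.trans h3.2, h4⟩

theorem DefReal.finite_of_countable {J : Set ℝ} (h : O.DefReal J) (hJ : J.Countable) :
    J.Finite := by
  by_contra hinf
  obtain ⟨a, b, hab, h1⟩ := h.exists_Ioo_subset hinf Set.finite_empty
  exact Cardinal.Real.Ioo_countable_iff.1 (hJ.mono (h1.trans Set.sdiff_subset)) |>.not_gt hab

theorem DefReal.image {n : ℕ} {A : Set (Fin n → ℝ)} (hA : A ∈ O.Def n) (i : Fin n) :
    O.DefReal ((fun p => p i) '' A) := by
  have : O.DefPred (fun x : Unit → ℝ => ∃ p : Fin n → ℝ, p ∈ A ∧ p i = x ()) :=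
    DefPred.ex ((DefPred.mem hA Sum.inr).and (DefPred.eq (Sum.inr i) (Sum.inl ())))
  exact this

/-- A countable definable set is finite, since each of its coordinate projections is. -/
theorem finite_of_countable {n : ℕ} {A : Set (Fin n → ℝ)} (hA : A ∈ O.Def n)
    (h : A.Countable) : A.Finite := by
  refine (Set.Finite.pi' (t := fun i => (fun p => p i) '' A) fun i =>
    (DefReal.image hA i).finite_of_countable (h.image _)).subset ?_
  intro p hp i
  exact ⟨p, hp, rfl⟩

end OMinimalStructure

/-! ### Arcs in one-dimensional manifolds -/

section OneManifold

variable {X : Type*} [TopologicalSpace X]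

/-- An open arc: the image of a bounded open interval under a continuous injection. In a
one-dimensional manifold such an injection is a homeomorphism onto an open set. -/
def IsArc (C : Set X) : Prop :=
  ∃ (a b : ℝ) (γ : ℝ → X), a < b ∧ ContinuousOn γ (Set.Ioo a b) ∧ Set.InjOn γ (Set.Ioo a b) ∧
    γ '' Set.Ioo a b = C

theorem IsArc.image_Ioo {a b c d : ℝ} {γ : ℝ → X} (hcd : c < d) (hc : ContinuousOn γ (Set.Ioo a b))
    (hi : Set.InjOn γ (Set.Ioo a b)) (h : Set.Ioo c d ⊆ Set.Ioo a b) : IsArc (γ '' Set.Ioo c d) :=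
  ⟨c, d, γ, hcd, hc.mono h, hi.mono h, rfl⟩

theorem IsArc.nonempty {C : Set X} (h : IsArc C) : C.Nonempty := by
  obtain ⟨a, b, γ, hab, -, -, rfl⟩ := h
  exact (Set.nonempty_Ioo.2 hab).image _

theorem IsArc.isPreconnected {C : Set X} (h : IsArc C) : IsPreconnected C := by
  obtain ⟨a, b, γ, hab, hc, -, rfl⟩ := h
  exact isPreconnected_Ioo.image _ hc

/-! ### Decompositions into points and arcs -/

/-- `A` is the disjoint union of the finite set `P` of points and the finite set `𝒞` of arcs. -/
structure IsArcDecomp (A : Set X) (P : Finset X) (𝒞 : Finset (Set X)) : Prop where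
  union_eq : (P : Set X) ∪ ⋃₀ (𝒞 : Set (Set X)) = A
  isArc : ∀ C ∈ 𝒞, IsArc C
  disjoint : ∀ C ∈ 𝒞, ∀ D ∈ 𝒞, C ≠ D → Disjoint C D
  notMem : ∀ p ∈ P, ∀ C ∈ 𝒞, p ∉ C

namespace IsArcDecomp

variable {A B : Set X} {P P' : Finset X} {𝒞 𝒞' : Finset (Set X)}

theorem subset (h : IsArcDecomp A P 𝒞) {C : Set X} (hC : C ∈ 𝒞) : C ⊆ A := by
  rw [← h.union_eq]
  exact (Set.subset_sUnion_of_mem (by exact_mod_cast hC)).trans Set.subset_union_right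

theorem points_subset (h : IsArcDecomp A P 𝒞) : (P : Set X) ⊆ A := by
  rw [← h.union_eq]
  exact Set.subset_union_left

theorem mem_iff (h : IsArcDecomp A P 𝒞) {x : X} : x ∈ A ↔ x ∈ P ∨ ∃ C ∈ 𝒞, x ∈ C := by
  rw [← h.union_eq]
  simp

/-- Two arcs of a decomposition that share a point are equal. -/
theorem eq_of_mem (h : IsArcDecomp A P 𝒞) {C D : Set X} (hC : C ∈ 𝒞) (hD : D ∈ 𝒞) {x : X}
    (hxC : x ∈ C) (hxD : x ∈ D) : C = D := by
  by_contra hne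
  exact Set.disjoint_left.1 (h.disjoint C hC D hD hne) hxC hxD

theorem union [DecidableEq X] [DecidableEq (Set X)] (h : IsArcDecomp A P 𝒞)
    (h' : IsArcDecomp B P' 𝒞') (hAB : Disjoint A B) :
    IsArcDecomp (A ∪ B) (P ∪ P') (𝒞 ∪ 𝒞') ∧ (P ∪ P').card = P.card + P'.card ∧
      (𝒞 ∪ 𝒞').card = 𝒞.card + 𝒞'.card := by
  refine ⟨⟨?_, ?_, ?_, ?_⟩, ?_, ?_⟩
  · rw [← h.union_eq, ← h'.union_eq]
    ext y
    simp only [Finset.coe_union, Set.sUnion_union, Set.mem_union]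
    tauto
  · intro C hC
    rcases Finset.mem_union.1 hC with hC | hC
    exacts [h.isArc C hC, h'.isArc C hC]
  · intro C hC D hD hne
    rcases Finset.mem_union.1 hC with hC | hC <;> rcases Finset.mem_union.1 hD with hD | hD
    · exact h.disjoint C hC D hD hne
    · exact hAB.mono (h.subset hC) (h'.subset hD)
    · exact hAB.symm.mono (h'.subset hC) (h.subset hD)
    · exact h'.disjoint C hC D hD hne
  · intro p hp C hC
    rcases Finset.mem_union.1 hp with hp | hp <;> rcases Finset.mem_union.1 hC with hC | hC
    · exact h.notMem p hp C hC
    · exact fun hpC => Set.disjoint_left.1 hAB (h.points_subset hp) (h'.subset hC hpC)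
    · exact fun hpC => Set.disjoint_left.1 hAB (h.subset hC hpC) (h'.points_subset hp)
    · exact h'.notMem p hp C hC
  · refine Finset.card_union_of_disjoint (Finset.disjoint_left.2 fun p hp hp' => ?_)
    exact Set.disjoint_left.1 hAB (h.points_subset hp) (h'.points_subset hp')
  · refine Finset.card_union_of_disjoint (Finset.disjoint_left.2 fun C hC hC' => ?_)
    obtain ⟨x, hx⟩ := (h.isArc C hC).nonempty
    exact Set.disjoint_left.1 hAB (h.subset hC hx) (h'.subset hC' hx)

/-- Cutting an arc at one of its points produces one more point and one more arc. -/
theorem exists_insert [DecidableEq X] (h : IsArcDecomp A P 𝒞) {x : X} (hxA : x ∈ A) (hxP : x ∉ P) :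
    ∃ 𝒞', IsArcDecomp A (insert x P) 𝒞' ∧ 𝒞'.card = 𝒞.card + 1 := by
  classical
  obtain ⟨C, hC, hxC⟩ := (h.mem_iff.1 hxA).resolve_left hxP
  obtain ⟨a, b, γ, hab, hc, hi, hCγ⟩ := h.isArc C hC
  obtain ⟨t, ht, rfl⟩ : x ∈ γ '' Set.Ioo a b := hCγ ▸ hxC
  set D := γ '' Set.Ioo a t
  set E := γ '' Set.Ioo t b
  have hl : Set.Ioo a t ⊆ Set.Ioo a b := Set.Ioo_subset_Ioo_right ht.2.le
  have hr : Set.Ioo t b ⊆ Set.Ioo a b := Set.Ioo_subset_Ioo_left ht.1.le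
  have hD : IsArc D := IsArc.image_Ioo ht.1 hc hi hl
  have hE : IsArc E := IsArc.image_Ioo ht.2 hc hi hr
  have hDC : D ⊆ C := hCγ ▸ Set.image_mono hl
  have hEC : E ⊆ C := hCγ ▸ Set.image_mono hr
  have hDE : Disjoint D E := by
    rw [Set.disjoint_left]
    rintro _ ⟨s, hs, rfl⟩ ⟨s', hs', h⟩
    have := hi (hr hs') (hl hs) h
    exact absurd hs.2 (this ▸ hs'.1).le.not_gt
  have hxD : γ t ∉ D := by
    rintro ⟨s, hs, h⟩
    exact hs.2.ne (hi (hl hs) ht h)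
  have hxE : γ t ∉ E := by
    rintro ⟨s, hs, h⟩
    exact hs.1.ne' (hi (hr hs) ht h)
  have hCU : C = D ∪ {γ t} ∪ E := by
    refine subset_antisymm ?_ (Set.union_subset (Set.union_subset hDC (by simpa using hxC)) hEC)
    rw [← hCγ]
    rintro _ ⟨s, hs, rfl⟩
    rcases lt_trichotomy s t with h | h | h
    · exact Or.inl (Or.inl ⟨s, ⟨hs.1, h⟩, rfl⟩)
    · exact Or.inl (Or.inr (h ▸ rfl))
    · exact Or.inr ⟨s, ⟨h, hs.2⟩, rfl⟩
  have hdisj : ∀ F ∈ 𝒞.erase C, Disjoint F C := fun F hF =>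
    h.disjoint F (Finset.mem_of_mem_erase hF) C hC (Finset.ne_of_mem_erase hF)
  have hDne : D ∉ insert E (𝒞.erase C) := by
    intro hmem
    obtain ⟨y, hy⟩ := hD.nonempty
    rcases Finset.mem_insert.1 hmem with h1 | h1
    · exact Set.disjoint_left.1 hDE hy (h1 ▸ hy)
    · exact Set.disjoint_left.1 (hdisj D h1) hy (hDC hy)
  have hEne : E ∉ 𝒞.erase C := by
    intro h1
    obtain ⟨y, hy⟩ := hE.nonempty
    exact Set.disjoint_left.1 (hdisj E h1) hy (hEC hy)
  refine ⟨insert D (insert E (𝒞.erase C)), ⟨?_, ?_, ?_, ?_⟩, ?_⟩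
  · have h1 : ⋃₀ (𝒞 : Set (Set X)) = C ∪ ⋃₀ ((𝒞.erase C : Finset _) : Set (Set X)) := by
      rw [← Set.sUnion_insert, ← Finset.coe_insert, Finset.insert_erase hC]
    rw [← h.union_eq, h1, hCU]
    ext y
    simp only [Finset.coe_insert, Set.sUnion_insert, Set.mem_union, Set.mem_insert_iff,
      Set.mem_singleton_iff]
    tauto
  · intro F hF
    rcases Finset.mem_insert.1 hF with rfl | hF
    · exact hD
    rcases Finset.mem_insert.1 hF with rfl | hF
    · exact hE
    exact h.isArc F (Finset.mem_of_mem_erase hF)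
  · intro F hF G hG hFG
    rcases Finset.mem_insert.1 hF with rfl | hF
    · rcases Finset.mem_insert.1 hG with rfl | hG
      · exact absurd rfl hFG
      rcases Finset.mem_insert.1 hG with rfl | hG
      · exact hDE
      exact ((hdisj G hG).mono_right hDC).symm
    rcases Finset.mem_insert.1 hF with rfl | hF
    · rcases Finset.mem_insert.1 hG with rfl | hG
      · exact hDE.symm
      rcases Finset.mem_insert.1 hG with rfl | hG
      · exact absurd rfl hFG
      exact ((hdisj G hG).mono_right hEC).symm
    · rcases Finset.mem_insert.1 hG with rfl | hG
      · exact (hdisj F hF).mono_right hDC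
      rcases Finset.mem_insert.1 hG with rfl | hG
      · exact (hdisj F hF).mono_right hEC
      exact h.disjoint F (Finset.mem_of_mem_erase hF) G (Finset.mem_of_mem_erase hG) hFG
  · intro p hp F hF
    rcases Finset.mem_insert.1 hp with rfl | hp
    · rcases Finset.mem_insert.1 hF with rfl | hF
      · exact hxD
      rcases Finset.mem_insert.1 hF with rfl | hF
      · exact hxE
      exact fun hxF => Set.disjoint_left.1 (hdisj F hF) hxF hxC
    · rcases Finset.mem_insert.1 hF with rfl | hF
      · exact fun hpD => h.notMem p hp C hC (hDC hpD)
      rcases Finset.mem_insert.1 hF with rfl | hF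
      · exact fun hpE => h.notMem p hp C hC (hEC hpE)
      exact h.notMem p hp F (Finset.mem_of_mem_erase hF)
  · rw [Finset.card_insert_of_notMem hDne, Finset.card_insert_of_notMem hEne,
      Finset.card_erase_of_mem hC]
    have := Finset.card_pos.2 ⟨C, hC⟩
    omega

theorem exists_refinement [DecidableEq X] (h : IsArcDecomp A P 𝒞) (Q : Finset X)
    (hQA : (Q : Set X) ⊆ A) :
    ∃ 𝒞', IsArcDecomp A (P ∪ Q) 𝒞' ∧ ((P ∪ Q).card : ℤ) - 𝒞'.card = P.card - 𝒞.card := by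
  induction Q using Finset.induction_on with
  | empty => exact ⟨𝒞, by simpa using h, by simp⟩
  | insert x Q hx ih =>
    rw [Finset.coe_insert, Set.insert_subset_iff] at hQA
    obtain ⟨𝒞₁, h1, hcard⟩ := ih hQA.2
    rw [Finset.union_insert]
    by_cases hxQ : x ∈ P ∪ Q
    · rw [Finset.insert_eq_of_mem hxQ]
      exact ⟨𝒞₁, h1, hcard⟩
    · obtain ⟨𝒞₂, h2, hc2⟩ := h1.exists_insert hQA.1 hxQ
      refine ⟨𝒞₂, h2, ?_⟩
      rw [Finset.card_insert_of_notMem hxQ, hc2]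
      push_cast
      linarith

end IsArcDecomp

variable [ChartedSpace ℝ X]

/-- Invariance of domain in dimension one: a continuous injection of an open subset of the line
maps neighbourhoods to neighbourhoods. -/
theorem image_mem_nhds_of_injOn {γ : ℝ → X} {J : Set ℝ} {t : ℝ} (hJ : J ∈ 𝓝 t)
    (hc : ContinuousOn γ J) (hi : Set.InjOn γ J) : γ '' J ∈ 𝓝 (γ t) := by
  set φ := chartAt ℝ (γ t)
  have h1 : J ∩ γ ⁻¹' φ.source ∈ 𝓝 t := Filter.inter_mem hJ
    ((hc.continuousAt hJ).preimage_mem_nhds (φ.open_source.mem_nhds (mem_chart_source ℝ (γ t))))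
  obtain ⟨a, b, hab, h2⟩ := mem_nhds_iff_exists_Ioo_subset.1 h1
  obtain ⟨c, hc1, hc2⟩ := exists_between hab.1
  obtain ⟨d, hd1, hd2⟩ := exists_between hab.2
  have hcd : c < d := hc2.trans hd1
  have h3 : Set.Icc c d ⊆ J ∩ γ ⁻¹' φ.source := fun x hx =>
    h2 ⟨hc1.trans_le hx.1, hx.2.trans_lt hd2⟩
  have huc : ContinuousOn (φ ∘ γ) (Set.Icc c d) :=
    φ.continuousOn.comp (hc.mono fun x hx => (h3 hx).1) fun x hx => (h3 hx).2
  have hui : Set.InjOn (φ ∘ γ) (Set.Icc c d) :=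
    φ.injOn.comp (hi.mono fun x hx => (h3 hx).1) fun x hx => (h3 hx).2
  have hnhds : (φ ∘ γ) '' Set.Ioo c d ∈ 𝓝 (φ (γ t)) := by
    have ht : φ (γ t) ∈ (φ ∘ γ) '' Set.Ioo c d := ⟨t, ⟨hc2, hd1⟩, rfl⟩
    refine IsOpen.mem_nhds ?_ ht
    rcases huc.strictMonoOn_of_injOn_Icc' hcd.le hui with h | h
    · rw [huc.image_Ioo_of_strictMonoOn hcd.le h]; exact isOpen_Ioo
    · rw [huc.image_Ioo_of_strictAntiOn hcd.le h]; exact isOpen_Ioo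
  have h4 := (φ.continuousAt (mem_chart_source ℝ (γ t))).preimage_mem_nhds hnhds
  filter_upwards [h4, φ.open_source.mem_nhds (mem_chart_source ℝ (γ t))] with y hy hys
  obtain ⟨s, hs, hsy⟩ := hy
  have hs' := h3 (Set.Ioo_subset_Icc_self hs)
  exact ⟨s, hs'.1, φ.injOn hs'.2 hys hsy⟩

theorem isOpen_image_of_injOn {γ : ℝ → X} {J : Set ℝ} (hJ : IsOpen J)
    (hc : ContinuousOn γ J) (hi : Set.InjOn γ J) : IsOpen (γ '' J) := by
  rw [isOpen_iff_mem_nhds]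
  rintro _ ⟨t, ht, rfl⟩
  exact image_mem_nhds_of_injOn (hJ.mem_nhds ht) hc hi

theorem IsArc.isOpen {C : Set X} (h : IsArc C) : IsOpen C := by
  obtain ⟨a, b, γ, hab, hc, hi, rfl⟩ := h
  exact isOpen_image_of_injOn isOpen_Ioo hc hi

/-- The points close to `p` in the chart at `p` lie in any given neighbourhood of `p`. -/
theorem exists_isArc_side (p : X) {U : Set X} (hU : U ∈ 𝓝 p) :
    ∃ ε > 0, Set.Ioo (chartAt ℝ p p - ε) (chartAt ℝ p p + ε) ⊆ (chartAt ℝ p).target ∧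
      (chartAt ℝ p).symm '' Set.Ioo (chartAt ℝ p p - ε) (chartAt ℝ p p + ε) ⊆ U := by
  set φ := chartAt ℝ p
  have hp := mem_chart_source ℝ p
  have h1 : φ.target ∩ φ.symm ⁻¹' U ∈ 𝓝 (φ p) := by
    refine Filter.inter_mem (φ.open_target.mem_nhds (φ.map_source hp)) ?_
    refine (φ.continuousAt_symm (φ.map_source hp)).preimage_mem_nhds ?_
    rwa [φ.left_inv hp]
  obtain ⟨ε, hε, h2⟩ := Metric.mem_nhds_iff.1 h1
  rw [Real.ball_eq_Ioo] at h2
  exact ⟨ε, hε, fun x hx => (h2 hx).1, Set.image_subset_iff.2 fun x hx => (h2 hx).2⟩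

/-- A point of a one-dimensional manifold, together with two open arcs that avoid a given finite
set, forms a neighbourhood of the point. -/
theorem exists_two_sided_nhds [T1Space X] (p : X) {F : Set X} (hF : F.Finite) :
    ∃ C₁ C₂ : Set X, IsArc C₁ ∧ IsArc C₂ ∧ Disjoint C₁ F ∧ Disjoint C₂ F ∧
      C₁ ∪ {p} ∪ C₂ ∈ 𝓝 p := by
  have hU : (F \ {p})ᶜ ∈ 𝓝 p := (hF.sdiff.isClosed.isOpen_compl).mem_nhds (by simp)
  obtain ⟨ε, hε, h1, h2⟩ := exists_isArc_side p hU
  set φ := chartAt ℝ p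
  have hp := mem_chart_source ℝ p
  have hc := φ.continuousOn_symm.mono h1
  have hi := φ.symm.injOn.mono h1
  have hl : Set.Ioo (φ p - ε) (φ p) ⊆ Set.Ioo (φ p - ε) (φ p + ε) :=
    Set.Ioo_subset_Ioo_right (by linarith)
  have hr : Set.Ioo (φ p) (φ p + ε) ⊆ Set.Ioo (φ p - ε) (φ p + ε) :=
    Set.Ioo_subset_Ioo_left (by linarith)
  have hm : φ p ∈ Set.Ioo (φ p - ε) (φ p + ε) := ⟨by linarith, by linarith⟩
  have key : ∀ t ∈ Set.Ioo (φ p - ε) (φ p + ε), t ≠ φ p → φ.symm t ∉ F := by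
    intro t ht htp htF
    refine h2 ⟨t, ht, rfl⟩ ⟨htF, fun h => htp ?_⟩
    rw [← φ.right_inv (h1 ht), h]
  refine ⟨φ.symm '' Set.Ioo (φ p - ε) (φ p), φ.symm '' Set.Ioo (φ p) (φ p + ε),
    IsArc.image_Ioo (by linarith) hc hi hl, IsArc.image_Ioo (by linarith) hc hi hr, ?_, ?_, ?_⟩
  · rw [Set.disjoint_left]
    rintro _ ⟨t, ht, rfl⟩
    exact key t (hl ht) ht.2.ne
  · rw [Set.disjoint_left]
    rintro _ ⟨t, ht, rfl⟩
    exact key t (hr ht) ht.1.ne'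
  · have h3 := image_mem_nhds_of_injOn (isOpen_Ioo.mem_nhds hm) hc hi
    rw [φ.left_inv hp] at h3
    filter_upwards [h3]
    rintro _ ⟨t, ht, rfl⟩
    rcases lt_trichotomy t (φ p) with h | h | h
    · exact Or.inl (Or.inl ⟨t, ⟨ht.1, h⟩, rfl⟩)
    · exact Or.inl (Or.inr (by rw [h, φ.left_inv hp]; rfl))
    · exact Or.inr ⟨t, ⟨h, ht.2⟩, rfl⟩

theorem infinite_of_mem_nhds_chartedSpace_real {p : X} {U : Set X} (hU : U ∈ 𝓝 p) : U.Infinite := by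
  obtain ⟨ε, hε, h1, h2⟩ := exists_isArc_side p hU
  exact (((Set.Ioo_infinite (by linarith)).image
    ((chartAt ℝ p).symm.injOn.mono h1))).mono h2

/-- The plane does not inject continuously into the line: removing a point from the plane leaves
it connected. -/
theorem not_injective_of_continuous_plane {f : ℝ × ℝ → ℝ} (hf : Continuous f) :
    ¬ Function.Injective f := by
  intro hi
  have hr : 1 < Module.rank ℝ (ℝ × ℝ) := by
    rw [← Module.finrank_eq_rank, Module.finrank_prod, Module.finrank_self]; norm_num
  -- among three points, one has the middle value
  obtain ⟨x, y, z, hxy, hyz⟩ : ∃ x y z, f x < f y ∧ f y < f z := by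
    have h01 : f (0, 0) ≠ f (1, 0) := hi.ne (by simp)
    have h02 : f (0, 0) ≠ f (0, 1) := hi.ne (by simp)
    have h12 : f (1, 0) ≠ f (0, 1) := hi.ne (by simp)
    rcases h01.lt_or_gt with a | a <;> rcases h02.lt_or_gt with b | b <;>
      rcases h12.lt_or_gt with c | c
    all_goals first
    | exact ⟨_, _, _, a, b⟩
    | exact ⟨_, _, _, a, c⟩
    | exact ⟨_, _, _, b, a⟩
    | exact ⟨_, _, _, b, c⟩
    | exact ⟨_, _, _, c, a⟩
    | exact ⟨_, _, _, c, b⟩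
  have hconn := (isConnected_compl_singleton_of_one_lt_rank hr y).isPreconnected.image f
    hf.continuousOn
  obtain ⟨w, hw, hwy⟩ := hconn.ordConnected.out
    ⟨x, fun h => hxy.ne (congrArg f h), rfl⟩ ⟨z, fun h => hyz.ne' (congrArg f h), rfl⟩
    ⟨hxy.le, hyz.le⟩
  exact hw (hi hwy)

/-! ### Counting points minus arcs -/

namespace IsArcDecomp

variable {A : Set X} {P P' : Finset X} {𝒞 𝒞' : Finset (Set X)}

/-- A connected set covered by the arcs lies in one of them. -/
theorem subset_of_isPreconnected (h : IsArcDecomp A P 𝒞) {S : Set X} (hS : IsPreconnected S)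
    (hSA : S ⊆ A) (hSP : Disjoint S P) {C : Set X} (hC : C ∈ 𝒞) (hne : (S ∩ C).Nonempty) :
    S ⊆ C := by
  classical
  refine hS.subset_left_of_subset_union (u := C) (v := ⋃ D ∈ 𝒞.erase C, D)
    (h.isArc C hC).isOpen ?_ ?_ ?_ hne
  · exact isOpen_biUnion fun D hD => (h.isArc D (Finset.mem_of_mem_erase hD)).isOpen
  · rw [Set.disjoint_iUnion₂_right]
    intro D hD
    exact h.disjoint C hC D (Finset.mem_of_mem_erase hD) (Finset.ne_of_mem_erase hD).symm
  · intro x hx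
    rcases h.mem_iff.1 (hSA hx) with hxP | ⟨D, hD, hxD⟩
    · exact absurd hxP (Set.disjoint_left.1 hSP hx)
    · by_cases hDC : D = C
      · exact Or.inl (hDC ▸ hxD)
      · refine Or.inr (Set.mem_biUnion (Finset.mem_erase.2 ⟨hDC, hD⟩) hxD)

theorem arcs_subset_of_points_eq (h : IsArcDecomp A P 𝒞) (h' : IsArcDecomp A P 𝒞') : 𝒞 ⊆ 𝒞' := by
  have key : ∀ {𝒞 𝒞' : Finset (Set X)}, IsArcDecomp A P 𝒞 → IsArcDecomp A P 𝒞' →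
      ∀ C ∈ 𝒞, ∃ D ∈ 𝒞', C ⊆ D := by
    intro 𝒞 𝒞' h h' C hC
    obtain ⟨x, hx⟩ := (h.isArc C hC).nonempty
    have hd : Disjoint C P := Set.disjoint_left.2 fun y hy hyP => h.notMem y hyP C hC hy
    rcases h'.mem_iff.1 (h.subset hC hx) with hxP | ⟨D, hD, hxD⟩
    · exact absurd hxP (Set.disjoint_left.1 hd hx)
    · exact ⟨D, hD, h'.subset_of_isPreconnected (h.isArc C hC).isPreconnected (h.subset hC) hd hD
        ⟨x, hx, hxD⟩⟩
  intro C hC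
  obtain ⟨D, hD, hCD⟩ := key h h' C hC
  obtain ⟨E, hE, hDE⟩ := key h' h D hD
  obtain ⟨x, hx⟩ := (h.isArc C hC).nonempty
  have : C = E := h.eq_of_mem hC hE hx (hDE (hCD hx))
  have : C = D := hCD.antisymm (this ▸ hDE)
  exact this ▸ hD

/-- The number of points minus the number of arcs does not depend on the decomposition: after
passing to a common set of points, the arcs are the connected components of what is left. -/
theorem card_sub_card_eq (h : IsArcDecomp A P 𝒞) (h' : IsArcDecomp A P' 𝒞') :
    (P.card : ℤ) - 𝒞.card = P'.card - 𝒞'.card := by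
  classical
  obtain ⟨𝒞₁, h1, hc1⟩ := h.exists_refinement P' h'.points_subset
  obtain ⟨𝒞₂, h2, hc2⟩ := h'.exists_refinement P h.points_subset
  rw [Finset.union_comm] at h2 hc2
  have : 𝒞₁ = 𝒞₂ := (h1.arcs_subset_of_points_eq h2).antisymm (h2.arcs_subset_of_points_eq h1)
  rw [← hc1, ← hc2, this]

end IsArcDecomp

end OneManifold

/-! ### Definable sections of a coordinate function -/

namespace OMinimalStructure

variable {O : OMinimalStructure} {n : ℕ}

/-- Definable choice for finite fibres: over each value of the coordinate `i`, the
lexicographically least point of the fibre is a definable choice of a point. -/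
theorem exists_section {B : Set (Fin n → ℝ)} (hB : B ∈ O.Def n) (i : Fin n)
    (hfin : ∀ t, {p ∈ B | p i = t}.Finite) :
    ∃ B' ⊆ B, B' ∈ O.Def n ∧ (fun p => p i) '' B' = (fun p => p i) '' B ∧
      Set.InjOn (fun p => p i) B' := by
  have key : ∀ S : Finset (Fin n), ∃ B' ⊆ B, B' ∈ O.Def n ∧
      (fun p => p i) '' B' = (fun p => p i) '' B ∧
      ∀ j ∈ S, ∀ p ∈ B', ∀ q ∈ B', p i = q i → p j = q j := by
    intro S
    induction S using Finset.induction_on with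
    | empty => exact ⟨B, subset_rfl, hB, rfl, by simp⟩
    | insert j S _ ih =>
      obtain ⟨B', hsub, hdef, himg, hS⟩ := ih
      refine ⟨{p | p ∈ B' ∧ ∀ q, q ∈ B' → q i = p i → p j ≤ q j}, fun p hp => hsub hp.1, ?_, ?_, ?_⟩
      · refine defPred_iff_mem.1 (DefPred.and (DefPred.mem hdef id) (DefPred.all ?_))
        exact (DefPred.mem hdef Sum.inr).imp
          ((DefPred.eq (Sum.inr i) (Sum.inl i)).imp (DefPred.le (Sum.inl j) (Sum.inr j)))
      · rw [← himg]
        refine (Set.image_mono fun p hp => hp.1).antisymm ?_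
        rintro _ ⟨p, hp, rfl⟩
        obtain ⟨q, hq, hmin⟩ := Set.exists_min_image {q ∈ B' | q i = p i} (fun q => q j)
          ((hfin (p i)).subset fun q hq => ⟨hsub hq.1, hq.2⟩) ⟨p, hp, rfl⟩
        exact ⟨q, ⟨hq.1, fun r hr hri => hmin r ⟨hr, hri.trans hq.2⟩⟩, hq.2⟩
      · intro k hk p hp q hq hpq
        rcases Finset.mem_insert.1 hk with rfl | hk
        · exact le_antisymm (hp.2 q hq.1 hpq.symm) (hq.2 p hp.1 hpq)
        · exact hS k hk p hp.1 q hq.1 hpq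
  obtain ⟨B', hsub, hdef, himg, hS⟩ := key Finset.univ
  exact ⟨B', hsub, hdef, himg, fun p hp q hq hpq =>
    funext fun j => hS j (Finset.mem_univ j) p hp q hq hpq⟩

/-- The point `p` of `B` is a continuity point of the section of the `i`-th coordinate whose image
is `B`. -/
def SectionContAt (B : Set (Fin n → ℝ)) (i : Fin n) (p : Fin n → ℝ) : Prop :=
  ∀ a b : Fin n → ℝ, (∀ j, a j < p j ∧ p j < b j) →
    ∃ c d : ℝ, (c < p i ∧ p i < d) ∧
      ∀ q : Fin n → ℝ, q ∈ B → (c < q i ∧ q i < d) → ∀ j, a j < q j ∧ q j < b j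

theorem defPred_sectionContAt {B : Set (Fin n → ℝ)} (hB : B ∈ O.Def n) (i : Fin n) :
    O.DefPred (SectionContAt B i) := by
  refine DefPred.all (DefPred.all (DefPred.imp ?_ (DefPred.exReal (DefPred.exReal
    (DefPred.and (DefPred.and ?_ ?_) (DefPred.all (DefPred.imp ?_ (DefPred.imp
      (DefPred.and ?_ ?_) ?_))))))))
  · exact DefPred.forall_fin fun j => (DefPred.lt _ _).and (DefPred.lt _ _)
  · exact DefPred.lt _ _
  · exact DefPred.lt _ _
  · exact DefPred.mem hB _
  · exact DefPred.lt _ _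
  · exact DefPred.lt _ _
  · exact DefPred.forall_fin fun j => (DefPred.lt _ _).and (DefPred.lt _ _)

/-- A definable section has only finitely many discontinuities. A discontinuity lies over the
frontier of one of the countably many definable sets `{x_j ≥ r}` and `{x_j ≤ r}` with `r` rational,
and these frontiers are finite; a countable definable set is finite. -/
theorem finite_not_sectionContAt {B : Set (Fin n → ℝ)} (hB : B ∈ O.Def n) {i : Fin n}
    (hi : Set.InjOn (fun p => p i) B) : {p ∈ B | ¬ SectionContAt B i p}.Finite := by
  refine finite_of_countable (O := O) (defPred_iff_mem.1
    ((DefPred.mem hB id).and (defPred_sectionContAt hB i).not)) ?_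
  have hU : ∀ (j : Fin n) (r : ℚ), {q | q ∈ B ∧ (r : ℝ) ≤ q j} ∈ O.Def n := fun j r =>
    defPred_iff_mem.1 ((DefPred.mem hB id).and (DefPred.mem_of_ordConnected j Set.ordConnected_Ici))
  have hL : ∀ (j : Fin n) (r : ℚ), {q | q ∈ B ∧ q j ≤ (r : ℝ)} ∈ O.Def n := fun j r =>
    defPred_iff_mem.1 ((DefPred.mem hB id).and (DefPred.mem_of_ordConnected j Set.ordConnected_Iic))
  have hT : (⋃ (j : Fin n) (r : ℚ),
      frontier ((fun p : Fin n → ℝ => p i) '' {q | q ∈ B ∧ (r : ℝ) ≤ q j}) ∪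
      frontier ((fun p : Fin n → ℝ => p i) '' {q | q ∈ B ∧ q j ≤ (r : ℝ)})).Countable :=
    Set.countable_iUnion fun j => Set.countable_iUnion fun r =>
      ((DefReal.image (hU j r) i).finite_frontier.union
        (DefReal.image (hL j r) i).finite_frontier).countable
  refine Set.MapsTo.countable_of_injOn (f := fun p => p i) ?_ (hi.mono fun p hp => hp.1) hT
  rintro p ⟨hpB, hp⟩
  by_contra hmem
  simp only [Set.mem_iUnion, Set.mem_union, not_exists, not_or] at hmem
  refine hp fun a b hab => ?_
  have h1 : ∀ j, ∀ᶠ t in 𝓝 (p i), ∀ q ∈ B, q i = t → a j < q j ∧ q j < b j := by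
    intro j
    obtain ⟨r, hr1, hr2⟩ := exists_rat_btwn (hab j).2
    obtain ⟨s, hs1, hs2⟩ := exists_rat_btwn (hab j).1
    have hr : p i ∉ closure ((fun p : Fin n → ℝ => p i) '' {q | q ∈ B ∧ (r : ℝ) ≤ q j}) := by
      intro hcl
      refine (hmem j r).1 ⟨hcl, fun hint => ?_⟩
      obtain ⟨q, hq, hqi⟩ := interior_subset hint
      have : q = p := hi hq.1 hpB hqi
      exact absurd hq.2 (this ▸ hr1.not_ge)
    have hs : p i ∉ closure ((fun p : Fin n → ℝ => p i) '' {q | q ∈ B ∧ q j ≤ (s : ℝ)}) := by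
      intro hcl
      refine (hmem j s).2 ⟨hcl, fun hint => ?_⟩
      obtain ⟨q, hq, hqi⟩ := interior_subset hint
      have : q = p := hi hq.1 hpB hqi
      exact absurd hq.2 (this ▸ hs2.not_ge)
    filter_upwards [isClosed_closure.isOpen_compl.mem_nhds hr,
      isClosed_closure.isOpen_compl.mem_nhds hs] with t ht1 ht2 q hq hqt
    constructor
    · refine hs1.trans (lt_of_not_ge fun h => ht2 (subset_closure ⟨q, ⟨hq, h⟩, hqt⟩))
    · refine (lt_of_not_ge fun h => ht1 (subset_closure ⟨q, ⟨hq, h⟩, hqt⟩)).trans hr2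
  obtain ⟨c, d, hcd, h2⟩ := mem_nhds_iff_exists_Ioo_subset.1 (eventually_all.2 h1)
  exact ⟨c, d, hcd, fun q hq hqi j => h2 hqi j q hq rfl⟩

/-! ### Definable subsets of a one-dimensional manifold -/

/-- Definability of a subset of the space `M`, as a subset of the ambient `ℝⁿ`. -/
def DefSub (O : OMinimalStructure) {M : Set (Fin n → ℝ)} (A : Set M) : Prop :=
  (Subtype.val '' A : Set (Fin n → ℝ)) ∈ O.Def n

/-- Definability of a binary relation on the space `M`. -/
def DefRel (O : OMinimalStructure) {M : Set (Fin n → ℝ)} (R : M → M → Prop) : Prop :=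
  O.DefPred (fun z : Fin n ⊕ Fin n → ℝ =>
    ∃ p q : M, (p : Fin n → ℝ) = (fun i => z (Sum.inl i)) ∧
      (q : Fin n → ℝ) = (fun i => z (Sum.inr i)) ∧ R p q)

variable {M : Set (Fin n → ℝ)}

theorem DefSub.inter {A B : Set M} (hA : O.DefSub A) (hB : O.DefSub B) : O.DefSub (A ∩ B) := by
  unfold DefSub
  rw [Set.image_inter Subtype.val_injective]
  exact O.inter_mem hA hB

theorem DefSub.union {A B : Set M} (hA : O.DefSub A) (hB : O.DefSub B) : O.DefSub (A ∪ B) := by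
  unfold DefSub
  rw [Set.image_union]
  exact O.union_mem _ _ _ hA hB

theorem DefSub.diff {A B : Set M} (hA : O.DefSub A) (hB : O.DefSub B) : O.DefSub (A \ B) := by
  unfold DefSub
  rw [Set.image_sdiff Subtype.val_injective]
  exact O.inter_mem hA (O.compl_mem _ _ hB)

theorem DefSub.of_mem (hM : M ∈ O.Def n) {B : Set (Fin n → ℝ)} (hB : B ∈ O.Def n) :
    O.DefSub {p : M | (p : Fin n → ℝ) ∈ B} := by
  have := O.inter_mem hM hB
  rwa [← Subtype.image_preimage_coe] at this

theorem DefSub.compl (hM : M ∈ O.Def n) {A : Set M} (hA : O.DefSub A) : O.DefSub Aᶜ := by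
  have h := DefSub.of_mem hM (O.compl_mem n _ hA)
  convert h using 1
  ext p; simp

theorem DefSub.singleton (hM : M ∈ O.Def n) (p : M) : O.DefSub {p} := by
  have h1 : {x : Fin n → ℝ | ∀ i, x i = (p : Fin n → ℝ) i} ∈ O.Def n :=
    defPred_iff_mem.1 (DefPred.forall_fin fun i => DefPred.eqConst i _)
  have h := DefSub.of_mem hM h1
  convert h using 1
  ext q
  simp [Subtype.ext_iff, funext_iff]

theorem DefSub.of_finite (hM : M ∈ O.Def n) {A : Set M} (hA : A.Finite) : O.DefSub A := by
  induction A, hA using Set.Finite.induction_on with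
  | empty => simpa [DefSub] using O.empty_mem n
  | insert _ _ ih =>
    rw [Set.insert_eq]
    exact (DefSub.singleton hM _).union ih

theorem DefSub.finite_of_countable {A : Set M} (hA : O.DefSub A) (h : A.Countable) : A.Finite :=
  ((OMinimalStructure.finite_of_countable hA (h.image _)).of_finite_image
    Subtype.val_injective.injOn)

/-- Neighbourhoods in a subspace of `ℝⁿ` are given by boxes. -/
theorem eventually_nhds_iff_box {p : M} {Q : M → Prop} : (∀ᶠ q in 𝓝 p, Q q) ↔
    ∃ a b : Fin n → ℝ, (∀ j, a j < (p : Fin n → ℝ) j ∧ (p : Fin n → ℝ) j < b j) ∧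
      ∀ q : M, (∀ j, a j < (q : Fin n → ℝ) j ∧ (q : Fin n → ℝ) j < b j) → Q q := by
  constructor
  · intro h
    obtain ⟨ε, hε, h⟩ := Metric.eventually_nhds_iff.1 h
    refine ⟨fun j => (p : Fin n → ℝ) j - ε, fun j => (p : Fin n → ℝ) j + ε,
      fun j => ⟨by linarith, by linarith⟩, fun q hq => h ?_⟩
    rw [Subtype.dist_eq, dist_pi_lt_iff hε]
    intro j
    rw [Real.dist_eq, abs_lt]
    constructor <;> linarith [(hq j).1, (hq j).2]
  · rintro ⟨a, b, hp, h⟩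
    have hopen : IsOpen {q : M | ∀ j, a j < (q : Fin n → ℝ) j ∧ (q : Fin n → ℝ) j < b j} := by
      simp only [Set.ofPred_forall]
      refine isOpen_iInter_of_finite fun j => ?_
      have hc : Continuous fun q : M => (q : Fin n → ℝ) j :=
        (continuous_apply j).comp continuous_subtype_val
      exact (isOpen_lt continuous_const hc).inter (isOpen_lt hc continuous_const)
    filter_upwards [hopen.mem_nhds hp] with q hq using h q hq

/-- The definable sets are closed under the quantifier "for all points of `M` near `p`". -/
theorem DefRel.eventually_nhds (hM : M ∈ O.Def n) {R : M → M → Prop} (hR : O.DefRel R) :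
    O.DefSub {p : M | ∀ᶠ q in 𝓝 p, R p q} := by
  have h1 : O.DefPred (fun x : Fin n → ℝ => ∃ a b : Fin n → ℝ, (∀ j, a j < x j ∧ x j < b j) ∧
      ∀ y : Fin n → ℝ, y ∈ M → (∀ j, a j < y j ∧ y j < b j) →
        ∃ p q : M, (p : Fin n → ℝ) = x ∧ (q : Fin n → ℝ) = y ∧ R p q) := by
    refine DefPred.ex (DefPred.ex (DefPred.and ?_
      (DefPred.all (DefPred.imp ?_ (DefPred.imp ?_ ?_)))))
    · exact DefPred.forall_fin fun j => (DefPred.lt _ _).and (DefPred.lt _ _)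
    · exact DefPred.mem hM _
    · exact DefPred.forall_fin fun j => (DefPred.lt _ _).and (DefPred.lt _ _)
    · exact hR.comp (Sum.elim (fun i => Sum.inl (Sum.inl (Sum.inl i))) (fun i => Sum.inr i))
  have h2 := DefSub.of_mem hM (defPred_iff_mem.1 h1)
  convert h2 using 1
  ext p
  simp only [Set.mem_ofPred_eq]
  rw [eventually_nhds_iff_box]
  refine exists_congr fun a => exists_congr fun b => and_congr_right fun _ => ?_
  constructor
  · intro h y hy hb
    exact ⟨p, ⟨y, hy⟩, rfl, rfl, h ⟨y, hy⟩ hb⟩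
  · intro h q hq
    obtain ⟨p', q', hp', hq', hR⟩ := h q q.2 hq
    rwa [Subtype.ext hp', Subtype.ext hq'] at hR

theorem DefSub.interior (hM : M ∈ O.Def n) {A : Set M} (hA : O.DefSub A) :
    O.DefSub (interior A) := by
  have hR : O.DefRel (fun p q : M => q ∈ A) := by
    have : O.DefPred (fun z : Fin n ⊕ Fin n → ℝ => (fun i => z (Sum.inl i)) ∈ M ∧
        (fun i => z (Sum.inr i)) ∈ (Subtype.val '' A : Set (Fin n → ℝ))) :=
      (DefPred.mem hM Sum.inl).and (DefPred.mem hA Sum.inr)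
    refine (congrArg O.DefPred (funext fun z => propext ?_)).mpr this
    constructor
    · rintro ⟨p, q, hp, hq, hA⟩
      exact ⟨hp ▸ p.2, q, hA, hq⟩
    · rintro ⟨hp, q, hA, hq⟩
      exact ⟨⟨_, hp⟩, q, rfl, hq, hA⟩
  have := hR.eventually_nhds hM
  convert this using 1
  ext p
  exact mem_interior_iff_mem_nhds

theorem DefSub.frontier (hM : M ∈ O.Def n) {A : Set M} (hA : O.DefSub A) :
    O.DefSub (frontier A) := by
  rw [frontier_eq_closure_inter_closure, closure_eq_compl_interior_compl,
    closure_eq_compl_interior_compl, compl_compl]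
  exact (((hA.compl hM).interior hM).compl hM).inter ((hA.interior hM).compl hM)

end OMinimalStructure

namespace OMinimalStructure

variable {O : OMinimalStructure} {n : ℕ} {M : Set (Fin n → ℝ)}

/-! ### Definable functions -/

theorem IsDefinableFun.defPred_graph {f : M → ℝ} (hf : O.IsDefinableFun f) :
    O.DefPred (fun z : Fin n ⊕ Unit → ℝ =>
      ∃ p : M, (p : Fin n → ℝ) = (fun i => z (Sum.inl i)) ∧ f p = z (Sum.inr ())) := by
  have := DefPred.mem (ι := Fin n ⊕ Unit) hf (Fin.lastCases (Sum.inr ()) Sum.inl)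
  refine (congrArg O.DefPred (funext fun z => propext ?_)).mpr this
  simp only [Set.mem_ofPred_eq, Fin.lastCases_castSucc, Fin.lastCases_last]
  refine exists_congr fun p => and_congr ?_ eq_comm
  rw [funext_iff]
  exact forall_congr' fun i => eq_comm

theorem IsDefinableFun.preimage {f : M → ℝ} (hf : O.IsDefinableFun f) {I : Set ℝ}
    (hI : I.OrdConnected) : O.DefSub (f ⁻¹' I) := by
  have : O.DefPred (fun x : Fin n → ℝ => ∃ u : ℝ,
      (∃ p : M, (p : Fin n → ℝ) = x ∧ f p = u) ∧ u ∈ I) :=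
    DefPred.exReal (hf.defPred_graph.and (DefPred.mem_of_ordConnected _ hI))
  refine (congrArg (· ∈ O.Def n) (Set.ext fun x => ?_)).mpr (defPred_iff_mem.1 this)
  constructor
  · rintro ⟨p, hp, rfl⟩
    exact ⟨f p, ⟨p, rfl, rfl⟩, hp⟩
  · rintro ⟨_, ⟨p, rfl, rfl⟩, hp⟩
    exact ⟨p, hp, rfl⟩

theorem IsDefinableFun.defRel_le {f : M → ℝ} (hf : O.IsDefinableFun f) :
    O.DefRel (fun p q => f p ≤ f q) := by
  have : O.DefPred (fun z : Fin n ⊕ Fin n → ℝ => ∃ u v : ℝ,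
      ((∃ p : M, (p : Fin n → ℝ) = (fun i => z (Sum.inl i)) ∧ f p = u) ∧
        (∃ q : M, (q : Fin n → ℝ) = (fun i => z (Sum.inr i)) ∧ f q = v)) ∧ u ≤ v) := by
    refine DefPred.exReal (DefPred.exReal (DefPred.and (DefPred.and ?_ ?_) (DefPred.le _ _)))
    · exact hf.defPred_graph.comp
        (Sum.elim (fun i => Sum.inl (Sum.inl (Sum.inl i))) (fun _ => Sum.inl (Sum.inr ())))
    · exact hf.defPred_graph.comp
        (Sum.elim (fun i => Sum.inl (Sum.inl (Sum.inr i))) (fun _ => Sum.inr ()))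
  refine (congrArg O.DefPred (funext fun z => propext ?_)).mpr this
  constructor
  · rintro ⟨p, q, hp, hq, h⟩
    exact ⟨f p, f q, ⟨⟨p, hp, rfl⟩, ⟨q, hq, rfl⟩⟩, h⟩
  · rintro ⟨_, _, ⟨⟨p, hp, rfl⟩, ⟨q, hq, rfl⟩⟩, h⟩
    exact ⟨p, q, hp, hq, h⟩

theorem DefRel.swap {R : M → M → Prop} (hR : O.DefRel R) : O.DefRel (fun p q => R q p) := by
  have := hR.comp (Sum.swap : Fin n ⊕ Fin n → Fin n ⊕ Fin n)
  refine (congrArg O.DefPred (funext fun z => propext ?_)).mpr this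
  exact ⟨fun ⟨p, q, hp, hq, h⟩ => ⟨q, p, hq, hp, h⟩, fun ⟨p, q, hp, hq, h⟩ => ⟨q, p, hq, hp, h⟩⟩

theorem isDefinableFun_coord (hM : M ∈ O.Def n) (i : Fin n) :
    O.IsDefinableFun (fun p : M => (p : Fin n → ℝ) i) := by
  have : O.DefPred (fun x : Fin (n + 1) → ℝ => (fun j : Fin n => x j.castSucc) ∈ M ∧
      x (Fin.last n) = x i.castSucc) := (DefPred.mem hM _).and (DefPred.eq _ _)
  refine (congrArg (· ∈ O.Def (n + 1)) (Set.ext fun x => ?_)).mpr (defPred_iff_mem.1 this)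
  constructor
  · rintro ⟨p, hp, hx⟩
    have h1 : (fun j : Fin n => x j.castSucc) = p := funext hp
    exact ⟨h1 ▸ p.2, by rw [hx, hp]⟩
  · rintro ⟨h1, h2⟩
    exact ⟨⟨_, h1⟩, fun _ => rfl, h2⟩

theorem continuous_coord (i : Fin n) : Continuous (fun p : M => (p : Fin n → ℝ) i) :=
  (continuous_apply i).comp continuous_subtype_val

/-! ### Infinite definable subsets of a one-dimensional manifold have interior points -/

/-- Over an interval that contains no discontinuity, a section of a coordinate is an arc. -/
theorem isArc_of_section {B : Set (Fin n → ℝ)} (hBM : B ⊆ M) {i : Fin n}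
    (hi : Set.InjOn (fun p => p i) B) {c d : ℝ} (hcd : c < d)
    (hsub : Set.Ioo c d ⊆ (fun p => p i) '' B \ (fun p => p i) '' {p ∈ B | ¬ SectionContAt B i p}) :
    IsArc {p : M | (p : Fin n → ℝ) ∈ B ∧ (p : Fin n → ℝ) i ∈ Set.Ioo c d} := by
  have hex : ∀ t ∈ Set.Ioo c d, ∃ p : M, (p : Fin n → ℝ) ∈ B ∧ (p : Fin n → ℝ) i = t := by
    intro t ht
    obtain ⟨p, hp, hpt⟩ := (hsub ht).1
    exact ⟨⟨p, hBM hp⟩, hp, hpt⟩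
  have : Nonempty M := by
    obtain ⟨t, ht⟩ := Set.nonempty_Ioo.2 hcd
    exact ⟨(hex t ht).choose⟩
  choose! γ hγB hγi using hex
  have hgood : ∀ t ∈ Set.Ioo c d, SectionContAt B i (γ t) := by
    intro t ht
    by_contra h
    exact (hsub ht).2 ⟨γ t, ⟨hγB t ht, h⟩, hγi t ht⟩
  refine ⟨c, d, γ, hcd, ?_, ?_, ?_⟩
  · rw [IsInducing.subtypeVal.continuousOn_iff]
    intro t ht
    refine ContinuousAt.continuousWithinAt ?_
    refine tendsto_pi_nhds.2 fun j => Metric.tendsto_nhds.2 fun ε hε => ?_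
    obtain ⟨c', d', h1, h2⟩ := hgood t ht (fun k => (γ t : Fin n → ℝ) k - ε)
      (fun k => (γ t : Fin n → ℝ) k + ε) (fun k => ⟨by linarith, by linarith⟩)
    rw [hγi t ht] at h1
    filter_upwards [Ioo_mem_nhds h1.1 h1.2, Ioo_mem_nhds ht.1 ht.2] with s hs hs'
    have h3 := h2 (γ s) (hγB s hs') (by rw [hγi s hs']; exact hs) j
    simp only [Function.comp_apply]
    rw [Real.dist_eq, abs_lt]
    constructor <;> linarith [h3.1, h3.2]
  · intro s hs t ht hst
    rw [← hγi s hs, ← hγi t ht, hst]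
  · ext p
    constructor
    · rintro ⟨t, ht, rfl⟩
      exact ⟨hγB t ht, by rw [hγi t ht]; exact ht⟩
    · rintro ⟨hpB, hp⟩
      exact ⟨_, hp, Subtype.ext (hi (hγB _ hp) hpB (hγi _ hp))⟩

/-- An infinite definable set contains an arc, by induction on the number of coordinates that are not
constant on it: either a fibre of one of them is infinite, or there is a definable section over an
infinite set of values. -/
theorem exists_isArc_subset_of_infinite {A : Set M} (hA : O.DefSub A) (hinf : A.Infinite) :
    ∃ C ⊆ A, IsArc C := by
  have key : ∀ (S : Finset (Fin n)) (B : Set (Fin n → ℝ)), B ∈ O.Def n → B ⊆ M → B.Infinite →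
      (∀ j ∉ S, ∀ p ∈ B, ∀ q ∈ B, p j = q j) → ∃ C : Set M, IsArc C ∧ Subtype.val '' C ⊆ B := by
    intro S
    induction S using Finset.induction_on with
    | empty =>
      intro B _ _ hinf hconst
      refine absurd (Set.Subsingleton.finite fun p hp q hq => funext fun j =>
        hconst j (by simp) p hp q hq) hinf
    | insert i S _ ih =>
      intro B hB hBM hinf hconst
      by_cases hfib : ∀ t, {p ∈ B | p i = t}.Finite
      · obtain ⟨B', hsub, hdef, himg, hinj⟩ := exists_section hB i hfib
        have hJ : ((fun p : Fin n → ℝ => p i) '' B').Infinite := by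
          intro hfin
          rw [himg] at hfin
          refine hinf ((hfin.biUnion fun t _ => hfib t).subset fun p hp => ?_)
          exact Set.mem_biUnion ⟨p, hp, rfl⟩ ⟨hp, rfl⟩
        obtain ⟨c, d, hcd, h⟩ := (DefReal.image hdef i).exists_Ioo_subset hJ
          ((finite_not_sectionContAt hdef hinj).image _)
        refine ⟨_, isArc_of_section (hsub.trans hBM) hinj hcd h, ?_⟩
        rintro _ ⟨p, hp, rfl⟩
        exact hsub hp.1
      · push Not at hfib
        obtain ⟨t, ht⟩ := hfib
        obtain ⟨C, hC, hCB⟩ := ih {p ∈ B | p i = t}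
          (defPred_iff_mem.1 ((DefPred.mem hB id).and (DefPred.eqConst i t)))
          (fun p hp => hBM hp.1) ht (by
            intro j hj p hp q hq
            by_cases hji : j = i
            · rw [hji, hp.2, hq.2]
            · exact hconst j (by simp [hji, hj]) p hp.1 q hq.1)
        exact ⟨C, hC, hCB.trans fun p hp => hp.1⟩
  obtain ⟨C, hC, hCA⟩ := key Finset.univ _ hA (by rintro _ ⟨p, -, rfl⟩; exact p.2)
    (hinf.image Subtype.val_injective.injOn) (by simp)
  exact ⟨C, (Set.image_subset_image_iff Subtype.val_injective).1 hCA, hC⟩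

/-- The topological frontier in the one-dimensional manifold `M` of a definable set is finite:
otherwise it contains an arc and has a nonempty interior, in which the set is dense. The part of the
set in this interior is infinite, so it contains an arc as well, which is an open subset of the set
made of frontier points. -/
theorem DefSub.finite_frontier [ChartedSpace ℝ M] (hM : M ∈ O.Def n) {A : Set M}
    (hA : O.DefSub A) : (_root_.frontier A).Finite := by
  by_contra hinf
  obtain ⟨C, hCF, hC⟩ := exists_isArc_subset_of_infinite (hA.frontier hM) hinf
  -- `C` need not be definable, the interior of the frontier is
  set U := _root_.interior (_root_.frontier A)
  have hUdef : O.DefSub U := (hA.frontier hM).interior hM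
  have hU : U.Nonempty := hC.nonempty.mono (interior_maximal hCF hC.isOpen)
  have hAU : (A ∩ U).Infinite := by
    intro hfin
    have hV : IsOpen (U \ (A ∩ U)) := isOpen_interior.sdiff hfin.isClosed
    obtain ⟨p, hp⟩ := hU
    obtain ⟨q, hq⟩ := ((infinite_of_mem_nhds_chartedSpace_real
      (isOpen_interior.mem_nhds hp)).sdiff hfin).nonempty
    obtain ⟨r, hrV, hrA⟩ := mem_closure_iff.1
      (frontier_subset_closure (interior_subset hq.1)) _ hV hq
    exact hrV.2 ⟨hrA, hrV.1⟩
  obtain ⟨D, hDA, hD⟩ := exists_isArc_subset_of_infinite (hA.inter hUdef) hAU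
  obtain ⟨p, hp⟩ := hD.nonempty
  have hpF : p ∈ _root_.frontier A := interior_subset (hDA hp).2
  exact hpF.2 (interior_maximal (fun q hq => (hDA hq).1) hD.isOpen hp)

/-! ### Monotonicity -/

/-- The points near which a function is constant. -/
def locConst {X : Type*} [TopologicalSpace X] (f : X → ℝ) : Set X :=
  {p | ∀ᶠ q in 𝓝 p, f q = f p}

/-- The finitely many points at which a definable function can change its behaviour: the local
extrema near which it is not constant, and the frontier of the set where it is locally constant. -/
def turningPoints {X : Type*} [TopologicalSpace X] (f : X → ℝ) : Set X :=
  ({p | IsLocalExtr f p} \ locConst f) ∪ frontier (locConst f)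

/-- A local maximal value is the supremum of the function over a member of a countable basis. -/
theorem countable_image_isLocalMax {X : Type*} [TopologicalSpace X] [SecondCountableTopology X]
    (f : X → ℝ) : (f '' {p | IsLocalMax f p}).Countable := by
  refine ((TopologicalSpace.countable_countableBasis X).image
    (fun U => sSup (f '' U))).mono ?_
  rintro _ ⟨p, hp, rfl⟩
  obtain ⟨U, hU, hpU, hsub⟩ :=
    (TopologicalSpace.isBasis_countableBasis X).mem_nhds_iff.1 (show {q | f q ≤ f p} ∈ 𝓝 p from hp)
  refine ⟨U, hU, IsGreatest.csSup_eq ⟨⟨p, hpU, rfl⟩, ?_⟩⟩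
  rintro _ ⟨q, hq, rfl⟩
  exact hsub hq

theorem countable_image_isLocalExtr {X : Type*} [TopologicalSpace X] [SecondCountableTopology X]
    (f : X → ℝ) : (f '' {p | IsLocalExtr f p}).Countable := by
  have h1 := countable_image_isLocalMax f
  have h2 := (countable_image_isLocalMax (-f)).image (fun t => -t)
  refine (h1.union h2).mono ?_
  rintro _ ⟨p, hp, rfl⟩
  rcases hp with hp | hp
  · exact Or.inr ⟨-f p, ⟨p, hp.neg, rfl⟩, neg_neg _⟩
  · exact Or.inl ⟨p, hp, rfl⟩

theorem IsDefinableFun.defSub_locConst (hM : M ∈ O.Def n) {f : M → ℝ} (hf : O.IsDefinableFun f) :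
    O.DefSub (locConst f) := by
  have h := (hf.defRel_le.eventually_nhds hM).inter (hf.defRel_le.swap.eventually_nhds hM)
  convert h using 1
  ext p
  simp only [locConst, Set.mem_ofPred_eq, Set.mem_inter_iff, ← eventually_and]
  refine eventually_congr (Eventually.of_forall fun q => ?_)
  rw [eq_comm, le_antisymm_iff]

/-- A definable function has finitely many turning points. Local extrema have countably many
values, and a local extremum near which the function is not constant lies on the frontier of its
level set. -/
theorem IsDefinableFun.finite_turningPoints [ChartedSpace ℝ M] (hM : M ∈ O.Def n) {f : M → ℝ}
    (hf : O.IsDefinableFun f) : (turningPoints f).Finite := by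
  refine Set.Finite.union ?_ ((hf.defSub_locConst hM).finite_frontier hM)
  have hdef : O.DefSub ({p | IsLocalExtr f p} \ locConst f) :=
    ((hf.defRel_le.eventually_nhds hM).union (hf.defRel_le.swap.eventually_nhds hM)).diff
      (hf.defSub_locConst hM)
  refine hdef.finite_of_countable ?_
  have hlev : ∀ c, (_root_.frontier (f ⁻¹' {c})).Finite := fun c =>
    (hf.preimage Set.ordConnected_singleton).finite_frontier hM
  refine ((countable_image_isLocalExtr f).biUnion fun c _ => (hlev c).countable).mono ?_
  rintro p ⟨hp, hpc⟩
  refine Set.mem_biUnion ⟨p, hp, rfl⟩ ⟨subset_closure rfl, fun hint => hpc ?_⟩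
  exact mem_interior_iff_mem_nhds.1 hint

theorem _root_.IsPreconnected.subset_interior_or_subset_compl_closure {X : Type*}
    [TopologicalSpace X] {s t : Set X} (hs : IsPreconnected s) (hd : Disjoint s (_root_.frontier t)) :
    s ⊆ _root_.interior t ∨ s ⊆ (closure t)ᶜ := by
  refine hs.subset_or_subset isOpen_interior isClosed_closure.isOpen_compl
    (Set.disjoint_left.2 fun p hp hp' => hp' (interior_subset_closure hp)) fun p hp => ?_
  by_contra h
  simp only [Set.mem_union, Set.mem_compl_iff, not_or, not_not] at h
  exact Set.disjoint_left.1 hd hp ⟨h.2, h.1⟩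

/-- On an arc without turning points a continuous function is constant or injective. -/
theorem const_or_injOn_of_isArc {X : Type*} [TopologicalSpace X] [ChartedSpace ℝ X] {f : X → ℝ}
    (hf : Continuous f) {C : Set X} (hC : IsArc C) (hd : Disjoint C (turningPoints f)) :
    (C ⊆ locConst f ∧ ∃ c, ∀ p ∈ C, f p = c) ∨ (Disjoint C (locConst f) ∧ Set.InjOn f C) := by
  have hdF : Disjoint C (frontier (locConst f)) := hd.mono_right Set.subset_union_right
  rcases hC.isPreconnected.subset_interior_or_subset_compl_closure hdF with h | h
  · left
    have hsub : C ⊆ locConst f := h.trans interior_subset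
    refine ⟨hsub, ?_⟩
    obtain ⟨p, hp⟩ := hC.nonempty
    refine ⟨f p, ?_⟩
    have h1 : C ⊆ {q | f q = f p} := by
      refine (hC.isPreconnected.subset_left_of_subset_union (u := C ∩ {q | f q = f p})
        (v := {q | f q ≠ f p}) ?_ (isOpen_ne_fun hf continuous_const) ?_ ?_ ⟨p, hp, hp, rfl⟩).trans
        Set.inter_subset_right
      · rw [isOpen_iff_mem_nhds]
        rintro q ⟨hq, hqp⟩
        filter_upwards [hC.isOpen.mem_nhds hq, hsub hq] with r hr hr'
        exact ⟨hr, hr'.trans hqp⟩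
      · exact Set.disjoint_left.2 fun q hq hq' => hq' hq.2
      · intro q hq
        by_cases hqp : f q = f p
        · exact Or.inl ⟨hq, hqp⟩
        · exact Or.inr hqp
    exact h1
  · right
    have hdL : Disjoint C (locConst f) :=
      Set.disjoint_left.2 fun p hp hp' => h hp (subset_closure hp')
    refine ⟨hdL, ?_⟩
    have hno : ∀ p ∈ C, ¬ IsLocalExtr f p := fun p hp hext =>
      Set.disjoint_left.1 hd hp (Or.inl ⟨hext, Set.disjoint_left.1 hdL hp⟩)
    obtain ⟨a, b, γ, hab, hc, hi, rfl⟩ := hC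
    -- a repeated value forces a local extremum in between
    have key : ∀ s ∈ Set.Ioo a b, ∀ t ∈ Set.Ioo a b, s < t → f (γ s) ≠ f (γ t) := by
      intro s hs t ht hst heq
      have hsub : Set.Icc s t ⊆ Set.Ioo a b := fun x hx => ⟨hs.1.trans_le hx.1, hx.2.trans_lt ht.2⟩
      obtain ⟨u, hu, hext⟩ := exists_isLocalExtr_Ioo hst
        (hf.comp_continuousOn (hc.mono hsub)) heq
      have hu' := hsub (Set.Ioo_subset_Icc_self hu)
      have hmap : 𝓝 (γ u) ≤ map γ (𝓝 u) := by
        intro V hV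
        have hV' : γ ⁻¹' V ∩ Set.Ioo a b ∈ 𝓝 u := Filter.inter_mem hV (isOpen_Ioo.mem_nhds hu')
        refine mem_of_superset (image_mem_nhds_of_injOn hV' (hc.mono Set.inter_subset_right)
          (hi.mono Set.inter_subset_right)) ?_
        rintro _ ⟨x, hx, rfl⟩
        exact hx.1
      refine hno _ ⟨u, hu', rfl⟩ ?_
      rcases hext with h | h
      · exact Or.inl (hmap h)
      · exact Or.inr (hmap h)
    rintro _ ⟨s, hs, rfl⟩ _ ⟨t, ht, rfl⟩ hst
    rcases lt_trichotomy s t with h | h | h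
    · exact absurd hst (key s hs t ht h)
    · rw [h]
    · exact absurd hst.symm (key t ht s hs h)

end OMinimalStructure

namespace OMinimalStructure

variable {O : OMinimalStructure} {n : ℕ} {M : Set (Fin n → ℝ)}

/-! ### Decomposition of definable sets into points and definable arcs -/

/-- The set is a finite disjoint union of points and definable arcs. -/
def HasDefDecomp (O : OMinimalStructure) {M : Set (Fin n → ℝ)} (A : Set M) : Prop :=
  ∃ (P : Finset M) (𝒞 : Finset (Set M)), IsArcDecomp A P 𝒞 ∧ ∀ C ∈ 𝒞, O.DefSub C

theorem HasDefDecomp.of_finite {A : Set M} (hA : A.Finite) : O.HasDefDecomp A :=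
  ⟨hA.toFinset, ∅, ⟨by simp, by simp, by simp, by simp⟩, by simp⟩

theorem HasDefDecomp.of_isArc {C : Set M} (hC : IsArc C) (hdef : O.DefSub C) :
    O.HasDefDecomp C :=
  ⟨∅, {C}, ⟨by simp, by simpa using hC, by simp, by simp⟩, by simpa using hdef⟩

theorem HasDefDecomp.union {A B : Set M} (hA : O.HasDefDecomp A) (hB : O.HasDefDecomp B)
    (hAB : Disjoint A B) : O.HasDefDecomp (A ∪ B) := by
  classical
  obtain ⟨P, 𝒞, h, hd⟩ := hA
  obtain ⟨P', 𝒞', h', hd'⟩ := hB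
  refine ⟨P ∪ P', 𝒞 ∪ 𝒞', (h.union h' hAB).1, fun C hC => ?_⟩
  rcases Finset.mem_union.1 hC with hC | hC
  exacts [hd C hC, hd' C hC]

/-- The image of a section of a bounded coordinate decomposes: cut at the finitely many values
where the section is discontinuous or its domain begins or ends. -/
theorem hasDefDecomp_of_injOn (hM : M ∈ O.Def n) {A : Set M} (hA : O.DefSub A) {i : Fin n}
    (hi : Set.InjOn (fun p : M => (p : Fin n → ℝ) i) A) {c d : ℝ} (hcd : c < d)
    (hb : ∀ p ∈ A, (p : Fin n → ℝ) i ∈ Set.Ioo c d) : O.HasDefDecomp A := by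
  classical
  set B : Set (Fin n → ℝ) := Subtype.val '' A
  have hBM : B ⊆ M := by rintro _ ⟨p, -, rfl⟩; exact p.2
  have hiB : Set.InjOn (fun p => p i) B := by
    rintro _ ⟨p, hp, rfl⟩ _ ⟨q, hq, rfl⟩ hpq
    rw [hi hp hq hpq]
  set J := (fun p : Fin n → ℝ => p i) '' B
  have hTfin : (frontier J ∪ (fun p => p i) '' {p ∈ B | ¬ SectionContAt B i p}).Finite :=
    (DefReal.image hA i).finite_frontier.union ((finite_not_sectionContAt hA hiB).image _)
  set T := hTfin.toFinset
  have hpre : ∀ {I : Set ℝ}, I.OrdConnected → O.DefSub {p : M | p ∈ A ∧ (p : Fin n → ℝ) i ∈ I} :=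
    fun hI => hA.inter ((isDefinableFun_coord hM i).preimage hI)
  have key : ∀ (k : ℕ) (c d : ℝ), c < d → (T.filter (· ∈ Set.Ioo c d)).card ≤ k →
      O.HasDefDecomp {p : M | p ∈ A ∧ (p : Fin n → ℝ) i ∈ Set.Ioo c d} := by
    intro k
    induction k with
    | zero =>
      intro c d hcd hk
      have hT : ∀ t ∈ Set.Ioo c d, t ∉ T := fun t ht htT => by
        have h0 := Finset.card_eq_zero.1 (Nat.le_zero.1 hk)
        exact Finset.notMem_empty t (h0 ▸ Finset.mem_filter.2 ⟨htT, ht⟩)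
      have hd : Disjoint (Set.Ioo c d) (frontier J) := Set.disjoint_left.2 fun t ht htJ =>
        hT t ht (hTfin.mem_toFinset.2 (Or.inl htJ))
      rcases isPreconnected_Ioo.subset_interior_or_subset_compl_closure hd with h | h
      · have harc := isArc_of_section hBM hiB hcd fun t ht =>
          ⟨interior_subset (h ht), fun hb => hT t ht (hTfin.mem_toFinset.2 (Or.inr hb))⟩
        have heq : {p : M | (p : Fin n → ℝ) ∈ B ∧ (p : Fin n → ℝ) i ∈ Set.Ioo c d} =
            {p : M | p ∈ A ∧ (p : Fin n → ℝ) i ∈ Set.Ioo c d} := by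
          ext p; simp [B]
        rw [heq] at harc
        exact HasDefDecomp.of_isArc harc (hpre Set.ordConnected_Ioo)
      · refine HasDefDecomp.of_finite (Set.Finite.subset Set.finite_empty fun p hp => ?_)
        exact h hp.2 (subset_closure ⟨p, ⟨p, hp.1, rfl⟩, rfl⟩)
    | succ k ih =>
      intro c d hcd hk
      by_cases hT : ∃ t ∈ Set.Ioo c d, t ∈ T
      · obtain ⟨t, ht, htT⟩ := hT
        have hlt : ∀ c' d', Set.Ioo c' d' ⊆ Set.Ioo c d → t ∉ Set.Ioo c' d' →
            (T.filter (· ∈ Set.Ioo c' d')).card ≤ k := by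
          intro c' d' hsub ht'
          have : (T.filter (· ∈ Set.Ioo c' d')).card < (T.filter (· ∈ Set.Ioo c d)).card := by
            refine Finset.card_lt_card ⟨fun s hs => ?_, fun h => ?_⟩
            · rw [Finset.mem_filter] at hs ⊢
              exact ⟨hs.1, hsub hs.2⟩
            · exact ht' (Finset.mem_filter.1 (h (Finset.mem_filter.2 ⟨htT, ht⟩))).2
          omega
        have h1 := ih c t ht.1 (hlt c t (Set.Ioo_subset_Ioo_right ht.2.le) fun h => h.2.false)
        have h2 := ih t d ht.2 (hlt t d (Set.Ioo_subset_Ioo_left ht.1.le) fun h => h.1.false)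
        have h3 : O.HasDefDecomp {p : M | p ∈ A ∧ (p : Fin n → ℝ) i = t} :=
          HasDefDecomp.of_finite (Set.Subsingleton.finite fun p hp q hq =>
            hi hp.1 hq.1 (hp.2.trans hq.2.symm))
        have h4 := (h1.union h2 (Set.disjoint_left.2 fun p hp hp' =>
          lt_asymm hp.2.2 hp'.2.1)).union h3 (Set.disjoint_left.2 fun p hp hp' => by
            rcases hp with hp | hp
            · exact hp.2.2.ne hp'.2
            · exact hp.2.1.ne' hp'.2)
        convert h4 using 1
        ext p
        simp only [Set.mem_ofPred_eq, Set.mem_union, Set.mem_Ioo, ← and_or_left]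
        refine and_congr_right fun _ => ?_
        constructor
        · rintro ⟨h1, h2⟩
          rcases lt_trichotomy ((p : Fin n → ℝ) i) t with h | h | h
          · exact Or.inl (Or.inl ⟨h1, h⟩)
          · exact Or.inr h
          · exact Or.inl (Or.inr ⟨h, h2⟩)
        · rintro ((h | h) | h)
          · exact ⟨h.1, h.2.trans ht.2⟩
          · exact ⟨ht.1.trans h.1, h.2⟩
          · exact h ▸ ht
      · push Not at hT
        refine ih c d hcd ?_
        rw [Finset.filter_false_of_mem fun t htT ht => hT t ht htT]
        simp
  have := key _ c d hcd le_rfl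
  convert this using 1
  ext p
  exact ⟨fun hp => ⟨hp, hb p hp⟩, fun hp => hp.1⟩

/-- Uniform finiteness of fibres on a compact set: each point has a neighbourhood made of the point
and two arcs without turning points, and the function is injective on an arc on which it is not
locally constant. -/
theorem exists_encard_fiber_le {X : Type*} [TopologicalSpace X] [T1Space X] [ChartedSpace ℝ X]
    {f : X → ℝ} (hf : Continuous f) (hF : (turningPoints f).Finite) {K : Set X}
    (hK : IsCompact K) :
    ∃ N : ℕ, ∀ t, (K ∩ {p | p ∉ turningPoints f ∧ p ∉ locConst f ∧ f p = t}).encard ≤ N := by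
  refine hK.induction_on (p := fun K => ∃ N : ℕ, ∀ t,
    (K ∩ {p | p ∉ turningPoints f ∧ p ∉ locConst f ∧ f p = t}).encard ≤ N) ⟨0, by simp⟩ ?_ ?_ ?_
  · rintro s t hst ⟨N, hN⟩
    exact ⟨N, fun c => (Set.encard_le_encard (Set.inter_subset_inter_left _ hst)).trans (hN c)⟩
  · rintro s t ⟨N, hN⟩ ⟨N', hN'⟩
    refine ⟨N + N', fun c => ?_⟩
    rw [Set.union_inter_distrib_right]
    push_cast
    exact (Set.encard_union_le _ _).trans (add_le_add (hN c) (hN' c))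
  · intro p _
    obtain ⟨C₁, C₂, h1, h2, hd1, hd2, hU⟩ := exists_two_sided_nhds p hF
    refine ⟨_, mem_nhdsWithin_of_mem_nhds hU, 3, fun t => ?_⟩
    have harc : ∀ C : Set X, IsArc C → Disjoint C (turningPoints f) →
        (C ∩ {p | p ∉ turningPoints f ∧ p ∉ locConst f ∧ f p = t}).encard ≤ 1 := by
      intro C hC hd
      rw [Set.encard_le_one_iff]
      rintro q r ⟨hq, -, hqL, hqt⟩ ⟨hr, -, -, hrt⟩
      rcases const_or_injOn_of_isArc hf hC hd with ⟨hL, -⟩ | ⟨-, hinj⟩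
      · exact absurd (hL hq) hqL
      · exact hinj hq hr (hqt.trans hrt.symm)
    rw [Set.union_inter_distrib_right, Set.union_inter_distrib_right]
    have hp : ({p} ∩ {p | p ∉ turningPoints f ∧ p ∉ locConst f ∧ f p = t}).encard ≤ 1 :=
      (Set.encard_le_encard Set.inter_subset_left).trans (Set.encard_singleton p).le
    calc _ ≤ _ := Set.encard_union_le _ _
      _ ≤ _ := add_le_add_left (Set.encard_union_le _ _) _
      _ ≤ 1 + 1 + 1 := add_le_add (add_le_add (harc C₁ h1 hd1) hp) (harc C₂ h2 hd2)
      _ = _ := by norm_num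

/-- Splitting off a section lowers the size of every nonempty fibre. -/
theorem hasDefDecomp_of_encard_fiber_le (hM : M ∈ O.Def n) (i : Fin n) {c d : ℝ} (hcd : c < d)
    (N : ℕ) {A : Set M} (hA : O.DefSub A) (hb : ∀ p ∈ A, (p : Fin n → ℝ) i ∈ Set.Ioo c d)
    (hN : ∀ t, {p ∈ A | (p : Fin n → ℝ) i = t}.encard ≤ N) : O.HasDefDecomp A := by
  induction N generalizing A with
  | zero =>
    refine HasDefDecomp.of_finite (Set.Finite.subset Set.finite_empty fun p hp => ?_)
    have := hN ((p : Fin n → ℝ) i)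
    rw [Nat.cast_zero, nonpos_iff_eq_zero, Set.encard_eq_zero] at this
    exact this.subset (show p ∈ {q ∈ A | (q : Fin n → ℝ) i = (p : Fin n → ℝ) i} from ⟨hp, rfl⟩)
  | succ N ih =>
    have hfin : ∀ t, {p ∈ (Subtype.val '' A : Set (Fin n → ℝ)) | p i = t}.Finite := by
      intro t
      have h1 : {p ∈ A | (p : Fin n → ℝ) i = t}.Finite :=
        Set.finite_of_encard_le_coe (hN t)
      refine (h1.image Subtype.val).subset ?_
      rintro _ ⟨⟨p, hp, rfl⟩, hpt⟩
      exact ⟨p, ⟨hp, hpt⟩, rfl⟩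
    obtain ⟨B, hBsub, hBdef, hBimg, hBinj⟩ := exists_section hA i hfin
    set S : Set M := {p : M | (p : Fin n → ℝ) ∈ B}
    have hSA : S ⊆ A := fun p hp => by
      obtain ⟨q, hq, hqp⟩ := hBsub hp
      exact Subtype.ext hqp ▸ hq
    have hS : O.DefSub S := DefSub.of_mem hM hBdef
    have h1 : O.HasDefDecomp S := hasDefDecomp_of_injOn hM hS
      (fun p hp q hq hpq => Subtype.ext (hBinj hp hq hpq)) hcd fun p hp => hb p (hSA hp)
    have h2 : O.HasDefDecomp (A \ S) := by
      refine ih (hA.diff hS) (fun p hp => hb p hp.1) fun t => ?_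
      by_cases hex : ∃ p ∈ A, (p : Fin n → ℝ) i = t
      · obtain ⟨p, hp, hpt⟩ := hex
        obtain ⟨q, hqB, hqt⟩ := hBimg.symm.subset ⟨p, ⟨p, hp, rfl⟩, rfl⟩
        obtain ⟨q, hq, rfl⟩ := hBsub hqB
        have h3 : insert q {p ∈ A \ S | (p : Fin n → ℝ) i = t} ⊆
            {p ∈ A | (p : Fin n → ℝ) i = t} := by
          rw [Set.insert_subset_iff]
          exact ⟨⟨hq, hqt.trans hpt⟩, fun r hr => ⟨hr.1.1, hr.2⟩⟩
        have h4 := (Set.encard_le_encard h3).trans (hN t)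
        rw [Set.encard_insert_of_notMem fun h => h.1.2 hqB] at h4
        push_cast at h4
        exact (ENat.add_le_add_iff_right (by simp)).1 h4
      · push Not at hex
        rw [Set.encard_eq_zero.2]
        · simp
        · exact Set.eq_empty_of_forall_notMem fun p hp => hex p hp.1.1 hp.2
    have := h1.union h2 Set.disjoint_sdiff_right
    rwa [Set.union_sdiff_cancel hSA] at this

/-- A definable subset of a compact part of a one-dimensional manifold is a finite disjoint union
of points and definable arcs. -/
theorem hasDefDecomp_of_subset_isCompact [ChartedSpace ℝ M] (hM : M ∈ O.Def n) {K : Set M}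
    (hK : IsCompact K) {A : Set M} (hA : O.DefSub A) (hAK : A ⊆ K) : O.HasDefDecomp A := by
  set x : Fin n → M → ℝ := fun i p => (p : Fin n → ℝ) i
  have hx : ∀ i, O.IsDefinableFun (x i) := fun i => isDefinableFun_coord hM i
  have hxc : ∀ i, Continuous (x i) := fun i => continuous_coord i
  have hTfin : ∀ i, (turningPoints (x i)).Finite := fun i => (hx i).finite_turningPoints hM
  set F : Set M := ⋃ i, turningPoints (x i)
  have hF : F.Finite := Set.finite_iUnion hTfin
  -- where the coordinate `i` is nowhere locally constant, its fibres are uniformly finite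
  have hstep : ∀ (i : Fin n) (A : Set M), O.DefSub A → A ⊆ K → Disjoint A F →
      Disjoint A (locConst (x i)) → O.HasDefDecomp A := by
    intro i A hA hAK hAF hAL
    obtain ⟨N, hN⟩ := exists_encard_fiber_le (hxc i) (hTfin i) hK
    obtain ⟨c, hc⟩ := (hK.image (hxc i)).bddBelow
    obtain ⟨d, hd⟩ := (hK.image (hxc i)).bddAbove
    rcases A.eq_empty_or_nonempty with rfl | ⟨p₀, hp₀⟩
    · exact HasDefDecomp.of_finite Set.finite_empty
    have hcd : c ≤ d := (hc ⟨p₀, hAK hp₀, rfl⟩).trans (hd ⟨p₀, hAK hp₀, rfl⟩)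
    refine hasDefDecomp_of_encard_fiber_le hM i (c := c - 1) (d := d + 1) (by linarith) N hA
      (fun p hp => ⟨?_, ?_⟩) fun t => (Set.encard_le_encard fun p hp => ?_).trans (hN t)
    · have := hc ⟨p, hAK hp, rfl⟩
      change c ≤ (p : Fin n → ℝ) i at this
      linarith
    · have := hd ⟨p, hAK hp, rfl⟩
      change (p : Fin n → ℝ) i ≤ d at this
      linarith
    · exact ⟨hAK hp.1, fun h => Set.disjoint_left.1 hAF hp.1 (Set.mem_iUnion.2 ⟨i, h⟩),
        Set.disjoint_left.1 hAL hp.1, hp.2⟩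
  -- the induction is on the set of coordinates that may fail to be locally constant
  have key : ∀ (S : Finset (Fin n)) (A : Set M), O.DefSub A → A ⊆ K → Disjoint A F →
      (∀ i ∉ S, A ⊆ locConst (x i)) → O.HasDefDecomp A := by
    intro S
    induction S using Finset.induction_on with
    | empty =>
      intro A _ _ _ hL
      refine HasDefDecomp.of_finite (Set.Finite.subset Set.finite_empty fun p hp => ?_)
      -- a point near which all coordinates are constant would be isolated
      have h1 : ∀ᶠ q in 𝓝 p, ∀ i, x i q = x i p := eventually_all.2 fun i => hL i (by simp) hp
      have h2 : {q : M | ∀ i, x i q = x i p} ⊆ {p} := fun q hq => Subtype.ext (funext hq)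
      exact infinite_of_mem_nhds_chartedSpace_real h1 ((Set.finite_singleton p).subset h2)
    | insert i S _ ih =>
      intro A hA hAK hAF hL
      have hLdef := (hx i).defSub_locConst hM
      have h1 := ih (A ∩ locConst (x i)) (hA.inter hLdef) (Set.inter_subset_left.trans hAK)
        (hAF.mono_left Set.inter_subset_left) (fun j hj => by
          by_cases hji : j = i
          · rw [hji]; exact Set.inter_subset_right
          · exact Set.inter_subset_left.trans (hL j (by simp [hji, hj])))
      have h2 := hstep i (A \ locConst (x i)) (hA.diff hLdef) (Set.sdiff_subset.trans hAK)
        (hAF.mono_left Set.sdiff_subset) Set.disjoint_sdiff_left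
      have := h1.union h2 (Set.disjoint_left.2 fun p hp hp' => hp'.2 hp.2)
      rwa [Set.inter_union_sdiff] at this
  have h1 : O.HasDefDecomp (A ∩ F) := HasDefDecomp.of_finite (hF.subset Set.inter_subset_right)
  have h2 := key Finset.univ (A \ F) (hA.diff (DefSub.of_finite hM hF))
    (Set.sdiff_subset.trans hAK) Set.disjoint_sdiff_left (by simp)
  have := h1.union h2 (Set.disjoint_left.2 fun p hp hp' => hp'.2 hp.2)
  rwa [Set.inter_union_sdiff] at this

end OMinimalStructure

/-! ### Simplices in one-dimensional manifolds -/

theorem openSimplex_zero_subsingleton : Subsingleton (openSimplex 0) := by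
  refine ⟨fun v w => Subtype.ext (funext fun i => ?_)⟩
  have hv : ∑ i : Fin 1, (v : Fin 1 → ℝ) i = 1 := v.2.2
  have hw : ∑ i : Fin 1, (w : Fin 1 → ℝ) i = 1 := w.2.2
  rw [Fin.sum_univ_one] at hv hw
  rw [Fin.eq_zero i, hv, hw]

theorem openSimplex_zero_nonempty : Nonempty (openSimplex 0) :=
  ⟨⟨fun _ => 1, by simp [openSimplex]⟩⟩

/-- The open one-dimensional simplex is an open interval. -/
noncomputable def iooHomeomorphOpenSimplex {a b : ℝ} (hab : a < b) :
    Set.Ioo a b ≃ₜ openSimplex 1 where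
  toFun t := ⟨![(t - a) / (b - a), (b - t) / (b - a)], by
    have h : 0 < b - a := sub_pos.2 hab
    refine ⟨?_, ?_⟩
    · intro i
      fin_cases i
      · exact div_pos (sub_pos.2 t.2.1) h
      · exact div_pos (sub_pos.2 t.2.2) h
    · rw [Fin.sum_univ_two]
      simp only [Matrix.cons_val_zero, Matrix.cons_val_one]
      field_simp
      ring⟩
  invFun w := ⟨a + (w : Fin 2 → ℝ) 0 * (b - a), by
    have h : 0 < b - a := sub_pos.2 hab
    have h0 := w.2.1 0
    have h1 := w.2.1 1
    have hs := w.2.2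
    rw [Fin.sum_univ_two] at hs
    constructor <;> nlinarith [mul_pos h0 h, mul_pos h1 h]⟩
  left_inv t := by
    have h : b - a ≠ 0 := (sub_pos.2 hab).ne'
    ext
    simp only [Matrix.cons_val_zero]
    field_simp
    ring
  right_inv w := by
    have h : b - a ≠ 0 := (sub_pos.2 hab).ne'
    have hs := w.2.2
    rw [Fin.sum_univ_two] at hs
    ext i
    fin_cases i
    · simp [h]
    · change (b - (a + (w : Fin 2 → ℝ) 0 * (b - a))) / (b - a) = (w : Fin 2 → ℝ) 1
      rw [div_eq_iff h]
      linear_combination (-(b - a)) * hs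
  continuous_toFun := by
    refine Continuous.subtype_mk (continuous_pi fun i => ?_) _
    fin_cases i <;> simp <;> fun_prop
  continuous_invFun := by
    exact Continuous.subtype_mk (continuous_const.add
      (((continuous_apply 0).comp continuous_subtype_val).mul continuous_const)) _

section OneManifold

variable {X : Type*} [TopologicalSpace X]

theorem isArc_range {a b : ℝ} (hab : a < b) {γ : Set.Ioo a b → X} (hc : Continuous γ)
    (hi : Function.Injective γ) : IsArc (Set.range γ) := by
  obtain ⟨t₀, ht₀⟩ := Set.nonempty_Ioo.2 hab
  classical
  set γ' : ℝ → X := fun t => if h : t ∈ Set.Ioo a b then γ ⟨t, h⟩ else γ ⟨t₀, ht₀⟩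
  have hγ' : ∀ t : Set.Ioo a b, γ' t = γ t := fun t => dif_pos t.2
  refine ⟨a, b, γ', hab, ?_, ?_, ?_⟩
  · rw [continuousOn_iff_continuous_domRestrict]
    convert hc using 1
    exact funext hγ'
  · intro s hs t ht hst
    have := hi ((hγ' ⟨s, hs⟩).symm.trans (hst.trans (hγ' ⟨t, ht⟩)))
    exact congrArg Subtype.val this
  · ext x
    constructor
    · rintro ⟨t, ht, rfl⟩
      exact ⟨⟨t, ht⟩, (hγ' ⟨t, ht⟩).symm⟩
    · rintro ⟨t, rfl⟩
      exact ⟨t, t.2, hγ' t⟩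

variable [ChartedSpace ℝ X]

/-- Simplices of dimension at least two do not inject continuously into a one-dimensional
manifold, since they contain planes of arbitrarily small size. -/
theorem not_injective_of_continuous_openSimplex {d : ℕ} (hd : 2 ≤ d) {f : openSimplex d → X}
    (hf : Continuous f) : ¬ Function.Injective f := by
  intro hi
  obtain ⟨e, rfl⟩ : ∃ e, d = e + 2 := ⟨d - 2, by omega⟩
  -- the plane through the barycentre spanned by two differences of vertices
  set g : ℝ × ℝ → (Fin (e + 2 + 1) → ℝ) := fun z i =>
    1 / ((e : ℝ) + 3) + (if i = 0 then z.1 else 0) + (if i = 1 then z.2 else 0)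
      - (if i = 2 then z.1 + z.2 else 0) with hg
  have hgc : Continuous g := by
    refine continuous_pi fun i => ?_
    simp only [hg]
    split_ifs <;> fun_prop
  have hgsum : ∀ z, ∑ i, g z i = 1 := by
    intro z
    simp only [hg, Finset.sum_sub_distrib, Finset.sum_add_distrib, Finset.sum_ite_eq',
      Finset.mem_univ, if_true, Finset.sum_const, Finset.card_univ, Fintype.card_fin, nsmul_eq_mul]
    have : (e : ℝ) + 3 ≠ 0 := by positivity
    push_cast
    field_simp
    ring
  have h01 : (0 : Fin (e + 2 + 1)) ≠ 1 := by simp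
  have h02 : (0 : Fin (e + 2 + 1)) ≠ 2 := by
    rw [Ne, Fin.ext_iff]
    change ¬ 0 = 2 % (e + 2 + 1)
    rw [Nat.mod_eq_of_lt (by omega)]
    omega
  have h12 : (1 : Fin (e + 2 + 1)) ≠ 2 := by
    rw [Ne, Fin.ext_iff]
    change ¬ 1 % (e + 2 + 1) = 2 % (e + 2 + 1)
    rw [Nat.mod_eq_of_lt (by omega), Nat.mod_eq_of_lt (by omega)]
    omega
  have hgi : Function.Injective g := by
    intro z w hzw
    have h0 := congrFun hzw 0
    have h1 := congrFun hzw 1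
    simp only [hg, if_true, h01, h02, h12, h01.symm, if_false] at h0 h1
    exact Prod.ext (by linarith) (by linarith)
  have hpos : ∀ᶠ z in 𝓝 (0 : ℝ × ℝ), ∀ i, 0 < g z i := by
    refine eventually_all.2 fun i => ?_
    refine ((continuous_apply i).comp hgc).continuousAt.eventually (lt_mem_nhds ?_)
    simp only [hg, Function.comp_apply, Prod.fst_zero, Prod.snd_zero, add_zero, ite_self, sub_zero]
    positivity
  have h0mem : g 0 ∈ openSimplex (e + 2) := ⟨hpos.self_of_nhds, hgsum 0⟩
  set φ := chartAt ℝ (f ⟨g 0, h0mem⟩)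
  obtain ⟨V, hV, hVf⟩ := isOpen_induced_iff.1 (φ.open_source.preimage hf)
  have h0V : g 0 ∈ V := by
    have : (⟨g 0, h0mem⟩ : openSimplex (e + 2)) ∈ Subtype.val ⁻¹' V := by
      rw [hVf]
      exact mem_chart_source ℝ _
    exact this
  obtain ⟨ε, hε, hball⟩ := Metric.mem_nhds_iff.1
    (Filter.inter_mem hpos (hgc.continuousAt.preimage_mem_nhds (hV.mem_nhds h0V)))
  set u := OpenPartialHomeomorph.univBall (0 : ℝ × ℝ) ε
  have hu : ∀ z, u z ∈ Metric.ball (0 : ℝ × ℝ) ε := by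
    intro z
    rw [← OpenPartialHomeomorph.univBall_target (0 : ℝ × ℝ) hε]
    refine u.map_source ?_
    rw [OpenPartialHomeomorph.univBall_source]
    trivial
  have huc : Continuous u := OpenPartialHomeomorph.continuous_univBall _ _
  have hui : Function.Injective u := by
    have := u.injOn
    rwa [OpenPartialHomeomorph.univBall_source, Set.injOn_univ] at this
  set F : ℝ × ℝ → openSimplex (e + 2) := fun z => ⟨g (u z), (hball (hu z)).1, hgsum _⟩
  have hFc : Continuous F := (hgc.comp huc).subtype_mk _
  have hFi : Function.Injective F := fun z w h => hui (hgi (congrArg Subtype.val h))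
  have hFs : ∀ z, f (F z) ∈ φ.source := by
    intro z
    have : F z ∈ f ⁻¹' φ.source := by
      rw [← hVf]
      exact (hball (hu z)).2
    exact this
  refine not_injective_of_continuous_plane (f := fun z => φ (f (F z))) ?_ ?_
  · exact φ.continuousOn.comp_continuous (hf.comp hFc) hFs
  · exact fun z w h => hFi (hi (φ.injOn (hFs z) (hFs w) h))

end OneManifold

namespace OMinimalStructure

variable {O : OMinimalStructure} {n : ℕ} {M : Set (Fin n → ℝ)}

/-! ### The Euler characteristic of definable subsets of a one-dimensional manifold -/

/-- A subset of a one-dimensional manifold homeomorphic to an open simplex is a point or an arc. -/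
theorem exists_isArcDecomp_of_homeomorph [ChartedSpace ℝ M] {D : Set M} {C : Set (Fin n → ℝ)}
    (hD : Subtype.val '' D = C) {d : ℕ} (e : C ≃ₜ openSimplex d) :
    ∃ (P : Finset M) (𝒞 : Finset (Set M)), IsArcDecomp D P 𝒞 ∧
      (P.card : ℤ) - 𝒞.card = (-1) ^ d := by
  have hCM : C ⊆ M := by rw [← hD]; rintro _ ⟨p, -, rfl⟩; exact p.2
  set ι : openSimplex d → M := fun w => Set.inclusion hCM (e.symm w)
  have hc : Continuous ι := (continuous_inclusion hCM).comp e.symm.continuous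
  have hi : Function.Injective ι := (Set.inclusion_injective hCM).comp e.symm.injective
  have hr : Set.range ι = D := by
    ext p
    constructor
    · rintro ⟨w, rfl⟩
      obtain ⟨q, hq, hqw⟩ := hD.symm.subset (e.symm w).2
      have : q = ι w := Subtype.ext hqw
      exact this ▸ hq
    · intro hp
      have hpC : (p : Fin n → ℝ) ∈ C := hD ▸ Set.mem_image_of_mem _ hp
      refine ⟨e ⟨p, hpC⟩, Subtype.ext ?_⟩
      simp [ι]
  match d, ι, hc, hi, hr with
  | 0, ι, _, _, hr =>
    obtain ⟨w⟩ := openSimplex_zero_nonempty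
    have := openSimplex_zero_subsingleton
    have hD' : D = {ι w} := by
      rw [← hr]
      refine Set.Subset.antisymm ?_ (by simp)
      rintro _ ⟨v, rfl⟩
      rw [Subsingleton.elim v w]
      rfl
    exact ⟨{ι w}, ∅, ⟨by simp [hD'], by simp, by simp, by simp⟩, by simp⟩
  | 1, ι, hc, hi, hr =>
    have harc : IsArc D := by
      have := isArc_range (zero_lt_one (α := ℝ))
        (hc.comp (iooHomeomorphOpenSimplex zero_lt_one).continuous)
        (hi.comp (iooHomeomorphOpenSimplex zero_lt_one).injective)
      rwa [(iooHomeomorphOpenSimplex zero_lt_one).surjective.range_comp, hr] at this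
    exact ⟨∅, {D}, ⟨by simp, by simpa using harc, by simp, by simp⟩, by simp⟩
  | d + 2, ι, hc, hi, _ =>
    exact absurd hi (not_injective_of_continuous_openSimplex (by omega) hc)

/-- The decompositions that define the Euler characteristic of a subset of a one-dimensional manifold
consist of points and arcs. -/
theorem HasEulerChar.exists_isArcDecomp [ChartedSpace ℝ M] {A : Set M} {c : ℤ}
    (h : O.HasEulerChar (Subtype.val '' A) c) :
    ∃ (P : Finset M) (𝒞 : Finset (Set M)), IsArcDecomp A P 𝒞 ∧ (P.card : ℤ) - 𝒞.card = c := by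
  classical
  obtain ⟨k, C, d, -, hhom, hdisj, hunion, rfl⟩ := h
  have hCM : ∀ i, C i ⊆ M := fun i x hx => by
    obtain ⟨p, -, rfl⟩ := hunion.subset (Set.mem_iUnion.2 ⟨i, hx⟩)
    exact p.2
  set D : Fin k → Set M := fun i => Subtype.val ⁻¹' C i
  have hD : ∀ i, Subtype.val '' D i = C i := fun i => by
    rw [Subtype.image_preimage_coe, Set.inter_eq_right.2 (hCM i)]
  have key : ∀ s : Finset (Fin k), ∃ (P : Finset M) (𝒞 : Finset (Set M)),
      IsArcDecomp (⋃ i ∈ s, D i) P 𝒞 ∧ (P.card : ℤ) - 𝒞.card = ∑ i ∈ s, (-1 : ℤ) ^ d i := by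
    intro s
    induction s using Finset.induction_on with
    | empty => exact ⟨∅, ∅, ⟨by simp, by simp, by simp, by simp⟩, by simp⟩
    | insert i s hi ih =>
      obtain ⟨P, 𝒞, h, hcard⟩ := ih
      obtain ⟨e⟩ := hhom i
      obtain ⟨P', 𝒞', h', hcard'⟩ := exists_isArcDecomp_of_homeomorph (hD i) e
      have hd : Disjoint (D i) (⋃ j ∈ s, D j) := by
        rw [Set.disjoint_iUnion₂_right]
        intro j hj
        exact (hdisj (show i ≠ j from fun hij => hi (hij ▸ hj))).preimage _
      obtain ⟨hu, hP, hC⟩ := h'.union h hd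
      refine ⟨_, _, by rwa [Finset.set_biUnion_insert], ?_⟩
      rw [Finset.sum_insert hi, hP, hC, ← hcard, ← hcard']
      push_cast
      ring
  obtain ⟨P, 𝒞, h, hcard⟩ := key Finset.univ
  refine ⟨P, 𝒞, ?_, hcard⟩
  convert h using 1
  have : Subtype.val '' A = Subtype.val '' (⋃ i, D i) := by
    rw [Set.image_iUnion, ← hunion]
    exact Set.iUnion_congr fun i => (hD i).symm
  simpa using Subtype.val_injective.image_injective this

theorem nonempty_homeomorph_of_isArc [ChartedSpace ℝ M] {C : Set M} (hC : IsArc C) :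
    Nonempty ((Subtype.val '' C : Set (Fin n → ℝ)) ≃ₜ openSimplex 1) := by
  obtain ⟨a, b, γ, hab, hc, hi, rfl⟩ := hC
  have hcont : Continuous ((Set.Ioo a b).domRestrict γ) := hc.domRestrict
  have hopen : IsOpenMap ((Set.Ioo a b).domRestrict γ) := by
    intro U hU
    have h1 : IsOpen (Subtype.val '' U : Set ℝ) := isOpen_Ioo.isOpenMap_subtype_val U hU
    have hsub : (Subtype.val '' U : Set ℝ) ⊆ Set.Ioo a b := by rintro _ ⟨t, -, rfl⟩; exact t.2
    have := isOpen_image_of_injOn h1 (hc.mono hsub) (hi.mono hsub)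
    rwa [Set.image_image] at this
  have hemb : IsEmbedding ((Set.Ioo a b).domRestrict γ) :=
    (IsOpenEmbedding.of_continuous_injective_isOpenMap hcont hi.injective hopen).isEmbedding
  have hemb' := IsEmbedding.subtypeVal.comp hemb
  have hr : Set.range (Subtype.val ∘ (Set.Ioo a b).domRestrict γ) =
      (Subtype.val '' (γ '' Set.Ioo a b) : Set (Fin n → ℝ)) := by
    rw [Set.range_comp, Set.range_domRestrict]
  exact ⟨(Homeomorph.setCongr hr.symm).trans
    (hemb'.toHomeomorph.symm.trans (iooHomeomorphOpenSimplex hab))⟩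

theorem IsArcDecomp.hasEulerChar [ChartedSpace ℝ M] (hM : M ∈ O.Def n) {A : Set M} {P : Finset M}
    {𝒞 : Finset (Set M)} (h : IsArcDecomp A P 𝒞) (hdef : ∀ C ∈ 𝒞, O.DefSub C) :
    O.HasEulerChar (Subtype.val '' A) (P.card - 𝒞.card) := by
  classical
  set C : P ⊕ 𝒞 → Set M := Sum.elim (fun p => {p.1}) (fun C => C.1)
  set d : P ⊕ 𝒞 → ℕ := Sum.elim (fun _ => 0) (fun _ => 1)
  set e := (Fintype.equivFin (P ⊕ 𝒞)).symm
  have hCdef : ∀ x, O.DefSub (C x) := by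
    rintro (p | D)
    · exact DefSub.singleton hM p.1
    · exact hdef D.1 D.2
  have hhom : ∀ x, Nonempty ((Subtype.val '' C x : Set (Fin n → ℝ)) ≃ₜ openSimplex (d x)) := by
    rintro (p | D)
    · have := openSimplex_zero_subsingleton
      obtain ⟨w⟩ := openSimplex_zero_nonempty
      have : Unique (openSimplex 0) := ⟨⟨w⟩, fun v => Subsingleton.elim v w⟩
      have hp : (Subtype.val '' C (Sum.inl p) : Set (Fin n → ℝ)) = {(p.1 : Fin n → ℝ)} :=
        Set.image_singleton
      rw [hp]
      change Nonempty (_ ≃ₜ openSimplex 0)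
      exact ⟨Homeomorph.homeomorphOfUnique _ _⟩
    · exact nonempty_homeomorph_of_isArc (h.isArc D.1 D.2)
  refine ⟨_, fun i => Subtype.val '' C (e i), fun i => d (e i), fun i => hCdef _, fun i => hhom _,
    ?_, ?_, ?_⟩
  · have : Pairwise fun i j => Disjoint (C i) (C j) := by
      rintro (p | D) (q | E) hne
      · refine Set.disjoint_singleton.2 fun hpq => hne (congrArg Sum.inl (Subtype.ext hpq))
      · exact Set.disjoint_singleton_left.2 (h.notMem p.1 p.2 E.1 E.2)
      · exact Set.disjoint_singleton_right.2 (h.notMem q.1 q.2 D.1 D.2)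
      · exact h.disjoint D.1 D.2 E.1 E.2 fun hDE => hne (congrArg Sum.inr (Subtype.ext hDE))
    intro i j hij
    exact (Set.disjoint_image_iff Subtype.val_injective).2 (this (e.injective.ne hij))
  · rw [← Set.image_iUnion]
    congr 1
    rw [e.surjective.iUnion_comp C]
    ext x
    rw [h.mem_iff, Set.mem_iUnion, Sum.exists]
    simp [C]
  · rw [e.sum_comp (fun i => (-1 : ℤ) ^ d i), Fintype.sum_sum_type]
    simp [d, sub_eq_add_neg]

/-- The Euler characteristic can be read off from any decomposition into points and definable arcs.
The decomposition chosen in its definition may be another one, with the same alternating count. -/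
theorem IsArcDecomp.eulerChar_eq [ChartedSpace ℝ M] (hM : M ∈ O.Def n) {A : Set M} {P : Finset M}
    {𝒞 : Finset (Set M)} (h : IsArcDecomp A P 𝒞) (hdef : ∀ C ∈ 𝒞, O.DefSub C) :
    O.eulerChar (Subtype.val '' A) = P.card - 𝒞.card := by
  have hex : ∃ c, O.HasEulerChar (Subtype.val '' A : Set (Fin n → ℝ)) c :=
    ⟨_, IsArcDecomp.hasEulerChar hM h hdef⟩
  obtain ⟨P', 𝒞', h', hcard⟩ := hex.choose_spec.exists_isArcDecomp
  rw [eulerChar, dif_pos hex, ← hcard]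
  exact h'.card_sub_card_eq h

theorem HasDefDecomp.eulerChar_union [ChartedSpace ℝ M] (hM : M ∈ O.Def n) {A B : Set M}
    (hA : O.HasDefDecomp A) (hB : O.HasDefDecomp B) (hAB : Disjoint A B) :
    O.eulerChar (Subtype.val '' (A ∪ B)) =
      O.eulerChar (Subtype.val '' A) + O.eulerChar (Subtype.val '' B) := by
  classical
  obtain ⟨P, 𝒞, h, hd⟩ := hA
  obtain ⟨P', 𝒞', h', hd'⟩ := hB
  obtain ⟨hu, hP, hC⟩ := h.union h' hAB
  rw [IsArcDecomp.eulerChar_eq hM h hd, IsArcDecomp.eulerChar_eq hM h' hd',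
    IsArcDecomp.eulerChar_eq hM hu, hP, hC]
  · push_cast
    ring
  · intro C hC
    rcases Finset.mem_union.1 hC with hC | hC
    exacts [hd C hC, hd' C hC]

theorem eulerChar_coe_finset [ChartedSpace ℝ M] (hM : M ∈ O.Def n) (P : Finset M) :
    O.eulerChar (Subtype.val '' (P : Set M)) = P.card := by
  have h : IsArcDecomp (P : Set M) P ∅ := ⟨by simp, by simp, by simp, by simp⟩
  rw [IsArcDecomp.eulerChar_eq hM h (by simp)]
  simp

theorem eulerChar_of_isArc [ChartedSpace ℝ M] (hM : M ∈ O.Def n) {C : Set M} (hC : IsArc C)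
    (hdef : O.DefSub C) : O.eulerChar (Subtype.val '' C) = -1 := by
  have h : IsArcDecomp C ∅ {C} := ⟨by simp, by simpa using hC, by simp, by simp⟩
  rw [IsArcDecomp.eulerChar_eq hM h (by simpa using hdef)]
  simp

theorem eulerChar_biUnion [ChartedSpace ℝ M] (hM : M ∈ O.Def n) (𝒞 : Finset (Set M))
    (f : Set M → Set M) (hf : ∀ C ∈ 𝒞, O.HasDefDecomp (f C))
    (hd : ∀ C ∈ 𝒞, ∀ D ∈ 𝒞, C ≠ D → Disjoint (f C) (f D)) :
    O.HasDefDecomp (⋃ C ∈ 𝒞, f C) ∧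
    O.eulerChar (Subtype.val '' (⋃ C ∈ 𝒞, f C)) = ∑ C ∈ 𝒞, O.eulerChar (Subtype.val '' (f C)) := by
  classical
  induction 𝒞 using Finset.induction_on with
  | empty =>
    refine ⟨HasDefDecomp.of_finite (by simp), ?_⟩
    simpa using eulerChar_coe_finset hM (∅ : Finset M)
  | insert C 𝒞 hC ih =>
    obtain ⟨h1, h2⟩ := ih (fun D hD => hf D (Finset.mem_insert_of_mem hD)) fun D hD E hE =>
      hd D (Finset.mem_insert_of_mem hD) E (Finset.mem_insert_of_mem hE)
    have h3 : Disjoint (f C) (⋃ D ∈ 𝒞, f D) := by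
      rw [Set.disjoint_iUnion₂_right]
      exact fun D hD => hd C (Finset.mem_insert_self _ _) D (Finset.mem_insert_of_mem hD)
        fun h => hC (h ▸ hD)
    have h4 := hf C (Finset.mem_insert_self _ _)
    rw [Finset.set_biUnion_insert, Finset.sum_insert hC, h4.eulerChar_union hM h1 h3, h2]
    exact ⟨h4.union h1 h3, rfl⟩

end OMinimalStructure

namespace OMinimalStructure

variable {O : OMinimalStructure} {n : ℕ} {M : Set (Fin n → ℝ)}

/-! ### Euler integrals over arcs -/

/-- An arc on which a continuous function is injective has a parametrization along which the
function increases. -/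
theorem _root_.IsArc.exists_strictMonoOn {X : Type*} [TopologicalSpace X] {C : Set X}
    (hC : IsArc C) {g : X → ℝ} (hg : Continuous g) (hinj : Set.InjOn g C) :
    ∃ (a b : ℝ) (γ : ℝ → X), a < b ∧ ContinuousOn γ (Set.Ioo a b) ∧ Set.InjOn γ (Set.Ioo a b) ∧
      γ '' Set.Ioo a b = C ∧ StrictMonoOn (g ∘ γ) (Set.Ioo a b) := by
  obtain ⟨a, b, γ, hab, hc, hi, rfl⟩ := hC
  have hgi : Set.InjOn (g ∘ γ) (Set.Ioo a b) := hinj.comp hi (Set.mapsTo_image _ _)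
  rcases (hg.comp_continuousOn hc).strictMonoOn_of_injOn_Ioo hab hgi with h | h
  · exact ⟨a, b, γ, hab, hc, hi, rfl, h⟩
  · have hm : Set.MapsTo (fun t : ℝ => -t) (Set.Ioo (-b) (-a)) (Set.Ioo a b) :=
      fun t ht => ⟨by linarith [ht.2], by linarith [ht.1]⟩
    refine ⟨-b, -a, fun t => γ (-t), by linarith, hc.comp continuous_neg.continuousOn hm,
      hi.comp neg_injective.injOn hm, ?_, fun s hs t ht hst => h (hm ht) (hm hs) (neg_lt_neg hst)⟩
    rw [← Set.image_image γ (fun t : ℝ => -t), Set.image_neg_Ioo, neg_neg, neg_neg]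

/-- The Euler characteristic of a superlevel set on an arc: the arc itself contributes `-1`, and a
nonempty proper superlevel set is a half-open arc. -/
theorem eulerChar_superlevel_of_isArc [ChartedSpace ℝ M] (hM : M ∈ O.Def n) {C : Set M}
    (hC : IsArc C) (hCdef : O.DefSub C) {g : M → ℝ} (hg : Continuous g)
    (hlev : ∀ y, O.DefSub {p | y ≤ g p}) (hmono : (∃ c, ∀ p ∈ C, g p = c) ∨ Set.InjOn g C)
    (hb : BddBelow (g '' C)) (y : ℝ) :
    O.eulerChar (Subtype.val '' (C ∩ {p | y ≤ g p})) = if y ≤ sInf (g '' C) then -1 else 0 := by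
  classical
  have hempty : O.eulerChar (Subtype.val '' (∅ : Set M)) = 0 := by
    simpa using eulerChar_coe_finset hM (∅ : Finset M)
  split_ifs with hy
  · have : C ∩ {p | y ≤ g p} = C :=
      Set.inter_eq_left.2 fun p hp => hy.trans (csInf_le hb ⟨p, hp, rfl⟩)
    rw [this, eulerChar_of_isArc hM hC hCdef]
  · obtain ⟨_, ⟨p, hp, rfl⟩, hpy⟩ := exists_lt_of_csInf_lt (hC.nonempty.image g) (not_le.1 hy)
    by_cases hq : ∃ q ∈ C, y ≤ g q
    · obtain ⟨q, hq, hqy⟩ := hq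
      rcases hmono with ⟨c, hc⟩ | hinj
      · exact absurd (hqy.trans_eq ((hc q hq).trans (hc p hp).symm)) hpy.not_ge
      obtain ⟨a, b, γ, hab, hc, hi, hγ, hmono⟩ := hC.exists_strictMonoOn hg hinj
      rw [← hγ] at hp hq
      obtain ⟨s, hs, rfl⟩ := hp
      obtain ⟨t, ht, rfl⟩ := hq
      obtain ⟨r, hr, hry⟩ := isPreconnected_Ioo.intermediate_value hs ht (hg.comp_continuousOn hc)
        ⟨hpy.le, hqy⟩
      have hrsub : Set.Ioo r b ⊆ Set.Ioo a b := Set.Ioo_subset_Ioo_left hr.1.le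
      have heq : C ∩ {p | y ≤ g p} = {γ r} ∪ γ '' Set.Ioo r b := by
        rw [← hγ]
        ext x
        constructor
        · rintro ⟨⟨u, hu, rfl⟩, hux⟩
          rcases lt_trichotomy u r with h | h | h
          · exact absurd hux ((hmono hu hr h).trans_eq hry).not_ge
          · exact Or.inl (h ▸ rfl)
          · exact Or.inr ⟨u, ⟨h, hu.2⟩, rfl⟩
        · rintro (h | ⟨u, hu, rfl⟩)
          · rw [Set.mem_singleton_iff.1 h]
            exact ⟨⟨r, hr, rfl⟩, hry.ge⟩
          · exact ⟨⟨u, hrsub hu, rfl⟩, hry.symm.trans_le (hmono hr (hrsub hu) hu.1).le⟩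
      have hr' : γ r ∉ γ '' Set.Ioo r b := by
        rintro ⟨u, hu, h⟩
        exact hu.1.ne' (hi (hrsub hu) hr h)
      have hdec : IsArcDecomp (C ∩ {p | y ≤ g p}) {γ r} {γ '' Set.Ioo r b} :=
        ⟨by simp [heq], by simpa using IsArc.image_Ioo hr.2 hc hi hrsub, by simp,
          by simpa using hr'⟩
      rw [IsArcDecomp.eulerChar_eq hM hdec]
      · simp
      · intro D hD
        rw [Finset.mem_singleton.1 hD]
        have : γ '' Set.Ioo r b = (C ∩ {p | y ≤ g p}) \ {γ r} := by
          rw [heq, Set.union_sdiff_left, Set.sdiff_singleton_eq_self hr']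
        rw [this]
        exact (hCdef.inter (hlev y)).diff (DefSub.singleton hM _)
    · push Not at hq
      have : C ∩ {p | y ≤ g p} = ∅ :=
        Set.eq_empty_of_forall_notMem fun q hq' => (hq q hq'.1).not_ge hq'.2
      rw [this, hempty]

/-- The Euler integral of `⌊m g⌋`, for a function adapted to a decomposition of its support: a point
contributes the value there, an arc contributes minus the rounded infimum of `m g` along it. -/
theorem eulerIntegral_floor [ChartedSpace ℝ M] (hM : M ∈ O.Def n) {K W : Set M} (hK : IsCompact K)
    (hWK : W ⊆ K) {P : Finset M} {𝒞 : Finset (Set M)} (hW : IsArcDecomp W P 𝒞)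
    (hdef : ∀ C ∈ 𝒞, O.DefSub C) {g : M → ℝ} (hg : Continuous g)
    (hlev : ∀ y, O.DefSub {p | y ≤ g p}) (hgW : ∀ p, g p ≠ 0 → p ∈ W)
    (hmono : ∀ C ∈ 𝒞, (∃ c, ∀ p ∈ C, g p = c) ∨ Set.InjOn g C) {m : ℕ} (hm : 0 < m) :
    O.eulerIntegral (fun p : M => ⌊(m : ℝ) * g p⌋) =
      ∑ p ∈ P, ⌊(m : ℝ) * g p⌋ - ∑ C ∈ 𝒞, ⌊(m : ℝ) * sInf (g '' C)⌋ := by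
  classical
  have hm' : (0 : ℝ) < m := Nat.cast_pos.2 hm
  have hb : ∀ C ∈ 𝒞, BddBelow (g '' C) := fun C hC =>
    (hK.image hg).bddBelow.mono (Set.image_mono ((hW.subset hC).trans hWK))
  set L : ℤ → Set M := fun s => {p | ⌊(m : ℝ) * g p⌋ = s}
  have hle : ∀ (x : ℝ) (s : ℤ), (s : ℝ) / m ≤ x ↔ s ≤ ⌊(m : ℝ) * x⌋ := fun x s => by
    rw [Int.le_floor, div_le_iff₀' hm']
  have hLeq : ∀ s, L s = {p | (s : ℝ) / m ≤ g p} \ {p | ((s + 1 : ℤ) : ℝ) / m ≤ g p} := by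
    intro s
    ext p
    simp only [L, Set.mem_ofPred_eq, Set.mem_sdiff, hle]
    omega
  have hLdef : ∀ s, O.DefSub (L s) := fun s => by
    rw [hLeq]
    exact (hlev _).diff (hlev _)
  have hdec : ∀ A : Set M, O.DefSub A → A ⊆ W → O.HasDefDecomp A := fun A hA hAW =>
    hasDefDecomp_of_subset_isCompact hM hK hA (hAW.trans hWK)
  have harc : ∀ s, ∀ C ∈ 𝒞, O.eulerChar (Subtype.val '' (C ∩ L s)) =
      -(if ⌊(m : ℝ) * sInf (g '' C)⌋ = s then 1 else 0) := by
    intro s C hC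
    have h1 : C ∩ {p | (s : ℝ) / m ≤ g p} = C ∩ {p | ((s + 1 : ℤ) : ℝ) / m ≤ g p} ∪ C ∩ L s := by
      ext p
      simp only [L, Set.mem_ofPred_eq, Set.mem_inter_iff, Set.mem_union, hle, ← and_or_left]
      refine and_congr_right fun _ => ?_
      omega
    have h2 := HasDefDecomp.eulerChar_union hM
      (hdec _ ((hdef C hC).inter (hlev (((s + 1 : ℤ) : ℝ) / m)))
        (Set.inter_subset_left.trans (hW.subset hC)))
      (hdec _ ((hdef C hC).inter (hLdef s)) (Set.inter_subset_left.trans (hW.subset hC)))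
      (Set.disjoint_left.2 fun p hp hp' => by
        have := hp'.2
        rw [hLeq] at this
        exact this.2 hp.2)
    rw [← h1, eulerChar_superlevel_of_isArc hM (hW.isArc C hC) (hdef C hC) hg hlev (hmono C hC)
      (hb C hC), eulerChar_superlevel_of_isArc hM (hW.isArc C hC) (hdef C hC) hg hlev (hmono C hC)
      (hb C hC)] at h2
    simp only [hle] at h2
    split_ifs at h2 ⊢ <;> omega
  -- only the level sets of nonzero values lie in `W`; the level `0` has weight zero in the integral
  have hL : ∀ s ≠ 0, O.eulerChar (Subtype.val '' L s) =
      ∑ p ∈ P, (if ⌊(m : ℝ) * g p⌋ = s then 1 else 0) -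
        ∑ C ∈ 𝒞, (if ⌊(m : ℝ) * sInf (g '' C)⌋ = s then 1 else 0) := by
    intro s hs
    have hLW : L s ⊆ W := fun p hp => hgW p fun h0 => hs (by
      have : ⌊(m : ℝ) * g p⌋ = s := hp
      rw [← this, h0, mul_zero, Int.floor_zero])
    have h1 : L s = ((P.filter fun p => ⌊(m : ℝ) * g p⌋ = s : Finset M) : Set M) ∪
        ⋃ C ∈ 𝒞, C ∩ L s := by
      ext p
      simp only [Finset.coe_filter, Set.mem_union, Set.mem_ofPred_eq, Set.mem_iUnion,
        Set.mem_inter_iff, exists_prop]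
      constructor
      · intro hp
        rcases hW.mem_iff.1 (hLW hp) with h | ⟨C, hC, hpC⟩
        · exact Or.inl ⟨h, hp⟩
        · exact Or.inr ⟨C, hC, hpC, hp⟩
      · rintro (⟨-, hp⟩ | ⟨C, -, -, hp⟩) <;> exact hp
    obtain ⟨h2, h3⟩ := eulerChar_biUnion hM 𝒞 (fun C => C ∩ L s)
      (fun C hC => hdec _ ((hdef C hC).inter (hLdef s))
        (Set.inter_subset_left.trans (hW.subset hC)))
      (fun C hC D hD hne => (hW.disjoint C hC D hD hne).mono Set.inter_subset_left
        Set.inter_subset_left)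
    rw [h1, HasDefDecomp.eulerChar_union hM (HasDefDecomp.of_finite (Finset.finite_toSet _)) h2,
      eulerChar_coe_finset hM, h3, Finset.sum_congr rfl (harc s), Finset.sum_neg_distrib,
      ← sub_eq_add_neg, Finset.card_filter]
    · push_cast
      rfl
    · rw [Set.disjoint_iUnion₂_right]
      intro C hC
      refine Set.disjoint_left.2 fun p hp hpC => ?_
      exact hW.notMem p (Finset.mem_filter.1 hp).1 C hC hpC.1
  have hterm : ∀ s, s * O.eulerChar (Subtype.val '' L s) =
      ∑ p ∈ P, (if ⌊(m : ℝ) * g p⌋ = s then s else 0) -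
        ∑ C ∈ 𝒞, (if ⌊(m : ℝ) * sInf (g '' C)⌋ = s then s else 0) := by
    intro s
    by_cases hs : s = 0
    · simp [hs]
    · rw [hL s hs, mul_sub, Finset.mul_sum, Finset.mul_sum]
      simp only [mul_ite, mul_one, mul_zero]
  set T : Finset ℤ := P.image (fun p => ⌊(m : ℝ) * g p⌋) ∪
    𝒞.image (fun C => ⌊(m : ℝ) * sInf (g '' C)⌋)
  have hsupp : Function.support (fun s => s * O.eulerChar (Subtype.val '' L s)) ⊆ T := by
    intro s hs
    by_contra hsT
    refine hs ((hterm s).trans ?_)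
    simp only [T, Finset.coe_union, Finset.coe_image, Set.mem_union, Set.mem_image, not_or,
      not_exists, not_and, Finset.mem_coe] at hsT
    rw [Finset.sum_eq_zero fun p hp => if_neg (hsT.1 p hp),
      Finset.sum_eq_zero fun C hC => if_neg (hsT.2 C hC), sub_zero]
  change ∑ᶠ s : ℤ, s * O.eulerChar (Subtype.val '' L s) = _
  rw [finsum_eq_sum_of_support_subset _ hsupp, Finset.sum_congr rfl fun s _ => hterm s,
    Finset.sum_sub_distrib, Finset.sum_comm, Finset.sum_comm (s := T) (t := 𝒞)]
  congr 1
  · refine Finset.sum_congr rfl fun p hp => ?_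
    rw [Finset.sum_ite_eq, if_pos (Finset.mem_union_left _ (Finset.mem_image_of_mem _ hp))]
  · refine Finset.sum_congr rfl fun C hC => ?_
    rw [Finset.sum_ite_eq, if_pos]
    exact Finset.mem_union_right _ (Finset.mem_image_of_mem (fun C => ⌊(m : ℝ) * sInf (g '' C)⌋) hC)

theorem tendsto_floor_natCast_mul_div (x : ℝ) :
    Tendsto (fun m : ℕ => (1 / (m : ℝ)) * (⌊(m : ℝ) * x⌋ : ℝ)) atTop (𝓝 x) := by
  have h0 : Tendsto (fun m : ℕ => x - 1 / (m : ℝ)) atTop (𝓝 x) := by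
    simpa using tendsto_const_nhds.sub (tendsto_one_div_atTop_nhds_zero_nat (𝕜 := ℝ))
  refine tendsto_of_tendsto_of_tendsto_of_le_of_le' h0 tendsto_const_nhds ?_ ?_
  · filter_upwards [eventually_gt_atTop 0] with m hm
    have hm' : (0 : ℝ) < m := Nat.cast_pos.2 hm
    have h1 := Int.sub_one_lt_floor ((m : ℝ) * x)
    have h2 : x - 1 / (m : ℝ) = (1 / (m : ℝ)) * (m * x - 1) := by field_simp
    rw [h2]
    exact mul_le_mul_of_nonneg_left h1.le (by positivity)
  · filter_upwards [eventually_gt_atTop 0] with m hm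
    have hm' : (0 : ℝ) < m := Nat.cast_pos.2 hm
    have h1 := Int.floor_le ((m : ℝ) * x)
    have h2 : x = (1 / (m : ℝ)) * (m * x) := by field_simp
    conv_rhs => rw [h2]
    exact mul_le_mul_of_nonneg_left h1 (by positivity)

/-- Definability is asked of the superlevel sets only, so that the formula applies to `-h` as well,
which need not be definable when `h` is. -/
theorem hasFloorIntegral_of_isArcDecomp [ChartedSpace ℝ M] (hM : M ∈ O.Def n) {K W : Set M}
    (hK : IsCompact K) (hWK : W ⊆ K) {P : Finset M} {𝒞 : Finset (Set M)} (hW : IsArcDecomp W P 𝒞)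
    (hdef : ∀ C ∈ 𝒞, O.DefSub C) {g : M → ℝ} (hg : Continuous g)
    (hlev : ∀ y, O.DefSub {p | y ≤ g p}) (hgW : ∀ p, g p ≠ 0 → p ∈ W)
    (hmono : ∀ C ∈ 𝒞, (∃ c, ∀ p ∈ C, g p = c) ∨ Set.InjOn g C) :
    O.HasFloorIntegral g (∑ p ∈ P, g p - ∑ C ∈ 𝒞, sInf (g '' C)) := by
  have h : Tendsto (fun m : ℕ => ∑ p ∈ P, (1 / (m : ℝ)) * (⌊(m : ℝ) * g p⌋ : ℝ) -
      ∑ C ∈ 𝒞, (1 / (m : ℝ)) * (⌊(m : ℝ) * sInf (g '' C)⌋ : ℝ)) atTop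
      (𝓝 (∑ p ∈ P, g p - ∑ C ∈ 𝒞, sInf (g '' C))) :=
    (tendsto_finsetSum _ fun p _ => tendsto_floor_natCast_mul_div _).sub
      (tendsto_finsetSum _ fun C _ => tendsto_floor_natCast_mul_div _)
  refine h.congr' ?_
  filter_upwards [eventually_gt_atTop 0] with m hm
  rw [eulerIntegral_floor hM hK hWK hW hdef hg hlev hgW hmono hm]
  push_cast
  rw [mul_sub, Finset.mul_sum, Finset.mul_sum]

/-- Rounding up `h` is rounding down `-h`. -/
theorem HasFloorIntegral.hasCeilIntegral_of_neg {X : Set (Fin n → ℝ)} {h : X → ℝ} {I : ℝ}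
    (hI : O.HasFloorIntegral (fun p => -h p) I) : O.HasCeilIntegral h (-I) := by
  refine (Tendsto.neg hI).congr fun m => ?_
  have : O.eulerIntegral (fun p : X => ⌈(m : ℝ) * h p⌉) =
      -O.eulerIntegral (fun p : X => ⌊(m : ℝ) * -h p⌋) := by
    unfold eulerIntegral
    rw [← finsum_comp_equiv (Equiv.neg ℤ), ← finsum_neg_distrib]
    refine finsum_congr fun s => ?_
    simp only [Equiv.neg_apply, mul_neg, Int.floor_neg, neg_mul, neg_inj]
    simp only [eq_neg_iff_add_eq_zero, neg_eq_iff_add_eq_zero]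
  rw [this]
  push_cast
  ring

end OMinimalStructure

/-! ### Endpoints of arcs -/

section OneManifold

variable {X : Type*} [TopologicalSpace X]

/-- A parametrization of an open arc that extends continuously to the closed interval. The two
endpoints may coincide. -/
structure ArcParam (C : Set X) where
  /-- the left end of the parameter interval -/
  a : ℝ
  /-- the right end of the parameter interval -/
  b : ℝ
  /-- the parametrization -/
  γ : ℝ → X
  lt : a < b
  continuousOn : ContinuousOn γ (Set.Icc a b)
  injOn : Set.InjOn γ (Set.Ioo a b)
  image_eq : γ '' Set.Ioo a b = C

namespace ArcParam

variable {C : Set X}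

/-- The same arc, traversed backwards. -/
def reverse (s : ArcParam C) : ArcParam C where
  a := -s.b
  b := -s.a
  γ := fun t => s.γ (-t)
  lt := neg_lt_neg s.lt
  continuousOn := s.continuousOn.comp continuous_neg.continuousOn
    fun t ht => ⟨by linarith [ht.2], by linarith [ht.1]⟩
  injOn := s.injOn.comp neg_injective.injOn
    fun t ht => ⟨by linarith [ht.2], by linarith [ht.1]⟩
  image_eq := by
    rw [← Set.image_image s.γ (fun t : ℝ => -t), Set.image_neg_Ioo, neg_neg, neg_neg, s.image_eq]

/-- The initial endpoint. -/
def start (s : ArcParam C) : X := s.γ s.a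

/-- The germ of the arc at its initial endpoint, as a filter. -/
def germ (s : ArcParam C) : Filter X := map s.γ (𝓝[>] s.a)

theorem start_reverse (s : ArcParam C) : s.reverse.start = s.γ s.b := by
  simp [start, reverse]

instance (s : ArcParam C) : s.germ.NeBot := by
  unfold germ
  infer_instance

theorem continuousOn_Ioo (s : ArcParam C) : ContinuousOn s.γ (Set.Ioo s.a s.b) :=
  s.continuousOn.mono Set.Ioo_subset_Icc_self

theorem germ_le (s : ArcParam C) : s.germ ≤ 𝓝 s.start := by
  have h := (s.continuousOn s.a (Set.left_mem_Icc.2 s.lt.le)).mono Set.Ioo_subset_Icc_self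
  have h' : Tendsto s.γ (𝓝[Set.Ioo s.a s.b] s.a) (𝓝 (s.γ s.a)) := h
  rwa [nhdsWithin_Ioo_eq_nhdsGT s.lt] at h'

theorem mem_germ (s : ArcParam C) : C ∈ s.germ := by
  refine mem_of_superset (image_mem_map (Ioo_mem_nhdsGT s.lt)) s.image_eq.le

theorem disjoint_germ_reverse (s : ArcParam C) : Disjoint s.germ s.reverse.germ := by
  have hlt := s.lt
  obtain ⟨m, hm1, hm2⟩ := exists_between hlt
  have h1 : s.γ '' Set.Ioo s.a m ∈ s.germ := image_mem_map (Ioo_mem_nhdsGT hm1)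
  have h2 : s.reverse.γ '' Set.Ioo (-s.b) (-m) ∈ s.reverse.germ :=
    image_mem_map (Ioo_mem_nhdsGT (neg_lt_neg hm2))
  refine Filter.disjoint_of_disjoint_of_mem (Set.disjoint_left.2 ?_) h1 h2
  rintro _ ⟨t, ht, rfl⟩ ⟨u, hu, hut⟩
  have := s.injOn (show -u ∈ Set.Ioo s.a s.b from ⟨by linarith [hu.2], by linarith [hu.1]⟩)
    ⟨ht.1, ht.2.trans hm2⟩ hut
  linarith [ht.2, hu.2]

theorem start_notMem_self [ChartedSpace ℝ X] (s : ArcParam C) : s.start ∉ C := by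
  intro h
  obtain ⟨t, ht, hts⟩ : s.start ∈ s.γ '' Set.Ioo s.a s.b := s.image_eq.symm ▸ h
  obtain ⟨m, hm1, hm2⟩ := exists_between ht.1
  have hsub : Set.Ioo m s.b ⊆ Set.Ioo s.a s.b := Set.Ioo_subset_Ioo_left hm1.le
  have h1 : s.γ '' Set.Ioo m s.b ∈ 𝓝 s.start := by
    rw [← hts]
    exact image_mem_nhds_of_injOn (isOpen_Ioo.mem_nhds ⟨hm2, ht.2⟩) (s.continuousOn_Ioo.mono hsub)
      (s.injOn.mono hsub)
  have h2 : s.γ '' Set.Ioo s.a m ∈ s.germ := image_mem_map (Ioo_mem_nhdsGT hm1)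
  obtain ⟨x, ⟨u, hu, rfl⟩, ⟨v, hv, hvu⟩⟩ :=
    Filter.nonempty_of_mem (Filter.inter_mem h2 (s.germ_le h1))
  have := s.injOn (hsub hv) ⟨hu.1, hu.2.trans (hm2.trans ht.2)⟩ hvu
  linarith [hv.1, hu.2]

/-- If the arc accumulates, along a filter converging to a point off the arc, then that point is one
of the two endpoints, and the filter meets the corresponding germ. -/
theorem exists_germ_of_mem [T2Space X] (s : ArcParam C) {S : Filter X} [S.NeBot] {p : X}
    (hS : S ≤ 𝓝 p) (hC : C ∈ S) (hp : p ∉ C) :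
    (s.start = p ∧ (S ⊓ s.germ).NeBot) ∨ (s.reverse.start = p ∧ (S ⊓ s.reverse.germ).NeBot) := by
  have hG : (comap s.γ S ⊓ 𝓟 (Set.Ioo s.a s.b)).NeBot :=
    comap_inf_principal_neBot_of_image_mem ‹_› (s.image_eq.symm ▸ hC)
  obtain ⟨t, ht, hcl⟩ := isCompact_Icc (a := s.a) (b := s.b)
    (f := comap s.γ S ⊓ 𝓟 (Set.Ioo s.a s.b))
    (inf_le_right.trans (principal_mono.2 Set.Ioo_subset_Icc_self))
  set H := 𝓝 t ⊓ (comap s.γ S ⊓ 𝓟 (Set.Ioo s.a s.b))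
  have hH : H.NeBot := hcl
  have hHS : map s.γ H ≤ S := by
    refine (map_mono (inf_le_right.trans inf_le_left)).trans map_comap_le
  have hHI : H ≤ 𝓝[Set.Ioo s.a s.b] t := inf_le_inf_left _ inf_le_right
  have hγt : s.γ t = p := by
    have h1 : Tendsto s.γ H (𝓝 (s.γ t)) :=
      (s.continuousOn t ht).mono_left (hHI.trans (nhdsWithin_mono _ Set.Ioo_subset_Icc_self))
    exact tendsto_nhds_unique h1 (hHS.trans hS)
  have htI : t ∉ Set.Ioo s.a s.b := fun h => hp (hγt ▸ s.image_eq.subset ⟨t, h, rfl⟩)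
  rcases ht.1.eq_or_lt with h | h
  · left
    subst h
    rw [nhdsWithin_Ioo_eq_nhdsGT s.lt] at hHI
    exact ⟨hγt, (hH.map s.γ).mono (le_inf hHS (map_mono hHI))⟩
  · right
    have h' : t = s.b := le_antisymm ht.2 (not_lt.1 fun h' => htI ⟨h, h'⟩)
    subst h'
    rw [nhdsWithin_Ioo_eq_nhdsLT s.lt] at hHI
    refine ⟨s.start_reverse.trans hγt, (hH.map s.γ).mono (le_inf hHS ?_)⟩
    have h2 : Tendsto (fun u : ℝ => -u) H (𝓝[>] (-s.b)) := by
      refine tendsto_nhdsWithin_iff.2 ⟨(continuous_neg.tendsto s.b).mono_left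
        (hHI.trans nhdsWithin_le_nhds), ?_⟩
      filter_upwards [hHI self_mem_nhdsWithin] with u hu
      exact neg_lt_neg (Set.mem_Iio.1 hu)
    have h3 : map s.γ H = map s.reverse.γ (map (fun u : ℝ => -u) H) := by
      rw [map_map]
      congr 1
      ext u
      simp [reverse]
    rw [h3]
    exact map_mono h2

end ArcParam

namespace IsArcDecomp

variable {W : Set X} {P : Finset X} {𝒞 : Finset (Set X)}

/-- An end of an arc of the decomposition: the arc together with a direction, encoded by whether
the parametrization is reversed. -/
def endParam (s : ∀ C : 𝒞, ArcParam C.1) (z : 𝒞 × Bool) : ArcParam z.1.1 :=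
  if z.2 then (s z.1).reverse else s z.1

theorem disjoint_germ_endParam (h : IsArcDecomp W P 𝒞) (s : ∀ C : 𝒞, ArcParam C.1)
    {z w : 𝒞 × Bool} (hzw : z ≠ w) : Disjoint (endParam s z).germ (endParam s w).germ := by
  obtain ⟨C, e⟩ := z
  obtain ⟨D, f⟩ := w
  by_cases hCD : C = D
  · subst hCD
    cases e <;> cases f
    · exact absurd rfl hzw
    · exact (s C).disjoint_germ_reverse
    · exact (s C).disjoint_germ_reverse.symm
    · exact absurd rfl hzw
  · exact Filter.disjoint_of_disjoint_of_mem
      (h.disjoint C.1 C.2 D.1 D.2 fun h => hCD (Subtype.ext h))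
      (endParam s (C, e)).mem_germ (endParam s (D, f)).mem_germ

end IsArcDecomp

/-! ### The two sides of a point -/

theorem map_nhdsGT_of_strictMonoOn {v : ℝ → ℝ} {a b : ℝ} (hab : a < b)
    (hc : ContinuousOn v (Set.Icc a b)) (hm : StrictMonoOn v (Set.Icc a b)) :
    map v (𝓝[>] a) = 𝓝[>] (v a) := by
  refine le_antisymm ?_ fun s hs => ?_
  · refine tendsto_nhdsWithin_iff.2 ⟨?_, ?_⟩
    · have h : Tendsto v (𝓝[Set.Ioo a b] a) (𝓝 (v a)) :=
        (hc a (Set.left_mem_Icc.2 hab.le)).mono Set.Ioo_subset_Icc_self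
      rwa [nhdsWithin_Ioo_eq_nhdsGT hab] at h
    · filter_upwards [Ioo_mem_nhdsGT hab] with t ht
      exact hm (Set.left_mem_Icc.2 hab.le) (Set.Ioo_subset_Icc_self ht) ht.1
  · obtain ⟨w, hw, hws⟩ := (mem_nhdsGT_iff_exists_Ioo_subset' hab).1 hs
    have hlt : a < min w b := lt_min hw hab
    have hsub : Set.Icc a (min w b) ⊆ Set.Icc a b := Set.Icc_subset_Icc_right (min_le_right _ _)
    refine mem_of_superset (Ioo_mem_nhdsGT (hm (Set.left_mem_Icc.2 hab.le)
      (hsub (Set.right_mem_Icc.2 hlt.le)) hlt)) ?_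
    rw [← (hc.mono hsub).image_Ioo_of_strictMonoOn hlt.le (hm.mono hsub)]
    rintro _ ⟨t, ht, rfl⟩
    exact hws ⟨ht.1, ht.2.trans_le (min_le_left _ _)⟩

theorem map_nhdsGT_of_strictAntiOn {v : ℝ → ℝ} {a b : ℝ} (hab : a < b)
    (hc : ContinuousOn v (Set.Icc a b)) (hm : StrictAntiOn v (Set.Icc a b)) :
    map v (𝓝[>] a) = 𝓝[<] (v a) := by
  refine le_antisymm ?_ fun s hs => ?_
  · refine tendsto_nhdsWithin_iff.2 ⟨?_, ?_⟩
    · have h : Tendsto v (𝓝[Set.Ioo a b] a) (𝓝 (v a)) :=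
        (hc a (Set.left_mem_Icc.2 hab.le)).mono Set.Ioo_subset_Icc_self
      rwa [nhdsWithin_Ioo_eq_nhdsGT hab] at h
    · filter_upwards [Ioo_mem_nhdsGT hab] with t ht
      exact hm (Set.left_mem_Icc.2 hab.le) (Set.Ioo_subset_Icc_self ht) ht.1
  · obtain ⟨w, hw, hws⟩ := (mem_nhdsGT_iff_exists_Ioo_subset' hab).1 hs
    have hlt : a < min w b := lt_min hw hab
    have hsub : Set.Icc a (min w b) ⊆ Set.Icc a b := Set.Icc_subset_Icc_right (min_le_right _ _)
    refine mem_of_superset (Ioo_mem_nhdsLT (hm (Set.left_mem_Icc.2 hab.le)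
      (hsub (Set.right_mem_Icc.2 hlt.le)) hlt)) ?_
    rw [← (hc.mono hsub).image_Ioo_of_strictAntiOn hlt.le (hm.mono hsub)]
    rintro _ ⟨t, ht, rfl⟩
    exact hws ⟨ht.1, ht.2.trans_le (min_le_left _ _)⟩

variable [ChartedSpace ℝ X]

/-- The two sides of a point of a one-dimensional manifold, as germs of sets in the preferred
chart. -/
noncomputable def sideGerm (p : X) : Bool → Filter X
  | true => map (chartAt ℝ p).symm (𝓝[>] (chartAt ℝ p p))
  | false => map (chartAt ℝ p).symm (𝓝[<] (chartAt ℝ p p))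

instance (p : X) (σ : Bool) : (sideGerm p σ).NeBot := by
  cases σ <;> unfold sideGerm <;> infer_instance

theorem sideGerm_le (p : X) (σ : Bool) : sideGerm p σ ≤ 𝓝 p := by
  have h := (chartAt ℝ p).continuousAt_symm ((chartAt ℝ p).map_source (mem_chart_source ℝ p))
  have h' : Tendsto (chartAt ℝ p).symm (𝓝 (chartAt ℝ p p)) (𝓝 p) := by
    have := h.tendsto
    rwa [(chartAt ℝ p).left_inv (mem_chart_source ℝ p)] at this
  cases σ
  · exact h'.mono_left nhdsWithin_le_nhds
  · exact h'.mono_left nhdsWithin_le_nhds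

theorem disjoint_sideGerm (p : X) : Disjoint (sideGerm p true) (sideGerm p false) := by
  obtain ⟨ε, hε, h1, -⟩ := exists_isArc_side p univ_mem
  set φ := chartAt ℝ p
  have hr : φ.symm '' Set.Ioo (φ p) (φ p + ε) ∈ sideGerm p true :=
    image_mem_map (Ioo_mem_nhdsGT (by linarith))
  have hl : φ.symm '' Set.Ioo (φ p - ε) (φ p) ∈ sideGerm p false :=
    image_mem_map (Ioo_mem_nhdsLT (by linarith))
  refine Filter.disjoint_of_disjoint_of_mem (Set.disjoint_left.2 ?_) hr hl
  rintro _ ⟨t, ht, rfl⟩ ⟨u, hu, hut⟩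
  have := φ.symm.injOn (h1 ⟨hu.1, by linarith [hu.2]⟩) (h1 ⟨by linarith [ht.1], ht.2⟩) hut
  linarith [ht.1, hu.2]

/-- The germ of an arc at an endpoint is one of the two sides of the endpoint. -/
theorem ArcParam.exists_germ_eq_sideGerm {C : Set X} (s : ArcParam C) :
    ∃ σ, s.germ = sideGerm s.start σ := by
  set φ := chartAt ℝ s.start
  have hlt := s.lt
  have hsrc : ∀ᶠ t in 𝓝[≥] s.a, s.γ t ∈ φ.source := by
    have h : Tendsto s.γ (𝓝[Set.Icc s.a s.b] s.a) (𝓝 s.start) :=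
      s.continuousOn s.a (Set.left_mem_Icc.2 s.lt.le)
    rw [nhdsWithin_Icc_eq_nhdsGE s.lt] at h
    exact h (φ.open_source.mem_nhds (mem_chart_source ℝ _))
  obtain ⟨u, hu, hus⟩ := (mem_nhdsGE_iff_exists_Ico_subset' hlt).1 hsrc
  obtain ⟨w, hw1, hw2⟩ := exists_between (lt_min hu hlt)
  have hwb : w < s.b := hw2.trans_le (min_le_right _ _)
  have hsub : ∀ t ∈ Set.Icc s.a w, s.γ t ∈ φ.source := fun t ht =>
    hus ⟨ht.1, ht.2.trans_lt (hw2.trans_le (min_le_left _ _))⟩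
  have hc : ContinuousOn (φ ∘ s.γ) (Set.Icc s.a w) :=
    φ.continuousOn.comp (s.continuousOn.mono (Set.Icc_subset_Icc_right hwb.le)) hsub
  have hγi : Set.InjOn s.γ (Set.Icc s.a w) := by
    have key : ∀ t ∈ Set.Icc s.a w, s.γ s.a = s.γ t → s.a = t := by
      intro t ht hst
      by_contra hne
      refine s.start_notMem_self (s.image_eq.subset ?_)
      exact ⟨t, ⟨ht.1.lt_of_ne hne, ht.2.trans_lt hwb⟩, hst.symm⟩
    intro t ht t' ht' htt'
    rcases ht.1.eq_or_lt with h | h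
    · subst h
      exact key t' ht' htt'
    rcases ht'.1.eq_or_lt with h' | h'
    · subst h'
      exact (key t ht htt'.symm).symm
    exact s.injOn ⟨h, ht.2.trans_lt hwb⟩ ⟨h', ht'.2.trans_lt hwb⟩ htt'
  have hi : Set.InjOn (φ ∘ s.γ) (Set.Icc s.a w) := φ.injOn.comp hγi hsub
  have hgerm : s.germ = map φ.symm (map (φ ∘ s.γ) (𝓝[>] s.a)) := by
    rw [map_map]
    refine map_congr ?_
    filter_upwards [Ioo_mem_nhdsGT hw1] with t ht
    exact (φ.left_inv (hsub t (Set.Ioo_subset_Icc_self ht))).symm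
  rcases hc.strictMonoOn_of_injOn_Icc' hw1.le hi with h | h
  · exact ⟨true, by rw [hgerm, map_nhdsGT_of_strictMonoOn hw1 hc h]; rfl⟩
  · exact ⟨false, by rw [hgerm, map_nhdsGT_of_strictAntiOn hw1 hc h]; rfl⟩

namespace IsArcDecomp

variable {W : Set X} {P : Finset X} {𝒞 : Finset (Set X)}

/-- Each side of an interior vertex of a decomposition is occupied by an arc. -/
theorem exists_mem_sideGerm [T1Space X] (h : IsArcDecomp W P 𝒞) {p : X} (hW : W ∈ 𝓝 p)
    (σ : Bool) : ∃ C ∈ 𝒞, C ∈ sideGerm p σ := by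
  have hU : W ∩ ((P : Set X) \ {p})ᶜ ∈ 𝓝 p := Filter.inter_mem hW
    ((P.finite_toSet.sdiff.isClosed.isOpen_compl).mem_nhds (by simp))
  obtain ⟨ε, hε, h1, h2⟩ := exists_isArc_side p hU
  set φ := chartAt ℝ p
  have key : ∀ c d, c < d → Set.Ioo c d ⊆ Set.Ioo (φ p - ε) (φ p + ε) → φ p ∉ Set.Ioo c d →
      ∃ C ∈ 𝒞, φ.symm '' Set.Ioo c d ⊆ C := by
    intro c d hcd hsub hnot
    have harc : IsArc (φ.symm '' Set.Ioo c d) :=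
      IsArc.image_Ioo hcd (φ.continuousOn_symm.mono h1) (φ.symm.injOn.mono h1) hsub
    have hSW : φ.symm '' Set.Ioo c d ⊆ W := fun x hx => (h2 (Set.image_mono hsub hx)).1
    have hSP : Disjoint (φ.symm '' Set.Ioo c d) P := by
      rw [Set.disjoint_left]
      rintro _ ⟨t, ht, rfl⟩ htP
      refine (h2 ⟨t, hsub ht, rfl⟩).2 ⟨htP, fun htp => hnot ?_⟩
      rw [← show φ.symm t = p from htp, φ.right_inv (h1 (hsub ht))]
      exact ht
    obtain ⟨x, hx⟩ := harc.nonempty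
    rcases h.mem_iff.1 (hSW hx) with hxP | ⟨C, hC, hxC⟩
    · exact absurd hxP (Set.disjoint_left.1 hSP hx)
    · exact ⟨C, hC, h.subset_of_isPreconnected harc.isPreconnected hSW hSP hC ⟨x, hx, hxC⟩⟩
  cases σ
  · obtain ⟨C, hC, hsub⟩ := key (φ p - ε) (φ p) (by linarith)
      (Set.Ioo_subset_Ioo_right (by linarith)) (fun h => h.2.false)
    exact ⟨C, hC, mem_of_superset (image_mem_map (Ioo_mem_nhdsLT (by linarith))) hsub⟩
  · obtain ⟨C, hC, hsub⟩ := key (φ p) (φ p + ε) (by linarith)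
      (Set.Ioo_subset_Ioo_left (by linarith)) (fun h => h.1.false)
    exact ⟨C, hC, mem_of_superset (image_mem_map (Ioo_mem_nhdsGT (by linarith))) hsub⟩

open Classical in
/-- Exactly two ends of arcs arrive at an interior vertex of the decomposition, one from each
side. -/
theorem card_ends_eq_two [T2Space X] (h : IsArcDecomp W P 𝒞) (s : ∀ C : 𝒞, ArcParam C.1) {p : X}
    (hp : p ∈ P) (hW : W ∈ 𝓝 p) :
    (Finset.univ.filter fun z : 𝒞 × Bool => (endParam s z).start = p).card = 2 := by
  have hside : ∀ σ, ∃ z : 𝒞 × Bool,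
      (endParam s z).start = p ∧ (endParam s z).germ = sideGerm p σ := by
    intro σ
    obtain ⟨C, hC, hCσ⟩ := h.exists_mem_sideGerm hW σ
    obtain ⟨z, hz, hne⟩ : ∃ z : 𝒞 × Bool, (endParam s z).start = p ∧
        (sideGerm p σ ⊓ (endParam s z).germ).NeBot := by
      rcases (s ⟨C, hC⟩).exists_germ_of_mem (sideGerm_le p σ) hCσ (h.notMem p hp C hC) with h1 | h1
      · exact ⟨(⟨C, hC⟩, false), h1⟩
      · exact ⟨(⟨C, hC⟩, true), h1⟩
    refine ⟨z, hz, ?_⟩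
    obtain ⟨τ, hτ⟩ := (endParam s z).exists_germ_eq_sideGerm
    rw [hz] at hτ
    rw [hτ] at hne ⊢
    have hd := disjoint_sideGerm p
    cases σ <;> cases τ
    · rfl
    · exact absurd hd.symm.eq_bot hne.ne
    · exact absurd hd.eq_bot hne.ne
    · rfl
  obtain ⟨z₁, hz₁, hg₁⟩ := hside true
  obtain ⟨z₂, hz₂, hg₂⟩ := hside false
  have hne : z₁ ≠ z₂ := by
    rintro rfl
    have hd := disjoint_sideGerm p
    rw [← hg₁, ← hg₂, disjoint_self] at hd
    exact (inferInstance : (endParam s z₁).germ.NeBot).ne hd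
  have heq : (Finset.univ.filter fun z : 𝒞 × Bool => (endParam s z).start = p) = {z₁, z₂} := by
    ext z
    simp only [Finset.mem_filter, Finset.mem_univ, true_and, Finset.mem_insert,
      Finset.mem_singleton]
    constructor
    · intro hz
      obtain ⟨τ, hτ⟩ := (endParam s z).exists_germ_eq_sideGerm
      rw [hz] at hτ
      have key : ∀ w : 𝒞 × Bool, (endParam s w).germ = (endParam s z).germ → z = w := by
        intro w hw
        by_contra hzw
        have hd := h.disjoint_germ_endParam s hzw
        rw [hw, disjoint_self] at hd
        exact (inferInstance : (endParam s z).germ.NeBot).ne hd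
      cases τ
      · exact Or.inr (key _ (hg₂.trans hτ.symm))
      · exact Or.inl (key _ (hg₁.trans hτ.symm))
    · rintro (rfl | rfl) <;> assumption
  rw [heq, Finset.card_pair hne]

/-- Arcs are open, so an arc contains no endpoint of an arc of the same decomposition. -/
theorem start_notMem (h : IsArcDecomp W P 𝒞) {C D : Set X} (hC : C ∈ 𝒞) (hD : D ∈ 𝒞)
    (s : ArcParam C) : s.start ∉ D := by
  intro hsD
  obtain ⟨x, hxD, hxC⟩ := Filter.nonempty_of_mem
    (Filter.inter_mem (s.germ_le ((h.isArc D hD).isOpen.mem_nhds hsD)) s.mem_germ)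
  exact s.start_notMem_self (h.eq_of_mem hC hD hxC hxD ▸ hsD)

/-- Handshake lemma: summing a function supported in the interior of `W` over the ends of the arcs
counts every vertex twice. -/
theorem sum_ends [T2Space X] (h : IsArcDecomp W P 𝒞) (s : ∀ C : 𝒞, ArcParam C.1) {f : X → ℝ}
    (hf : ∀ p, f p ≠ 0 → W ∈ 𝓝 p) :
    ∑ C : 𝒞, (f (s C).start + f (s C).reverse.start) = 2 * ∑ p ∈ P, f p := by
  classical
  have h1 : ∑ C : 𝒞, (f (s C).start + f (s C).reverse.start) =
      ∑ z : 𝒞 × Bool, f (endParam s z).start := by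
    rw [Fintype.sum_prod_type]
    refine Finset.sum_congr rfl fun C _ => ?_
    rw [Fintype.sum_bool, add_comm]
    rfl
  have h2 : ∀ z : 𝒞 × Bool, f (endParam s z).start =
      ∑ p ∈ P, if (endParam s z).start = p then f p else 0 := by
    intro z
    rw [Finset.sum_ite_eq]
    split_ifs with hz
    · rfl
    · by_contra hne
      rcases h.mem_iff.1 (mem_of_mem_nhds (hf _ hne)) with hP | ⟨D, hD, hzD⟩
      · exact hz hP
      · exact h.start_notMem z.1.2 hD (endParam s z) hzD
  rw [h1, Finset.sum_congr rfl fun z _ => h2 z, Finset.sum_comm, Finset.mul_sum]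
  refine Finset.sum_congr rfl fun p hp => ?_
  by_cases hfp : f p = 0
  · simp [hfp]
  · rw [← Finset.sum_filter, Finset.sum_const, h.card_ends_eq_two s hp (hf p hfp), nsmul_eq_mul]
    norm_num

end IsArcDecomp

end OneManifold

/-! ### Limits at the ends of an arc -/

theorem tendsto_ends_of_const_or_injOn {u : ℝ → ℝ} {a b : ℝ} (hab : a < b)
    (hc : ContinuousOn u (Set.Ioo a b))
    (hm : (∃ c, ∀ t ∈ Set.Ioo a b, u t = c) ∨ Set.InjOn u (Set.Ioo a b))
    (hb : BddBelow (u '' Set.Ioo a b)) (hB : BddAbove (u '' Set.Ioo a b)) :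
    (Tendsto u (𝓝[>] a) (𝓝 (sInf (u '' Set.Ioo a b))) ∧
      Tendsto u (𝓝[<] b) (𝓝 (sSup (u '' Set.Ioo a b)))) ∨
    (Tendsto u (𝓝[>] a) (𝓝 (sSup (u '' Set.Ioo a b))) ∧
      Tendsto u (𝓝[<] b) (𝓝 (sInf (u '' Set.Ioo a b)))) := by
  have hne : (Set.Ioo a b).Nonempty := Set.nonempty_Ioo.2 hab
  have key : MonotoneOn u (Set.Ioo a b) ∨ AntitoneOn u (Set.Ioo a b) := by
    rcases hm with ⟨c, hc⟩ | hi
    · exact Or.inl fun s hs t ht _ => ((hc s hs).trans (hc t ht).symm).le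
    · exact (hc.strictMonoOn_of_injOn_Ioo hab hi).imp StrictMonoOn.monotoneOn
        StrictAntiOn.antitoneOn
  rcases key with h | h
  · exact Or.inl ⟨h.tendsto_nhdsWithin_Ioo_right hne hb, h.tendsto_nhdsWithin_Ioo_left hne hB⟩
  · exact Or.inr ⟨h.tendsto_nhdsWithin_Ioo_right hne hB, h.tendsto_nhdsWithin_Ioo_left hne hb⟩

/-- A function constant or injective along an arc takes its infimum at one end and its supremum at the
other. -/
theorem ArcParam.values_of_const_or_injOn {X : Type*} [TopologicalSpace X] {C : Set X}
    (s : ArcParam C) {g : X → ℝ} (hg : Continuous g)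
    (hm : (∃ c, ∀ p ∈ C, g p = c) ∨ Set.InjOn g C) (hb : BddBelow (g '' C))
    (hB : BddAbove (g '' C)) :
    (g s.start = sInf (g '' C) ∧ g s.reverse.start = sSup (g '' C)) ∨
      (g s.start = sSup (g '' C) ∧ g s.reverse.start = sInf (g '' C)) := by
  have himg : (g ∘ s.γ) '' Set.Ioo s.a s.b = g '' C := by rw [Set.image_comp, s.image_eq]
  have hmem : ∀ t ∈ Set.Ioo s.a s.b, s.γ t ∈ C := fun t ht => s.image_eq.subset ⟨t, ht, rfl⟩
  have hm' : (∃ c, ∀ t ∈ Set.Ioo s.a s.b, (g ∘ s.γ) t = c) ∨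
      Set.InjOn (g ∘ s.γ) (Set.Ioo s.a s.b) :=
    hm.imp (fun ⟨c, hc⟩ => ⟨c, fun t ht => hc _ (hmem t ht)⟩) fun h => h.comp s.injOn hmem
  have hc := hg.comp_continuousOn s.continuousOn
  have ha : Tendsto (g ∘ s.γ) (𝓝[>] s.a) (𝓝 (g s.start)) := by
    have : Tendsto (g ∘ s.γ) (𝓝[Set.Ioo s.a s.b] s.a) (𝓝 (g s.start)) :=
      (hc s.a (Set.left_mem_Icc.2 s.lt.le)).mono Set.Ioo_subset_Icc_self
    rwa [nhdsWithin_Ioo_eq_nhdsGT s.lt] at this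
  have hb' : Tendsto (g ∘ s.γ) (𝓝[<] s.b) (𝓝 (g s.reverse.start)) := by
    have : Tendsto (g ∘ s.γ) (𝓝[Set.Ioo s.a s.b] s.b) (𝓝 (g (s.γ s.b))) :=
      (hc s.b (Set.right_mem_Icc.2 s.lt.le)).mono Set.Ioo_subset_Icc_self
    rwa [nhdsWithin_Ioo_eq_nhdsLT s.lt, ← s.start_reverse] at this
  have := tendsto_ends_of_const_or_injOn s.lt (hc.mono Set.Ioo_subset_Icc_self) hm'
    (himg.symm ▸ hb) (himg.symm ▸ hB)
  rw [himg] at this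
  exact this.imp (fun h => ⟨tendsto_nhds_unique ha h.1, tendsto_nhds_unique hb' h.2⟩)
    fun h => ⟨tendsto_nhds_unique ha h.1, tendsto_nhds_unique hb' h.2⟩

/-- A relatively compact arc in `M ⊆ ℝⁿ` along which all coordinates are monotone has endpoints
in `M`. -/
theorem nonempty_arcParam {n : ℕ} {M : Set (Fin n → ℝ)} {C K : Set M} (hC : IsArc C)
    (hK : IsCompact K) (hCK : C ⊆ K)
    (hm : ∀ i, (∃ c, ∀ p ∈ C, (p : Fin n → ℝ) i = c) ∨
      Set.InjOn (fun p : M => (p : Fin n → ℝ) i) C) : Nonempty (ArcParam C) := by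
  obtain ⟨a, b, γ, hab, hc, hi, hγ⟩ := hC
  have hmem : ∀ t ∈ Set.Ioo a b, γ t ∈ C := fun t ht => hγ.subset ⟨t, ht, rfl⟩
  have hlim : ∀ i, (∃ l, Tendsto (fun t => (γ t : Fin n → ℝ) i) (𝓝[>] a) (𝓝 l)) ∧
      ∃ l, Tendsto (fun t => (γ t : Fin n → ℝ) i) (𝓝[<] b) (𝓝 l) := by
    intro i
    have hxc := OMinimalStructure.continuous_coord (M := M) i
    have hsub : (fun t => (γ t : Fin n → ℝ) i) '' Set.Ioo a b ⊆
        (fun p : M => (p : Fin n → ℝ) i) '' K := by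
      rintro _ ⟨t, ht, rfl⟩
      exact ⟨γ t, hCK (hmem t ht), rfl⟩
    have h := tendsto_ends_of_const_or_injOn hab (hxc.comp_continuousOn hc)
      ((hm i).imp (fun ⟨c, hc⟩ => ⟨c, fun t ht => hc _ (hmem t ht)⟩) fun h => h.comp hi hmem)
      ((hK.image hxc).bddBelow.mono hsub) ((hK.image hxc).bddAbove.mono hsub)
    rcases h with h | h
    · exact ⟨⟨_, h.1⟩, ⟨_, h.2⟩⟩
    · exact ⟨⟨_, h.1⟩, ⟨_, h.2⟩⟩
  have hK' : IsClosed (Subtype.val '' K : Set (Fin n → ℝ)) :=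
    (hK.image continuous_subtype_val).isClosed
  have key : ∀ l : Filter ℝ, l.NeBot → Set.Ioo a b ∈ l →
      (∀ i, ∃ c, Tendsto (fun t => (γ t : Fin n → ℝ) i) l (𝓝 c)) → ∃ p, Tendsto γ l (𝓝 p) := by
    intro l _ hl h
    choose c hc using h
    have hc' : Tendsto (fun t => (γ t : Fin n → ℝ)) l (𝓝 c) := tendsto_pi_nhds.2 hc
    obtain ⟨p, -, hp⟩ := hK'.mem_of_tendsto hc' (by
      filter_upwards [hl] with t ht
      exact ⟨γ t, hCK (hmem t ht), rfl⟩)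
    exact ⟨p, tendsto_subtype_rng.2 (hp ▸ hc')⟩
  obtain ⟨p, hp⟩ := key _ inferInstance (Ioo_mem_nhdsGT hab) fun i => (hlim i).1
  obtain ⟨q, hq⟩ := key _ inferInstance (Ioo_mem_nhdsLT hab) fun i => (hlim i).2
  have hext : Set.EqOn (extendFrom (Set.Ioo a b) γ) γ (Set.Ioo a b) := fun t ht =>
    extendFrom_eq (subset_closure ht) (hc t ht)
  exact ⟨⟨a, b, extendFrom (Set.Ioo a b) γ, hab, continuousOn_Icc_extendFrom_Ioo hc hp hq,
    hi.congr hext.symm, by rw [hext.image_eq, hγ]⟩⟩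

/-! ### Total variation -/

open Classical in
theorem sum_indicator_one_apply {κ α : Type*} (S : Finset κ) (E : κ → Set α) (y : α) :
    ∑ i ∈ S, (E i).indicator (1 : α → ℝ≥0∞) y = ((S.filter fun i => y ∈ E i).card : ℝ≥0∞) := by
  rw [Finset.card_filter]
  push_cast
  exact Finset.sum_congr rfl fun i _ => Set.indicator_apply _ _ _

section TotalVariation

variable {X : Type*} [TopologicalSpace X] {W : Set X} {P : Finset X} {𝒞 : Finset (Set X)}
  {h : X → ℝ}

/-- The variation along any family of non-overlapping arcs is at most the sum of the oscillations of
`h` on the arcs of an adapted decomposition. For almost every value `y`, the arcs of the family on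
whose interior `y` is attained choose distinct preimages of `y`, and these lie on distinct arcs of
the decomposition; integrating over `y` gives the inequality. -/
theorem IsArcDecomp.manifoldTotalVariation_le (hW : IsArcDecomp W P 𝒞) (hh : Continuous h)
    (hhW : ∀ p, h p ≠ 0 → p ∈ W)
    (hm : ∀ C ∈ 𝒞, (∃ c, ∀ p ∈ C, h p = c) ∨ Set.InjOn h C)
    (hb : ∀ C ∈ 𝒞, BddBelow (h '' C)) (hB : ∀ C ∈ 𝒞, BddAbove (h '' C)) :
    manifoldTotalVariation h ≤ ∑ C ∈ 𝒞, ENNReal.ofReal (sSup (h '' C) - sInf (h '' C)) := by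
  classical
  refine iSup_le fun k => iSup_le fun γ => iSup_le fun _ => iSup_le fun hdisj => ?_
  rcases isEmpty_or_nonempty (Fin k) with _ | ⟨⟨i₀⟩⟩
  · simp
  have : Nonempty X := ⟨γ i₀ 0⟩
  set F : Fin k → Set ℝ := fun i =>
    Set.Ioo (min (h (γ i 0)) (h (γ i 1))) (max (h (γ i 0)) (h (γ i 1)))
  set G : Set X → Set ℝ := fun C => Set.Icc (sInf (h '' C)) (sSup (h '' C))
  have hF : ∀ i, ENNReal.ofReal |h (γ i 1) - h (γ i 0)| = MeasureTheory.volume (F i) := by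
    intro i
    rw [Real.volume_Ioo, max_sub_min_eq_abs]
  have hG : ∀ C, ENNReal.ofReal (sSup (h '' C) - sInf (h '' C)) = MeasureTheory.volume (G C) :=
    fun C => Real.volume_Icc.symm
  have hFex : ∀ i, ∀ y ∈ F i, ∃ p ∈ γ i '' Set.Ioo 0 1, h p = y := by
    intro i y hy
    have hconn := (isPreconnected_univ (α := unitInterval)).image (h ∘ γ i)
      (hh.comp (γ i).continuous).continuousOn
    have h0 : h (γ i 0) ∈ (h ∘ γ i) '' Set.univ := ⟨0, trivial, rfl⟩
    have h1 : h (γ i 1) ∈ (h ∘ γ i) '' Set.univ := ⟨1, trivial, rfl⟩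
    obtain ⟨t, -, hty⟩ := hconn.ordConnected.uIcc_subset h0 h1 (Set.Ioo_subset_Icc_self hy)
    have hty' : h (γ i t) = y := hty
    refine ⟨γ i t, ⟨t, ⟨?_, ?_⟩, rfl⟩, hty'⟩
    · refine lt_of_le_of_ne t.2.1 ?_
      rintro rfl
      rw [← hty'] at hy
      rcases le_total (h (γ i 0)) (h (γ i 1)) with hle | hle
      · exact hy.1.ne (min_eq_left hle)
      · exact hy.2.ne (max_eq_left hle).symm
    · refine lt_of_le_of_ne t.2.2 ?_
      rintro rfl
      rw [← hty'] at hy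
      rcases le_total (h (γ i 0)) (h (γ i 1)) with hle | hle
      · exact hy.2.ne (max_eq_right hle).symm
      · exact hy.1.ne (min_eq_right hle)
  -- exceptional values: those at the vertices, the value outside `W`, and the infima over the arcs,
  -- among which are the values of `h` on the arcs where it is constant
  set N : Set ℝ := h '' P ∪ {0} ∪ (fun C => sInf (h '' C)) '' 𝒞
  have hN : N.Finite := ((P.finite_toSet.image _).union (Set.finite_singleton 0)).union
    (𝒞.finite_toSet.image _)
  have hpoint : ∀ y ∉ N, (∑ i, (F i).indicator (1 : ℝ → ℝ≥0∞) y) ≤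
      ∑ C ∈ 𝒞, (G C).indicator (1 : ℝ → ℝ≥0∞) y := by
    intro y hy
    simp only [N, Set.mem_union, Set.mem_singleton_iff, Set.mem_image, not_or, not_exists,
      not_and, Finset.mem_coe] at hy
    have hsel : ∀ i ∈ Finset.univ.filter (fun i => y ∈ F i), ∃ p C,
        p ∈ γ i '' Set.Ioo 0 1 ∧ h p = y ∧ C ∈ 𝒞 ∧ p ∈ C := by
      intro i hi
      obtain ⟨p, hp, hpy⟩ := hFex i y (Finset.mem_filter.1 hi).2
      rcases hW.mem_iff.1 (hhW p (fun h0 => hy.1.2 (hpy.symm.trans h0))) with hpP | ⟨C, hC, hpC⟩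
      · exact absurd hpy (hy.1.1 p hpP)
      · exact ⟨p, C, hp, hpy, hC, hpC⟩
    choose! p C hpγ hpy hC hpC using hsel
    have hcard : (Finset.univ.filter fun i => y ∈ F i).card ≤ (𝒞.filter fun C => y ∈ G C).card := by
      refine Finset.card_le_card_of_injOn C (fun i hi => ?_) fun i hi j hj hij => ?_
      · refine Finset.mem_coe.2 (Finset.mem_filter.2 ⟨hC i hi, ?_⟩)
        have hyC : y ∈ h '' C i := ⟨p i, hpC i hi, hpy i hi⟩
        exact ⟨csInf_le (hb _ (hC i hi)) hyC, le_csSup (hB _ (hC i hi)) hyC⟩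
      · have hpj : p j ∈ C i := hij ▸ hpC j hj
        rcases hm _ (hC i hi) with ⟨c, hc⟩ | hinj
        · exfalso
          refine hy.2 (C i) (hC i hi) ?_
          have : h '' C i = {y} := by
            refine Set.eq_singleton_iff_unique_mem.2 ⟨⟨p i, hpC i hi, hpy i hi⟩, ?_⟩
            rintro _ ⟨q, hq, rfl⟩
            rw [hc q hq, ← hpy i hi, hc _ (hpC i hi)]
          rw [this, csInf_singleton]
        · by_contra hne
          have hpp : p i = p j := hinj (hpC i hi) hpj ((hpy i hi).trans (hpy j hj).symm)
          exact Set.disjoint_left.1 (hdisj hne) (hpγ i hi) (hpp ▸ hpγ j hj)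
    rw [sum_indicator_one_apply, sum_indicator_one_apply]
    refine le_of_eq_of_le ?_ (le_of_le_of_eq (Nat.cast_le.2 hcard) ?_) <;> congr
  calc ∑ i, ENNReal.ofReal |h (γ i 1) - h (γ i 0)|
      = ∑ i, ∫⁻ y, (F i).indicator (1 : ℝ → ℝ≥0∞) y :=
        Finset.sum_congr rfl fun i _ => by
          rw [hF, MeasureTheory.lintegral_indicator_one measurableSet_Ioo]
    _ = ∫⁻ y, ∑ i, (F i).indicator (1 : ℝ → ℝ≥0∞) y :=
        (MeasureTheory.lintegral_finsetSum _ fun i _ =>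
          measurable_one.indicator measurableSet_Ioo).symm
    _ ≤ ∫⁻ y, ∑ C ∈ 𝒞, (G C).indicator (1 : ℝ → ℝ≥0∞) y := by
        refine MeasureTheory.lintegral_mono_ae ?_
        filter_upwards [MeasureTheory.compl_mem_ae_iff.2 (hN.measure_zero _)] with y hy
        exact hpoint y hy
    _ = ∑ C ∈ 𝒞, ∫⁻ y, (G C).indicator (1 : ℝ → ℝ≥0∞) y :=
        MeasureTheory.lintegral_finsetSum _ fun C _ =>
          measurable_one.indicator measurableSet_Icc
    _ = ∑ C ∈ 𝒞, ENNReal.ofReal (sSup (h '' C) - sInf (h '' C)) :=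
        Finset.sum_congr rfl fun C _ => by
          rw [hG, MeasureTheory.lintegral_indicator_one measurableSet_Icc]

/-- Closed subarcs exhausting the open arcs of a decomposition show that the total variation is at
least the sum of the differences of the endpoint values. -/
theorem IsArcDecomp.le_manifoldTotalVariation (hW : IsArcDecomp W P 𝒞) (hh : Continuous h)
    (s : ∀ C : 𝒞, ArcParam C.1) :
    ∑ C : 𝒞, ENNReal.ofReal |h (s C).reverse.start - h (s C).start| ≤
      manifoldTotalVariation h := by
  -- affine reparametrization; the subarcs below correspond to `[δ, 1 - δ]`
  set l : 𝒞 → ℝ → ℝ := fun C δ => (s C).a + δ * ((s C).b - (s C).a)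
  have hl : ∀ C, Continuous (l C) := fun C => by fun_prop
  have hlmem : ∀ C, ∀ δ ∈ Set.Icc (0 : ℝ) 1, l C δ ∈ Set.Icc (s C).a (s C).b := by
    intro C δ hδ
    have := (s C).lt
    constructor <;> simp only [l] <;> nlinarith [hδ.1, hδ.2]
  have hlmem' : ∀ C, ∀ δ ∈ Set.Ioo (0 : ℝ) 1, l C δ ∈ Set.Ioo (s C).a (s C).b := by
    intro C δ hδ
    have := (s C).lt
    constructor <;> simp only [l] <;>
      nlinarith [mul_pos hδ.1 (sub_pos.2 this), mul_pos (sub_pos.2 hδ.2) (sub_pos.2 this)]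
  have hle : ∀ δ ∈ Set.Ioo (0 : ℝ) (1 / 2),
      ∑ C : 𝒞, ENNReal.ofReal |h ((s C).γ (l C (1 - δ))) - h ((s C).γ (l C δ))| ≤
        manifoldTotalVariation h := by
    intro δ hδ
    have hδI : ∀ t : unitInterval, δ + t * (1 - 2 * δ) ∈ Set.Ioo (0 : ℝ) 1 := by
      intro t
      have h1 := hδ.1
      have h2 : 0 < 1 - 2 * δ := by linarith [hδ.2]
      constructor
      · nlinarith [t.2.1]
      · nlinarith [t.2.2]
    set e := (Fintype.equivFin 𝒞).symm
    set γ : 𝒞 → C(unitInterval, X) := fun C =>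
      ⟨fun t => (s C).γ (l C (δ + t * (1 - 2 * δ))),
        (s C).continuousOn.comp_continuous (by fun_prop)
          fun t => hlmem C _ (Set.Ioo_subset_Icc_self (hδI t))⟩
    have hinj : ∀ C, Function.Injective (γ C) := by
      intro C t u htu
      have h1 := (s C).injOn (hlmem' C _ (hδI t)) (hlmem' C _ (hδI u)) htu
      have h2 : (s C).b - (s C).a ≠ 0 := (sub_pos.2 (s C).lt).ne'
      have h3 : (1 - 2 * δ) ≠ 0 := by linarith [hδ.2]
      exact Subtype.ext (mul_right_cancel₀ h3 (add_left_cancel (mul_right_cancel₀ h2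
        (add_left_cancel h1))))
    have hsub : ∀ C S, γ C '' S ⊆ C.1 := by
      rintro C S _ ⟨t, -, rfl⟩
      exact (s C).image_eq.subset ⟨_, hlmem' C _ (hδI t), rfl⟩
    refine le_trans ?_ (le_iSup_of_le _ (le_iSup_of_le (fun i => γ (e i)) (le_iSup_of_le
      (fun i => hinj _) (le_iSup_of_le (fun i j hij => ?_) le_rfl))))
    · rw [← e.sum_comp]
      refine Finset.sum_le_sum fun i _ => le_of_eq ?_
      have h0 : γ (e i) 0 = (s (e i)).γ (l (e i) δ) := by simp [γ]
      have h1 : γ (e i) 1 = (s (e i)).γ (l (e i) (1 - δ)) := by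
        change (s (e i)).γ (l (e i) (δ + ((1 : unitInterval) : ℝ) * (1 - 2 * δ))) = _
        congr 2
        rw [Set.Icc.coe_one]
        ring
      rw [h0, h1]
    · exact (hW.disjoint _ (e i).2 _ (e j).2 fun h => hij (e.injective (Subtype.ext h))).mono
        (hsub _ _) (hsub _ _)
  have htend : Tendsto (fun δ : ℝ => ∑ C : 𝒞,
      ENNReal.ofReal |h ((s C).γ (l C (1 - δ))) - h ((s C).γ (l C δ))|) (𝓝[>] 0)
      (𝓝 (∑ C : 𝒞, ENNReal.ofReal |h (s C).reverse.start - h (s C).start|)) := by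
    refine tendsto_finsetSum _ fun C _ => ENNReal.tendsto_ofReal ?_
    have hc : ContinuousOn (fun δ => h ((s C).γ (l C δ))) (Set.Icc 0 1) :=
      (hh.comp_continuousOn (s C).continuousOn).comp (hl C).continuousOn (hlmem C)
    have hr : ContinuousOn (fun δ : ℝ => h ((s C).γ (l C (1 - δ)))) (Set.Icc 0 1) :=
      hc.comp (by fun_prop) fun δ hδ => ⟨by linarith [hδ.2], by linarith [hδ.1]⟩
    have habs := ((hr.sub hc).abs 0 (Set.left_mem_Icc.2 zero_le_one)).mono
      Set.Ioo_subset_Icc_self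
    have h0 : l C 0 = (s C).a := by simp [l]
    have h1 : l C (1 - 0) = (s C).b := by simp [l]
    rw [ContinuousWithinAt, nhdsWithin_Ioo_eq_nhdsGT zero_lt_one, Pi.sub_apply, h0, h1,
      ← ArcParam.start_reverse] at habs
    exact habs
  refine le_of_tendsto htend ?_
  filter_upwards [Ioo_mem_nhdsGT (show (0 : ℝ) < 1 / 2 by norm_num)] with δ hδ using hle δ hδ

end TotalVariation

theorem mainTheorem10 (O : OMinimalStructure) {n : ℕ} (M : Set (Fin n → ℝ)) (hM : M ∈ O.Def n)
    [ChartedSpace ℝ M] (h : M → ℝ) (hdef : O.IsDefinableFun h) (hcont : Continuous h)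
    (hsupp : HasCompactSupport h) :
    manifoldTotalVariation h ≠ ⊤ ∧
    ∃ I J : ℝ, O.HasFloorIntegral h I ∧ O.HasCeilIntegral h J ∧
      I = -J ∧ I = 1 / 2 * (manifoldTotalVariation h).toReal := by
  classical
  set K : Set M := tsupport h
  have hK : IsCompact K := hsupp
  set W : Set M := {p | h p ≠ 0}
  have hWK : W ⊆ K := subset_tsupport h
  have hWopen : IsOpen W := isOpen_ne_fun hcont continuous_const
  have hWdef : O.DefSub W :=
    (hdef.preimage (Set.ordConnected_singleton (a := (0 : ℝ)))).compl hM
  -- the points where a coordinate or `h` turns become vertices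
  set F : Set M := (⋃ i, OMinimalStructure.turningPoints fun p : M => (p : Fin n → ℝ) i) ∪
    OMinimalStructure.turningPoints h
  have hF : F.Finite := (Set.finite_iUnion fun i =>
    (OMinimalStructure.isDefinableFun_coord hM i).finite_turningPoints hM).union
      (hdef.finite_turningPoints hM)
  obtain ⟨P₀, 𝒞, hdec₀, hdefC⟩ := OMinimalStructure.hasDefDecomp_of_subset_isCompact hM hK
    (hWdef.diff (OMinimalStructure.DefSub.of_finite hM hF)) (Set.sdiff_subset.trans hWK)
  have hWF : (W ∩ F).Finite := hF.subset Set.inter_subset_right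
  have hfin : IsArcDecomp (W ∩ F) hWF.toFinset ∅ := ⟨by simp, by simp, by simp, by simp⟩
  obtain ⟨hW, -, -⟩ := hdec₀.union hfin (Set.disjoint_left.2 fun p hp hp' => hp.2 hp'.2)
  rw [Finset.union_empty, Set.sdiff_union_inter] at hW
  set P := P₀ ∪ hWF.toFinset
  have hCF : ∀ C ∈ 𝒞, Disjoint C F := fun C hC =>
    Set.disjoint_left.2 fun p hp => (hdec₀.subset hC hp).2
  have hmono : ∀ {f : M → ℝ}, Continuous f → OMinimalStructure.turningPoints f ⊆ F → ∀ C ∈ 𝒞,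
      (∃ c, ∀ p ∈ C, f p = c) ∨ Set.InjOn f C := fun hf hsub C hC =>
    (OMinimalStructure.const_or_injOn_of_isArc hf (hW.isArc C hC) ((hCF C hC).mono_right hsub)).imp
      And.right And.right
  have hm := hmono hcont Set.subset_union_right
  have hb : ∀ C ∈ 𝒞, BddBelow (h '' C) := fun C hC =>
    (hK.image hcont).bddBelow.mono (Set.image_mono ((hW.subset hC).trans hWK))
  have hB : ∀ C ∈ 𝒞, BddAbove (h '' C) := fun C hC =>
    (hK.image hcont).bddAbove.mono (Set.image_mono ((hW.subset hC).trans hWK))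
  have hparam : ∀ C : 𝒞, Nonempty (ArcParam C.1) := fun C =>
    nonempty_arcParam (hW.isArc C.1 C.2) hK ((hW.subset C.2).trans hWK) fun i =>
      hmono (OMinimalStructure.continuous_coord i) (Set.subset_union_of_subset_left
        (Set.subset_iUnion
          (fun i => OMinimalStructure.turningPoints fun p : M => (p : Fin n → ℝ) i) i) _) C.1 C.2
  set s : ∀ C : 𝒞, ArcParam C.1 := fun C => (hparam C).some
  have hval := fun C : 𝒞 => (s C).values_of_const_or_injOn hcont (hm C.1 C.2) (hb C.1 C.2)
    (hB C.1 C.2)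
  have hle : ∀ C ∈ 𝒞, 0 ≤ sSup (h '' C) - sInf (h '' C) := fun C hC => by
    obtain ⟨p, hp⟩ := (hW.isArc C hC).nonempty
    exact sub_nonneg.2 ((csInf_le (hb C hC) ⟨p, hp, rfl⟩).trans (le_csSup (hB C hC) ⟨p, hp, rfl⟩))
  -- an end of an arc is a vertex or lies outside the open set `W`, where `h` vanishes
  have hends : ∑ C ∈ 𝒞, (sInf (h '' C) + sSup (h '' C)) = 2 * ∑ p ∈ P, h p := by
    rw [← hW.sum_ends s fun p hp => hWopen.mem_nhds hp, ← Finset.sum_coe_sort]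
    refine Finset.sum_congr rfl fun C _ => ?_
    rcases hval C with ⟨h1, h2⟩ | ⟨h1, h2⟩
    · rw [h1, h2]
    · rw [h1, h2, add_comm]
  have htv : manifoldTotalVariation h =
      ENNReal.ofReal (∑ C ∈ 𝒞, (sSup (h '' C) - sInf (h '' C))) := by
    rw [ENNReal.ofReal_sum_of_nonneg hle]
    refine le_antisymm (hW.manifoldTotalVariation_le hcont (fun p hp => hp) hm hb hB) ?_
    refine le_trans (le_of_eq ?_) (hW.le_manifoldTotalVariation hcont s)
    rw [← Finset.sum_coe_sort]
    refine Finset.sum_congr rfl fun C _ => congrArg ENNReal.ofReal ?_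
    rcases hval C with ⟨h1, h2⟩ | ⟨h1, h2⟩
    · rw [h1, h2, abs_of_nonneg (hle C.1 C.2)]
    · rw [h1, h2, abs_sub_comm, abs_of_nonneg (hle C.1 C.2)]
  have hfloor := OMinimalStructure.hasFloorIntegral_of_isArcDecomp hM hK hWK hW hdefC hcont
    (fun y => hdef.preimage (Set.ordConnected_Ici (a := y))) (fun p hp => hp) hm
  -- `-h` need not be definable, but its superlevel sets are
  have hlev : ∀ y, O.DefSub {p | y ≤ -h p} := fun y => by
    have := hdef.preimage (Set.ordConnected_Iic (a := -y))
    convert this using 1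
    ext p
    change y ≤ -h p ↔ h p ≤ -y
    exact le_neg
  have hceil := (OMinimalStructure.hasFloorIntegral_of_isArcDecomp (g := fun p => -h p)
    hM hK hWK hW hdefC hcont.neg hlev (fun p hp => neg_ne_zero.1 hp) fun C hC => (hm C hC).imp
      (fun ⟨c, hc⟩ => ⟨-c, fun p hp => congrArg Neg.neg (hc p hp)⟩)
      fun hi => neg_injective.comp_injOn hi).hasCeilIntegral_of_neg
  have hneg : ∀ C, sInf ((fun p => -h p) '' C) = -sSup (h '' C) := fun C => by
    rw [← Real.sInf_neg, ← Set.image_neg_eq_neg, Set.image_image]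
  simp only [hneg, Finset.sum_neg_distrib] at hceil
  rw [Finset.sum_add_distrib] at hends
  refine ⟨by rw [htv]; exact ENNReal.ofReal_ne_top, _, _, hfloor, hceil, ?_, ?_⟩
  · linarith
  · rw [htv, ENNReal.toReal_ofReal (Finset.sum_nonneg hle), Finset.sum_sub_distrib]
    linarith
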